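/- Let $(M,g)$ be a smooth Riemannian manifold of dimension $m$ with Levi-Civita connection $\nabla$ and curvature tensor $R(X,Y)Z=[\nabla_X,\nabla_Y]Z-\nabla_{[X,Y]}Z$. All components below are taken with respect to an orthonormal basis $(e_i)$ of a tangent space, repeated indices are summed from $1$ to $m$, $R_{abcd}=g(R(e_a,e_b)e_c,e_d)$, and $R_{abcd;i}=(\nabla_{e_i}R)(e_a,e_b,e_c,e_d)$. Let $\mathfrak S$ denote summation over all permutations of the free indices inside the parentheses. Call $(M,g)$ asymptotic harmonic up to order $3$ if there are real constants $\Lambda_1,\Lambda_2,\Lambda_3$ such that, at every point of $M$ and in every orthonormal basis, $$H_1:\quad R_{aija}=\Lambda_1\,g_{ij},$$ $$H_2:\quad \mathfrak S(R_{aijb}R_{bkla})=\Lambda_2\,\mathfrak S(g_{ij}g_{kl}),$$ $$H_3:\quad \mathfrak S(32R_{aijb}R_{bklc}R_{cuva}-9R_{aijb;k}R_{buva;l})=\Lambda_3\,\mathfrak S(g_{ij}g_{kl}g_{uv}).$$ Put $$|R|^2=R_{abcd}R_{abcd},\quad |\nabla R|^2=R_{abcd;i}R_{abcd;i},\quad \hat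 R=R_{abcd}R_{abuv}R_{cduv},\quad \mathring R=R_{abcd}R_{aucv}R_{budv}.$$ If $(M,g)$ is asymptotic harmonic up to order $3$, then: 1. $(M,g)$ is $2$-stein, that is, it is Einstein (there is a constant $\Lambda$ with $\operatorname{tr}R_x=\Lambda|x|^2$ for all tangent vectors $x$, where $R_x=R(\cdot,x)x$ is the Jacobi operator), and there is a function $\mu:M\to\mathbb R$ with $\operatorname{tr}(R_x^2)=\mu(p)|x|^4$ for all $p\in M$ and $x\in T_pM$; 2. $|R|^2$ is constant on $M$; 3. $|\nabla R|^2+\hat R+4\mathring R$ is constant on $M$; 4. $27|\nabla R|^2+112\hat R-32\mathring R$ is constant on $M$; 5. hence $17\hat R-28\mathring R$ is constant on $M$. -/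

import Mathlib

open scoped Manifold ContDiff

noncomputable section

namespace AsymptoticHarmonic

/-! ### Riemannian geometry of a metric on an open subset of Euclidean space

`G y v w` is the metric at the point `y`, evaluated on the (constant) vectors `v` and `w`. -/

section Coordinates

variable {m : ℕ}

/-- Christoffel symbols of the first kind:
`(D_u G(v, w) + D_v G(u, w) - D_w G(u, v)) / 2`. -/
def christoffelFirst
    (G : EuclideanSpace ℝ (Fin m) → EuclideanSpace ℝ (Fin m) → EuclideanSpace ℝ (Fin m) → ℝ)
    (y u v w : EuclideanSpace ℝ (Fin m)) : ℝ :=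
  (fderiv ℝ (fun z => G z v w) y u + fderiv ℝ (fun z => G z u w) y v
    - fderiv ℝ (fun z => G z u v) y w) / 2

/-- The matrix `(g_{ij})` of the metric in the standard basis. -/
def gramMatrix
    (G : EuclideanSpace ℝ (Fin m) → EuclideanSpace ℝ (Fin m) → EuclideanSpace ℝ (Fin m) → ℝ)
    (y : EuclideanSpace ℝ (Fin m)) : Matrix (Fin m) (Fin m) ℝ :=
  Matrix.of fun i j => G y (EuclideanSpace.single i 1) (EuclideanSpace.single j 1)

/-- Christoffel symbols of the second kind, i.e. the Levi-Civita derivative `∇_u v` at `y`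
of the constant vector field `v` : `∑ g^{kl} Γ_{uv,l} ∂_k`. -/
def christoffel
    (G : EuclideanSpace ℝ (Fin m) → EuclideanSpace ℝ (Fin m) → EuclideanSpace ℝ (Fin m) → ℝ)
    (y u v : EuclideanSpace ℝ (Fin m)) : EuclideanSpace ℝ (Fin m) :=
  ∑ k, ∑ l, ((gramMatrix G y)⁻¹ k l * christoffelFirst G y u v (EuclideanSpace.single l 1)) •
    EuclideanSpace.single k 1

/-- The curvature operator `R(u, v) w = ∇_u ∇_v w - ∇_v ∇_u w` at `y`, for constant vector
fields `u`, `v`, `w` (so that `[u, v] = 0`). -/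
def curvatureOp
    (G : EuclideanSpace ℝ (Fin m) → EuclideanSpace ℝ (Fin m) → EuclideanSpace ℝ (Fin m) → ℝ)
    (y u v w : EuclideanSpace ℝ (Fin m)) : EuclideanSpace ℝ (Fin m) :=
  fderiv ℝ (fun z => christoffel G z v w) y u - fderiv ℝ (fun z => christoffel G z u w) y v
    + christoffel G y u (christoffel G y v w) - christoffel G y v (christoffel G y u w)

/-- The curvature tensor with all indices lowered: `R(a, b, c, d) = G(R(a, b) c, d)`. -/
def curvatureCoord
    (G : EuclideanSpace ℝ (Fin m) → EuclideanSpace ℝ (Fin m) → EuclideanSpace ℝ (Fin m) → ℝ)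
    (y a b c d : EuclideanSpace ℝ (Fin m)) : ℝ :=
  G y (curvatureOp G y a b c) d

/-- The covariant derivative `(∇_x R)(a, b, c, d)` of the curvature tensor. -/
def nablaCurvatureCoord
    (G : EuclideanSpace ℝ (Fin m) → EuclideanSpace ℝ (Fin m) → EuclideanSpace ℝ (Fin m) → ℝ)
    (y x a b c d : EuclideanSpace ℝ (Fin m)) : ℝ :=
  fderiv ℝ (fun z => curvatureCoord G z a b c d) y x
    - curvatureCoord G y (christoffel G y x a) b c d
    - curvatureCoord G y a (christoffel G y x b) c d
    - curvatureCoord G y a b (christoffel G y x c) d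
    - curvatureCoord G y a b c (christoffel G y x d)

end Coordinates

/-! ### Curvature of a Riemannian manifold -/

section Manifold

variable {m : ℕ} {M : Type*} [TopologicalSpace M] [ChartedSpace (EuclideanSpace ℝ (Fin m)) M]
  [IsManifold (𝓡 m) ∞ M]

/-- The metric `g` read in the coordinate chart at `p` : the pullback of `g` under the inverse
of the chart. -/
def metricInChart
    (g : Bundle.ContMDiffRiemannianMetric (𝓡 m) ∞ (EuclideanSpace ℝ (Fin m))
      (fun q : M => TangentSpace (𝓡 m) q))
    (p : M) (y v w : EuclideanSpace ℝ (Fin m)) : ℝ :=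
  g.inner ((extChartAt (𝓡 m) p).symm y)
    (mfderiv 𝓘(ℝ, EuclideanSpace ℝ (Fin m)) (𝓡 m) (extChartAt (𝓡 m) p).symm y v)
    (mfderiv 𝓘(ℝ, EuclideanSpace ℝ (Fin m)) (𝓡 m) (extChartAt (𝓡 m) p).symm y w)

/-- Coordinates of a tangent vector at `p` in the chart at `p`. -/
def toChart (p : M) (v : TangentSpace (𝓡 m) p) : EuclideanSpace ℝ (Fin m) :=
  mfderiv (𝓡 m) 𝓘(ℝ, EuclideanSpace ℝ (Fin m)) (extChartAt (𝓡 m) p) p v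

/-- The curvature tensor `R(a, b, c, d) = g(R(a, b) c, d)` at `p`, where
`R(X, Y) Z = [∇_X, ∇_Y] Z - ∇_{[X, Y]} Z` for the Levi-Civita connection `∇`. -/
def curvature
    (g : Bundle.ContMDiffRiemannianMetric (𝓡 m) ∞ (EuclideanSpace ℝ (Fin m))
      (fun q : M => TangentSpace (𝓡 m) q))
    (p : M) (a b c d : TangentSpace (𝓡 m) p) : ℝ :=
  curvatureCoord (metricInChart g p) (extChartAt (𝓡 m) p p)
    (toChart p a) (toChart p b) (toChart p c) (toChart p d)

/-- The covariant derivative of the curvature tensor at `p` : the argument `x` is the direction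
of differentiation, so that `nablaCurvature g p (e i) (e a) (e b) (e c) (e d)` is `R_{abcd;i}`. -/
def nablaCurvature
    (g : Bundle.ContMDiffRiemannianMetric (𝓡 m) ∞ (EuclideanSpace ℝ (Fin m))
      (fun q : M => TangentSpace (𝓡 m) q))
    (p : M) (x a b c d : TangentSpace (𝓡 m) p) : ℝ :=
  nablaCurvatureCoord (metricInChart g p) (extChartAt (𝓡 m) p p)
    (toChart p x) (toChart p a) (toChart p b) (toChart p c) (toChart p d)

/-- Orthonormal bases of the tangent space at `p`. -/
def IsOrthonormalFrame
    (g : Bundle.ContMDiffRiemannianMetric (𝓡 m) ∞ (EuclideanSpace ℝ (Fin m))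
      (fun q : M => TangentSpace (𝓡 m) q))
    (p : M) (e : Fin m → TangentSpace (𝓡 m) p) : Prop :=
  ∀ i j, g.inner p (e i) (e j) = if i = j then 1 else 0

/-! Scalar curvature invariants, in an orthonormal basis `e` of the tangent space at `p`. -/

/-- `|R|² = R_{abcd} R_{abcd}`. -/
def normSqR
    (g : Bundle.ContMDiffRiemannianMetric (𝓡 m) ∞ (EuclideanSpace ℝ (Fin m))
      (fun q : M => TangentSpace (𝓡 m) q))
    (p : M) (e : Fin m → TangentSpace (𝓡 m) p) : ℝ :=
  ∑ a, ∑ b, ∑ c, ∑ d, curvature g p (e a) (e b) (e c) (e d) ^ 2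

/-- `|∇R|² = R_{abcd;i} R_{abcd;i}`. -/
def normSqNablaR
    (g : Bundle.ContMDiffRiemannianMetric (𝓡 m) ∞ (EuclideanSpace ℝ (Fin m))
      (fun q : M => TangentSpace (𝓡 m) q))
    (p : M) (e : Fin m → TangentSpace (𝓡 m) p) : ℝ :=
  ∑ i, ∑ a, ∑ b, ∑ c, ∑ d, nablaCurvature g p (e i) (e a) (e b) (e c) (e d) ^ 2

/-- `R̂ = R_{abcd} R_{abuv} R_{cduv}`. -/
def hatR
    (g : Bundle.ContMDiffRiemannianMetric (𝓡 m) ∞ (EuclideanSpace ℝ (Fin m))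
      (fun q : M => TangentSpace (𝓡 m) q))
    (p : M) (e : Fin m → TangentSpace (𝓡 m) p) : ℝ :=
  ∑ a, ∑ b, ∑ c, ∑ d, ∑ u, ∑ v,
    curvature g p (e a) (e b) (e c) (e d) * curvature g p (e a) (e b) (e u) (e v) *
      curvature g p (e c) (e d) (e u) (e v)

/-- `R̊ = R_{abcd} R_{aucv} R_{budv}`. -/
def ringR
    (g : Bundle.ContMDiffRiemannianMetric (𝓡 m) ∞ (EuclideanSpace ℝ (Fin m))
      (fun q : M => TangentSpace (𝓡 m) q))
    (p : M) (e : Fin m → TangentSpace (𝓡 m) p) : ℝ :=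
  ∑ a, ∑ b, ∑ c, ∑ d, ∑ u, ∑ v,
    curvature g p (e a) (e b) (e c) (e d) * curvature g p (e a) (e u) (e c) (e v) *
      curvature g p (e b) (e u) (e d) (e v)

/-! ### The conditions `H₁`, `H₂`, `H₃` -/

/-- `𝔖` : the sum over all permutations of the `n` free indices. -/
def symSum {n : ℕ} {ι : Type*} (T : (Fin n → ι) → ℝ) (i : Fin n → ι) : ℝ :=
  ∑ σ : Equiv.Perm (Fin n), T (i ∘ σ)

/-- `R_{aija} = Λ₁ g_{ij}` with a constant `Λ₁`. -/
def ConditionH₁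
    (g : Bundle.ContMDiffRiemannianMetric (𝓡 m) ∞ (EuclideanSpace ℝ (Fin m))
      (fun q : M => TangentSpace (𝓡 m) q)) : Prop :=
  ∃ Λ : ℝ, ∀ (p : M) (e : Fin m → TangentSpace (𝓡 m) p), IsOrthonormalFrame g p e →
    ∀ i j : Fin m,
      ∑ a, curvature g p (e a) (e i) (e j) (e a) = Λ * g.inner p (e i) (e j)

/-- `𝔖(R_{aijb} R_{bkla}) = Λ₂ 𝔖(g_{ij} g_{kl})` with a constant `Λ₂`;
the free indices `i, j, k, l` are `i 0, …, i 3`. -/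
def ConditionH₂
    (g : Bundle.ContMDiffRiemannianMetric (𝓡 m) ∞ (EuclideanSpace ℝ (Fin m))
      (fun q : M => TangentSpace (𝓡 m) q)) : Prop :=
  ∃ Λ : ℝ, ∀ (p : M) (e : Fin m → TangentSpace (𝓡 m) p), IsOrthonormalFrame g p e →
    ∀ i : Fin 4 → Fin m,
      symSum (fun i => ∑ a, ∑ b,
          curvature g p (e a) (e (i 0)) (e (i 1)) (e b) *
            curvature g p (e b) (e (i 2)) (e (i 3)) (e a)) i =
        Λ * symSum (fun i =>
          g.inner p (e (i 0)) (e (i 1)) * g.inner p (e (i 2)) (e (i 3))) i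

/-- `𝔖(32 R_{aijb} R_{bklc} R_{cuva} - 9 R_{aijb;k} R_{buva;l}) = Λ₃ 𝔖(g_{ij} g_{kl} g_{uv})`
with a constant `Λ₃`; the free indices `i, j, k, l, u, v` are `i 0, …, i 5`. -/
def ConditionH₃
    (g : Bundle.ContMDiffRiemannianMetric (𝓡 m) ∞ (EuclideanSpace ℝ (Fin m))
      (fun q : M => TangentSpace (𝓡 m) q)) : Prop :=
  ∃ Λ : ℝ, ∀ (p : M) (e : Fin m → TangentSpace (𝓡 m) p), IsOrthonormalFrame g p e →
    ∀ i : Fin 6 → Fin m,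
      symSum (fun i =>
          32 * (∑ a, ∑ b, ∑ c,
            curvature g p (e a) (e (i 0)) (e (i 1)) (e b) *
              curvature g p (e b) (e (i 2)) (e (i 3)) (e c) *
              curvature g p (e c) (e (i 4)) (e (i 5)) (e a))
          - 9 * (∑ a, ∑ b,
            nablaCurvature g p (e (i 2)) (e a) (e (i 0)) (e (i 1)) (e b) *
              nablaCurvature g p (e (i 3)) (e b) (e (i 4)) (e (i 5)) (e a))) i =
        Λ * symSum (fun i =>
          g.inner p (e (i 0)) (e (i 1)) * g.inner p (e (i 2)) (e (i 3)) *
            g.inner p (e (i 4)) (e (i 5))) i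

/-- Asymptotic harmonic manifolds up to order 3. -/
def IsAsymptoticHarmonicUpToThree
    (g : Bundle.ContMDiffRiemannianMetric (𝓡 m) ∞ (EuclideanSpace ℝ (Fin m))
      (fun q : M => TangentSpace (𝓡 m) q)) : Prop :=
  ConditionH₁ g ∧ ConditionH₂ g ∧ ConditionH₃ g

/-- `2`-stein manifolds: Einstein manifolds such that, for the Jacobi operators
`R_x = R(·, x) x`, one has `tr (R_x²) = μ(p) |x|⁴` for all `x` in the tangent space at `p`,
where `μ` is a function on the manifold.  (The Einstein condition is `tr R_x = Λ |x|²`.) -/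
def IsTwoStein
    (g : Bundle.ContMDiffRiemannianMetric (𝓡 m) ∞ (EuclideanSpace ℝ (Fin m))
      (fun q : M => TangentSpace (𝓡 m) q)) : Prop :=
  (∃ Λ : ℝ, ∀ (p : M) (e : Fin m → TangentSpace (𝓡 m) p), IsOrthonormalFrame g p e →
    ∀ x : TangentSpace (𝓡 m) p,
      ∑ a, curvature g p (e a) x x (e a) = Λ * g.inner p x x) ∧
  (∃ μ : M → ℝ, ∀ (p : M) (e : Fin m → TangentSpace (𝓡 m) p), IsOrthonormalFrame g p e →
    ∀ x : TangentSpace (𝓡 m) p,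
      ∑ a, ∑ b, curvature g p (e a) x x (e b) * curvature g p (e b) x x (e a) =
        μ p * g.inner p x x ^ 2)

/-- The scalar `f`, computed in orthonormal bases of the tangent spaces, is constant on `M`:
it takes the same value at all points and in all orthonormal bases. -/
def IsConstantScalar
    (g : Bundle.ContMDiffRiemannianMetric (𝓡 m) ∞ (EuclideanSpace ℝ (Fin m))
      (fun q : M => TangentSpace (𝓡 m) q))
    (f : (p : M) → (Fin m → TangentSpace (𝓡 m) p) → ℝ) : Prop :=
  ∃ c : ℝ, ∀ (p : M) (e : Fin m → TangentSpace (𝓡 m) p), IsOrthonormalFrame g p e → f p e = c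

end Manifold

end AsymptoticHarmonic

end

/-! The theorem compares scalar invariants of the curvature. Contracting H₂ with four copies of the
components of a vector `x`, symmetrization contributes only a factor 4! on both sides, so H₂ is the
polynomial identity tr(R_x²) = Λ₂|x|⁴ (`quadForm_polynomial`); with H₁ this is the 2-stein property.
Contracting the four free indices of H₂ in pairs instead turns its left side into 8(mΛ₁² + 3/2 |R|²)
(`sum_symSum_quadForm`), so |R|² is constant.

Since |R|² is constant, its Laplacian vanishes: |∇R|² + ⟨ΔR, R⟩ = 0. The curvature of an Einstein
metric is divergence free, so the second Bianchi identity and the Ricci identity reduce ΔR to terms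
quadratic in R, and ⟨ΔR, R⟩ = 2Λ₁|R|² + R̂ + 4R̊ (`IsAlgCurv.sum_laplacian`,
`IsMetricOn.gradSq_eq`). This is assertion 3. The full contraction of H₃ runs over the fifteen
pairings of six slots. It gives 48(mΛ₁³ + 9/2 Λ₁|R|² − 7/2 R̂ + R̊) for the cubic part and 48 ·
3|∇R|² for the gradient part (`sum_symSum_cubicForm`, `sum_symSum_gradForm`), which is assertion 4.
Eliminating |∇R|² between the two leaves 5(17R̂ − 28R̊).

The analytic difficulty is that the curvature at a point is computed in the chart at that very
point, whereas differentiation needs one chart on a neighbourhood. Naturality of the curvature under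
transition maps (`IsPullbackOn.curvatureCoord_eq`) carries the Einstein condition and the constancy
of |R|² over to the whole chart at `p`. There they are differentiated along geodesics in parallel
orthonormal frames, where the ordinary derivative of tensor components is the covariant derivative.
H₃ is used at `p` only, so no naturality of ∇R is required. -/

noncomputable section
namespace AsymptoticHarmonic

open Filter Topology

/-- The Euclidean space that serves as coordinate space. -/
abbrev Euc (m : ℕ) := EuclideanSpace ℝ (Fin m)

/-! ### Maps that are linear in one slot -/

section Slot

variable {m : ℕ} {X F : Type*} [NormedAddCommGroup X] [NormedSpace ℝ X]
  [NormedAddCommGroup F] [NormedSpace ℝ F]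

/-- Tensor fields are handled here as plain functions that are linear in each slot. Expansion in the
standard basis reduces joint regularity in the base point and the argument to regularity at fixed
vectors. -/
theorem isLinearMap_apply_eq_sum {V : Type*} [AddCommGroup V] [Module ℝ V] {L : Euc m → V}
    (hL : IsLinearMap ℝ L) (w : Euc m) :
    L w = ∑ k, w k • L (EuclideanSpace.single k (1 : ℝ)) := by
  have h1 : w = ∑ k, w k • EuclideanSpace.single k (1 : ℝ) := by
    have := (EuclideanSpace.basisFun (Fin m) ℝ).sum_repr w
    simpa using this.symm
  conv_lhs => rw [h1]
  change hL.mk' L _ = _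
  rw [map_sum]
  simp

theorem isLinearMap_sum {V ι : Type*} [AddCommGroup V] [Module ℝ V] {L : Euc m → V}
    (hL : IsLinearMap ℝ L) (s : Finset ι) (c : ι → ℝ) (e : ι → Euc m) :
    L (∑ k ∈ s, c k • e k) = ∑ k ∈ s, c k • L (e k) := by
  change hL.mk' L _ = _
  rw [map_sum]
  simp

theorem hasFDerivAt_coord {w : X → Euc m} {w' : X →L[ℝ] Euc m} {x₀ : X}
    (hw : HasFDerivAt w w' x₀) (k : Fin m) :
    HasFDerivAt (fun x => w x k) ((EuclideanSpace.proj k : Euc m →L[ℝ] ℝ).comp w') x₀ :=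
  ((EuclideanSpace.proj k : Euc m →L[ℝ] ℝ).hasFDerivAt).comp x₀ hw

/-- Product rule for `x ↦ L x (w x)` where `L x` is linear. -/
theorem hasFDerivAt_slot {L : X → Euc m → F} {L' : Euc m → X →L[ℝ] F} {w : X → Euc m}
    {w' : X →L[ℝ] Euc m} {x₀ : X} (hlin : ∀ᶠ x in 𝓝 x₀, IsLinearMap ℝ (L x))
    (hL : ∀ v, HasFDerivAt (fun x => L x v) (L' v) x₀) (hw : HasFDerivAt w w' x₀) :
    HasFDerivAt (fun x => L x (w x))
      (L' (w x₀) + (hlin.self_of_nhds.mk' (L x₀)).toContinuousLinearMap.comp w') x₀ := by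
  -- The derivatives `L' v` are given one vector at a time. Uniqueness of the derivative provides
  -- the expansion of `L' (w x₀)`, because `L x` is linear for all `x` near `x₀`.
  have hL'lin : L' (w x₀) = ∑ k, w x₀ k • L' (EuclideanSpace.single k 1) := by
    have h1 : HasFDerivAt (fun x => ∑ k, w x₀ k • L x (EuclideanSpace.single k 1))
        (∑ k, w x₀ k • L' (EuclideanSpace.single k 1)) x₀ :=
      HasFDerivAt.fun_sum fun k _ => (hL _).const_smul _
    refine (hL (w x₀)).unique (h1.congr_of_eventuallyEq ?_)
    filter_upwards [hlin] with x hx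
    exact isLinearMap_apply_eq_sum hx _
  have h2 : HasFDerivAt (fun x => ∑ k, w x k • L x (EuclideanSpace.single k 1)) _ x₀ :=
    HasFDerivAt.fun_sum fun k _ => (hasFDerivAt_coord hw k).smul (hL (EuclideanSpace.single k 1))
  refine (h2.congr_of_eventuallyEq ?_).congr_fderiv ?_
  · filter_upwards [hlin] with x hx
    exact isLinearMap_apply_eq_sum hx _
  · ext u
    rw [hL'lin]
    simp only [Finset.sum_add_distrib, add_apply,
      ContinuousLinearMap.comp_apply, LinearMap.coe_toContinuousLinearMap', IsLinearMap.mk'_apply]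
    rw [isLinearMap_apply_eq_sum hlin.self_of_nhds (w' u)]
    simp

theorem differentiableAt_slot {L : X → Euc m → F} {w : X → Euc m} {x₀ : X}
    (hlin : ∀ᶠ x in 𝓝 x₀, IsLinearMap ℝ (L x))
    (hL : ∀ v, DifferentiableAt ℝ (fun x => L x v) x₀) (hw : DifferentiableAt ℝ w x₀) :
    DifferentiableAt ℝ (fun x => L x (w x)) x₀ :=
  (hasFDerivAt_slot hlin (fun v => (hL v).hasFDerivAt) hw.hasFDerivAt).differentiableAt

theorem fderiv_slot {L : X → Euc m → F} {w : X → Euc m} {x₀ : X}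
    (hlin : ∀ᶠ x in 𝓝 x₀, IsLinearMap ℝ (L x))
    (hL : ∀ v, DifferentiableAt ℝ (fun x => L x v) x₀) (hw : DifferentiableAt ℝ w x₀) (u : X) :
    fderiv ℝ (fun x => L x (w x)) x₀ u =
      fderiv ℝ (fun x => L x (w x₀)) x₀ u + L x₀ (fderiv ℝ w x₀ u) := by
  rw [(hasFDerivAt_slot hlin (fun v => (hL v).hasFDerivAt) hw.hasFDerivAt).fderiv]
  simp

theorem hasDerivAt_slot {L : ℝ → Euc m → F} {L' : Euc m → F} {w : ℝ → Euc m}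
    {w' : Euc m} {t₀ : ℝ} (hlin : ∀ᶠ t in 𝓝 t₀, IsLinearMap ℝ (L t))
    (hL : ∀ v, HasDerivAt (fun t => L t v) (L' v) t₀) (hw : HasDerivAt w w' t₀) :
    HasDerivAt (fun t => L t (w t)) (L' (w t₀) + L t₀ w') t₀ := by
  have := (hasFDerivAt_slot hlin (fun v => (hL v).hasFDerivAt) hw.hasFDerivAt).hasDerivAt
  simpa using this

theorem contDiffAt_slot {n : WithTop ℕ∞} {L : X → Euc m → F} {w : X → Euc m} {x₀ : X}
    (hlin : ∀ᶠ x in 𝓝 x₀, IsLinearMap ℝ (L x))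
    (hL : ∀ v, ContDiffAt ℝ n (fun x => L x v) x₀) (hw : ContDiffAt ℝ n w x₀) :
    ContDiffAt ℝ n (fun x => L x (w x)) x₀ := by
  have h2 : ContDiffAt ℝ n (fun x => ∑ k, w x k • L x (EuclideanSpace.single k 1)) x₀ :=
    ContDiffAt.sum fun k _ =>
      ((EuclideanSpace.proj k : Euc m →L[ℝ] ℝ).contDiff.contDiffAt.comp x₀ hw).smul (hL _)
  refine h2.congr_of_eventuallyEq ?_
  filter_upwards [hlin] with x hx
  exact isLinearMap_apply_eq_sum hx _

theorem isLinearMap_fderiv {V : Type*} [AddCommGroup V] [Module ℝ V] {L : X → V → F} {x₀ : X}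
    (hlin : ∀ᶠ x in 𝓝 x₀, IsLinearMap ℝ (L x))
    (hL : ∀ v, DifferentiableAt ℝ (fun x => L x v) x₀) (u : X) :
    IsLinearMap ℝ (fun v => fderiv ℝ (fun x => L x v) x₀ u) where
  map_add v w := by
    have : (fun x => L x (v + w)) =ᶠ[𝓝 x₀] fun x => L x v + L x w := by
      filter_upwards [hlin] with x hx using hx.map_add v w
    rw [this.fderiv_eq, fderiv_fun_add (hL v) (hL w)]
    rfl
  map_smul c v := by
    have : (fun x => L x (c • v)) =ᶠ[𝓝 x₀] fun x => c • L x v := by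
      filter_upwards [hlin] with x hx using hx.map_smul c v
    rw [this.fderiv_eq, fderiv_fun_const_smul (hL v)]
    rfl

theorem isLinearMap_fderiv_apply (f : X → F) (x₀ : X) :
    IsLinearMap ℝ (fun u => fderiv ℝ f x₀ u) :=
  (fderiv ℝ f x₀).toLinearMap.isLinear

theorem contDiffAt_fderiv_apply {f : X → F} {x₀ : X} (hf : ContDiffAt ℝ ∞ f x₀) (u : X) :
    ContDiffAt ℝ ∞ (fun x => fderiv ℝ f x u) x₀ :=
  (hf.fderiv_right (m := ∞) (by simp)).clm_apply contDiffAt_const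

theorem fderiv_fderiv_comm {f : X → F} {x₀ : X} (hf : ContDiffAt ℝ ∞ f x₀) (u v : X) :
    fderiv ℝ (fun x => fderiv ℝ f x u) x₀ v = fderiv ℝ (fun x => fderiv ℝ f x v) x₀ u := by
  have hd : DifferentiableAt ℝ (fderiv ℝ f) x₀ :=
    (hf.fderiv_right (m := ∞) (by simp)).differentiableAt (by simp)
  have hs : IsSymmSndFDerivAt ℝ f x₀ := hf.isSymmSndFDerivAt (by simpa using ENat.LEInfty.out)
  rw [fderiv_clm_apply hd (by fun_prop), fderiv_clm_apply hd (by fun_prop)]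
  simpa using hs v u

end Slot

/-! ### Connections and metrics on an open set of the coordinate space -/

section Local

variable {m : ℕ}

/-- A smooth field of symmetric bilinear maps: the Christoffel symbols of a torsion-free
connection on `U`. -/
structure IsConnectionOn (U : Set (Euc m)) (Γ : Euc m → Euc m → Euc m → Euc m) : Prop where
  isOpen : IsOpen U
  lin_right : ∀ z ∈ U, ∀ u, IsLinearMap ℝ (Γ z u)
  symm : ∀ z ∈ U, ∀ u v, Γ z u v = Γ z v u
  smooth : ∀ z ∈ U, ∀ u v, ContDiffAt ℝ ∞ (fun y => Γ y u v) z

/-- The curvature operator of a connection. -/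
def connCurvature (Γ : Euc m → Euc m → Euc m → Euc m) (y u v w : Euc m) : Euc m :=
  fderiv ℝ (fun z => Γ z v w) y u - fderiv ℝ (fun z => Γ z u w) y v
    + Γ y u (Γ y v w) - Γ y v (Γ y u w)

/-- The covariant derivative of a field of `4`-linear forms. -/
def nab4 (Γ : Euc m → Euc m → Euc m → Euc m) (T : Euc m → Euc m → Euc m → Euc m → Euc m → ℝ)
    (y x a b c d : Euc m) : ℝ :=
  fderiv ℝ (fun z => T z a b c d) y x - T y (Γ y x a) b c d - T y a (Γ y x b) c d
    - T y a b (Γ y x c) d - T y a b c (Γ y x d)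

/-- The covariant derivative of a field of `5`-linear forms. -/
def nab5 (Γ : Euc m → Euc m → Euc m → Euc m)
    (T : Euc m → Euc m → Euc m → Euc m → Euc m → Euc m → ℝ) (y x e a b c d : Euc m) : ℝ :=
  fderiv ℝ (fun z => T z e a b c d) y x - T y (Γ y x e) a b c d - T y e (Γ y x a) b c d
    - T y e a (Γ y x b) c d - T y e a b (Γ y x c) d - T y e a b c (Γ y x d)

/-- A smooth field of `4`-linear forms on `U`. -/
structure IsTensor4On (U : Set (Euc m)) (T : Euc m → Euc m → Euc m → Euc m → Euc m → ℝ) :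
    Prop where
  lin1 : ∀ z ∈ U, ∀ b c d, IsLinearMap ℝ (fun a => T z a b c d)
  lin2 : ∀ z ∈ U, ∀ a c d, IsLinearMap ℝ (fun b => T z a b c d)
  lin3 : ∀ z ∈ U, ∀ a b d, IsLinearMap ℝ (fun c => T z a b c d)
  lin4 : ∀ z ∈ U, ∀ a b c, IsLinearMap ℝ (fun d => T z a b c d)
  smooth : ∀ z ∈ U, ∀ a b c d, ContDiffAt ℝ ∞ (fun y => T y a b c d) z

/-- A smooth field of `5`-linear forms on `U`. -/
structure IsTensor5On (U : Set (Euc m))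
    (T : Euc m → Euc m → Euc m → Euc m → Euc m → Euc m → ℝ) : Prop where
  lin0 : ∀ z ∈ U, ∀ a b c d, IsLinearMap ℝ (fun x => T z x a b c d)
  lin1 : ∀ z ∈ U, ∀ x b c d, IsLinearMap ℝ (fun a => T z x a b c d)
  lin2 : ∀ z ∈ U, ∀ x a c d, IsLinearMap ℝ (fun b => T z x a b c d)
  lin3 : ∀ z ∈ U, ∀ x a b d, IsLinearMap ℝ (fun c => T z x a b c d)
  lin4 : ∀ z ∈ U, ∀ x a b c, IsLinearMap ℝ (fun d => T z x a b c d)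
  smooth : ∀ z ∈ U, ∀ x a b c d, ContDiffAt ℝ ∞ (fun y => T y x a b c d) z

namespace IsConnectionOn

variable {U : Set (Euc m)} {Γ : Euc m → Euc m → Euc m → Euc m} (h : IsConnectionOn U Γ)
  {z : Euc m} (hz : z ∈ U)
include h hz

theorem lin_left (v : Euc m) : IsLinearMap ℝ (fun u => Γ z u v) := by
  have : (fun u => Γ z u v) = Γ z v := funext fun u => h.symm z hz u v
  rw [this]; exact h.lin_right z hz v

theorem mem_nhds : ∀ᶠ y in 𝓝 z, y ∈ U := h.isOpen.mem_nhds hz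

theorem diff (u v : Euc m) : DifferentiableAt ℝ (fun y => Γ y u v) z :=
  (h.smooth z hz u v).differentiableAt (by simp)

theorem lin_right_ev (u : Euc m) : ∀ᶠ y in 𝓝 z, IsLinearMap ℝ (fun v => Γ y u v) := by
  filter_upwards [h.mem_nhds hz] with y hy using h.lin_right y hy u

theorem lin_left_ev (v : Euc m) : ∀ᶠ y in 𝓝 z, IsLinearMap ℝ (fun u => Γ y u v) := by
  filter_upwards [h.mem_nhds hz] with y hy using h.lin_left hy v

theorem fderiv_comp_right (u : Euc m) {w : Euc m → Euc m} (hw : DifferentiableAt ℝ w z)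
    (x : Euc m) : fderiv ℝ (fun y => Γ y u (w y)) z x =
      fderiv ℝ (fun y => Γ y u (w z)) z x + Γ z u (fderiv ℝ w z x) :=
  fderiv_slot (L := fun y v => Γ y u v) (h.lin_right_ev hz u) (fun _ => h.diff hz _ _) hw x

theorem diff_comp_right (u : Euc m) {w : Euc m → Euc m} (hw : DifferentiableAt ℝ w z) :
    DifferentiableAt ℝ (fun y => Γ y u (w y)) z :=
  differentiableAt_slot (L := fun y v => Γ y u v) (h.lin_right_ev hz u)
    (fun _ => h.diff hz _ _) hw

theorem smooth_comp_right (u : Euc m) {w : Euc m → Euc m} (hw : ContDiffAt ℝ ∞ w z) :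
    ContDiffAt ℝ ∞ (fun y => Γ y u (w y)) z :=
  contDiffAt_slot (L := fun y v => Γ y u v) (h.lin_right_ev hz u)
    (fun _ => h.smooth z hz _ _) hw

omit h hz in
theorem curvature_swap (z u v w : Euc m) :
    connCurvature Γ z u v w = -connCurvature Γ z v u w := by
  simp only [connCurvature]; abel

/-- Torsion-freeness: once the lower arguments of `Γ` are exchanged, the derivative terms and the
quadratic terms of the cyclic sum cancel in pairs. -/
theorem curvature_bianchi (u v w : Euc m) :
    connCurvature Γ z u v w + connCurvature Γ z v w u + connCurvature Γ z w u v = 0 := by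
  have hs : ∀ a b c : Euc m,
      fderiv ℝ (fun y => Γ y a b) z c = fderiv ℝ (fun y => Γ y b a) z c := by
    intro a b c
    rw [Filter.EventuallyEq.fderiv_eq]
    filter_upwards [h.mem_nhds hz] with y hy using h.symm y hy a b
  simp only [connCurvature]
  rw [hs u w v, hs v u w, hs w v u, h.symm z hz u w, h.symm z hz v u, h.symm z hz w v]
  abel

theorem lin1_curvature (v w : Euc m) : IsLinearMap ℝ (fun u => connCurvature Γ z u v w) := by
  have h1 := isLinearMap_fderiv (L := fun y u => Γ y u w) (h.lin_left_ev hz w)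
    (fun _ => h.diff hz _ _) v
  have h2 := isLinearMap_fderiv_apply (fun y => Γ y v w) z
  have h3 := h.lin_left hz (Γ z v w)
  have h4 := h.lin_right z hz v
  have h5 := h.lin_left hz w
  constructor
  · intro a b
    simp only [connCurvature, h1.map_add, h2.map_add, h3.map_add, h4.map_add, h5.map_add]
    abel
  · intro c a
    simp only [connCurvature, h1.map_smul, h2.map_smul, h3.map_smul, h4.map_smul, h5.map_smul,
      smul_sub, smul_add]

theorem lin2_curvature (u w : Euc m) : IsLinearMap ℝ (fun v => connCurvature Γ z u v w) := by
  have h1 := h.lin1_curvature hz u w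
  have : (fun v => connCurvature Γ z u v w) = fun v => -connCurvature Γ z v u w :=
    funext fun v => curvature_swap z u v w
  rw [this]
  exact ⟨fun a b => by rw [h1.map_add]; abel, fun c a => by rw [h1.map_smul, smul_neg]⟩

theorem lin3_curvature (u v : Euc m) : IsLinearMap ℝ (fun w => connCurvature Γ z u v w) := by
  have h1 := isLinearMap_fderiv (L := fun y w => Γ y v w) (h.lin_right_ev hz v)
    (fun _ => h.diff hz _ _) u
  have h2 := isLinearMap_fderiv (L := fun y w => Γ y u w) (h.lin_right_ev hz u)
    (fun _ => h.diff hz _ _) v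
  have h3 := h.lin_right z hz u
  have h4 := h.lin_right z hz v
  constructor
  · intro a b
    simp only [connCurvature, h1.map_add, h2.map_add, h3.map_add, h4.map_add]
    abel
  · intro c a
    simp only [connCurvature, h1.map_smul, h2.map_smul, h3.map_smul, h4.map_smul,
      smul_sub, smul_add]

theorem smooth_curvature (u v w : Euc m) :
    ContDiffAt ℝ ∞ (fun y => connCurvature Γ y u v w) z := by
  unfold connCurvature
  exact (((contDiffAt_fderiv_apply (h.smooth z hz v w) u).sub
    (contDiffAt_fderiv_apply (h.smooth z hz u w) v)).add
    (h.smooth_comp_right hz u (h.smooth z hz v w))).sub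
    (h.smooth_comp_right hz v (h.smooth z hz u w))

theorem fderiv_curvature (u v w x : Euc m) :
    fderiv ℝ (fun y => connCurvature Γ y u v w) z x =
      fderiv ℝ (fun y => fderiv ℝ (fun y => Γ y v w) y u) z x
      - fderiv ℝ (fun y => fderiv ℝ (fun y => Γ y u w) y v) z x
      + (fderiv ℝ (fun y => Γ y u (Γ z v w)) z x + Γ z u (fderiv ℝ (fun y => Γ y v w) z x))
      - (fderiv ℝ (fun y => Γ y v (Γ z u w)) z x + Γ z v (fderiv ℝ (fun y => Γ y u w) z x)) := by
  have hd : ∀ a b c : Euc m, DifferentiableAt ℝ (fun y => fderiv ℝ (fun y => Γ y a b) y c) z :=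
    fun a b c => (contDiffAt_fderiv_apply (h.smooth z hz a b) c).differentiableAt (by simp)
  have hc : ∀ a b c : Euc m, DifferentiableAt ℝ (fun y => Γ y a (Γ y b c)) z :=
    fun a b c => h.diff_comp_right hz a (h.diff hz b c)
  unfold connCurvature
  rw [fderiv_fun_sub (((hd _ _ _).fun_sub (hd _ _ _)).fun_add (hc _ _ _)) (hc _ _ _),
    fderiv_fun_add ((hd _ _ _).fun_sub (hd _ _ _)) (hc _ _ _),
    fderiv_fun_sub (hd _ _ _) (hd _ _ _)]
  simp only [sub_apply, add_apply]
  rw [h.fderiv_comp_right hz u (h.diff hz v w), h.fderiv_comp_right hz v (h.diff hz u w)]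

/-- The second Bianchi identity for the curvature operator. -/
theorem curvature_bianchi₂ (x u v w : Euc m) :
    (fderiv ℝ (fun y => connCurvature Γ y u v w) z x + Γ z x (connCurvature Γ z u v w)
        - connCurvature Γ z u v (Γ z x w))
      + (fderiv ℝ (fun y => connCurvature Γ y v x w) z u + Γ z u (connCurvature Γ z v x w)
        - connCurvature Γ z v x (Γ z u w))
      + (fderiv ℝ (fun y => connCurvature Γ y x u w) z v + Γ z v (connCurvature Γ z x u w)
        - connCurvature Γ z x u (Γ z v w)) = 0 := by
  have hl : ∀ a, IsLinearMap ℝ (Γ z a) := h.lin_right z hz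
  -- Mixed second derivatives of `Γ` commute, and everything else cancels algebraically. The terms
  -- where `∇` acts on the two operator slots are absent from the statement: they cancel among
  -- themselves in the cyclic sum.
  rw [h.fderiv_curvature hz, h.fderiv_curvature hz, h.fderiv_curvature hz,
    fderiv_fderiv_comm (h.smooth z hz v w) u x, fderiv_fderiv_comm (h.smooth z hz x w) v u,
    fderiv_fderiv_comm (h.smooth z hz u w) v x]
  simp only [connCurvature, (hl _).map_sub, (hl _).map_add]
  abel

end IsConnectionOn

end Local

end AsymptoticHarmonic
end

/-! ### The Levi-Civita connection of a metric in coordinates and the symmetries of its curvature.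
-/

noncomputable section
namespace AsymptoticHarmonic

open Filter Topology

section Local

variable {m : ℕ}

/-- A smooth Riemannian metric on an open set of the coordinate space. -/
structure IsMetricOn (U : Set (Euc m)) (G : Euc m → Euc m → Euc m → ℝ) : Prop where
  isOpen : IsOpen U
  lin_right : ∀ z ∈ U, ∀ v, IsLinearMap ℝ (G z v)
  symm : ∀ z ∈ U, ∀ v w, G z v w = G z w v
  pos : ∀ z ∈ U, ∀ v, v ≠ 0 → 0 < G z v v
  smooth : ∀ z ∈ U, ∀ v w, ContDiffAt ℝ ∞ (fun y => G y v w) z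

namespace IsMetricOn

variable {U : Set (Euc m)} {G : Euc m → Euc m → Euc m → ℝ} (h : IsMetricOn U G)
  {z : Euc m} (hz : z ∈ U)
include h hz

theorem mem_nhds : ∀ᶠ y in 𝓝 z, y ∈ U := h.isOpen.mem_nhds hz

theorem lin_left (w : Euc m) : IsLinearMap ℝ (fun v => G z v w) := by
  have : (fun v => G z v w) = G z w := funext fun u => h.symm z hz u w
  rw [this]; exact h.lin_right z hz w

theorem diff (u v : Euc m) : DifferentiableAt ℝ (fun y => G y u v) z :=
  (h.smooth z hz u v).differentiableAt (by simp)

theorem lin_right_ev (u : Euc m) : ∀ᶠ y in 𝓝 z, IsLinearMap ℝ (fun v => G y u v) := by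
  filter_upwards [h.mem_nhds hz] with y hy using h.lin_right y hy u

theorem lin_left_ev (v : Euc m) : ∀ᶠ y in 𝓝 z, IsLinearMap ℝ (fun u => G y u v) := by
  filter_upwards [h.mem_nhds hz] with y hy using h.lin_left hy v

theorem eq_of_forall {v w : Euc m} (hvw : ∀ x, G z v x = G z w x) : v = w := by
  by_contra hne
  have h1 := h.pos z hz (v - w) (sub_ne_zero.2 hne)
  have h2 : G z (v - w) (v - w) = G z v (v - w) - G z w (v - w) :=
    (h.lin_left hz (v - w)).map_sub v w
  rw [h2, hvw, sub_self] at h1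
  exact h1.false

/-- A kernel vector of the Gram matrix would be orthogonal to every basis vector, hence to itself,
against positivity. -/
theorem det_gramMatrix_ne_zero : (gramMatrix G z).det ≠ 0 := by
  intro h0
  obtain ⟨v, hv, hv0⟩ := Matrix.exists_mulVec_eq_zero_iff.2 h0
  have h1 := h.pos z hz (WithLp.toLp 2 v) (by simpa using hv)
  rw [isLinearMap_apply_eq_sum (h.lin_left hz _)] at h1
  have h2 : ∀ i, G z (EuclideanSpace.single i 1) (WithLp.toLp 2 v) = 0 := by
    intro i
    rw [isLinearMap_apply_eq_sum (h.lin_right z hz _)]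
    have := congrFun hv0 i
    simpa [Matrix.mulVec, dotProduct, gramMatrix, mul_comm] using this
  simp [h2] at h1

theorem fderiv_symm (v w x : Euc m) :
    fderiv ℝ (fun y => G y v w) z x = fderiv ℝ (fun y => G y w v) z x := by
  rw [Filter.EventuallyEq.fderiv_eq]
  filter_upwards [h.mem_nhds hz] with y hy using h.symm y hy v w

theorem lin3_christoffelFirst (u v : Euc m) :
    IsLinearMap ℝ (fun w => christoffelFirst G z u v w) := by
  have h1 := fun a b => isLinearMap_fderiv (L := fun y w => G y a w) (h.lin_right_ev hz a)
    (fun _ => h.diff hz _ _) b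
  have h2 := isLinearMap_fderiv_apply (fun y => G y u v) z
  constructor
  · intro a b
    simp only [christoffelFirst, (h1 _ _).map_add, h2.map_add]
    ring
  · intro c a
    simp only [christoffelFirst, (h1 _ _).map_smul, h2.map_smul, smul_eq_mul]
    ring

theorem lin2_christoffelFirst (u w : Euc m) :
    IsLinearMap ℝ (fun v => christoffelFirst G z u v w) := by
  have h1 := isLinearMap_fderiv (L := fun y v => G y v w) (h.lin_left_ev hz w)
    (fun _ => h.diff hz _ _) u
  have h3 := isLinearMap_fderiv (L := fun y v => G y u v) (h.lin_right_ev hz u)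
    (fun _ => h.diff hz _ _) w
  have h2 := isLinearMap_fderiv_apply (fun y => G y u w) z
  constructor
  · intro a b
    simp only [christoffelFirst, h1.map_add, h2.map_add, h3.map_add]
    ring
  · intro c a
    simp only [christoffelFirst, h1.map_smul, h2.map_smul, h3.map_smul, smul_eq_mul]
    ring

theorem christoffelFirst_symm (u v w : Euc m) :
    christoffelFirst G z u v w = christoffelFirst G z v u w := by
  unfold christoffelFirst
  rw [h.fderiv_symm hz u v w]
  ring

theorem smooth_christoffelFirst (u v w : Euc m) :
    ContDiffAt ℝ ∞ (fun y => christoffelFirst G y u v w) z := by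
  unfold christoffelFirst
  exact (((contDiffAt_fderiv_apply (h.smooth z hz v w) u).add
    (contDiffAt_fderiv_apply (h.smooth z hz u w) v)).sub
    (contDiffAt_fderiv_apply (h.smooth z hz u v) w)).div_const 2

/-- Lowering the index cancels the inverse Gram matrix. Together with `isConnectionOn`, this is the
only access to the explicit formula for `christoffel`. -/
theorem metric_christoffel (u v w : Euc m) :
    G z (christoffel G z u v) w = christoffelFirst G z u v w := by
  rw [isLinearMap_apply_eq_sum (h.lin_right z hz _) w,
    isLinearMap_apply_eq_sum (h.lin3_christoffelFirst hz u v) w]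
  refine Finset.sum_congr rfl fun j _ => ?_
  congr 1
  have hinv : gramMatrix G z * (gramMatrix G z)⁻¹ = 1 :=
    Matrix.mul_nonsing_inv _ (isUnit_iff_ne_zero.2 (h.det_gramMatrix_ne_zero hz))
  have h1 : G z (christoffel G z u v) (EuclideanSpace.single j 1) =
      ∑ k, ∑ l, (gramMatrix G z)⁻¹ k l * christoffelFirst G z u v (EuclideanSpace.single l 1) *
        gramMatrix G z j k := by
    have : christoffel G z u v = ∑ k, (∑ l, (gramMatrix G z)⁻¹ k l *
        christoffelFirst G z u v (EuclideanSpace.single l 1)) • EuclideanSpace.single k 1 := by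
      simp only [christoffel, Finset.sum_smul]
    rw [this, isLinearMap_sum (h.lin_left hz _)]
    refine Finset.sum_congr rfl fun k _ => ?_
    rw [smul_eq_mul, Finset.sum_mul]
    simp [gramMatrix, h.symm z hz (EuclideanSpace.single j 1)]
  rw [h1, Finset.sum_comm]
  have h2 : ∀ l, ∑ k, (gramMatrix G z)⁻¹ k l *
      christoffelFirst G z u v (EuclideanSpace.single l 1) * gramMatrix G z j k =
      (1 : Matrix (Fin m) (Fin m) ℝ) j l *
        christoffelFirst G z u v (EuclideanSpace.single l 1) := by
    intro l
    rw [← hinv, Matrix.mul_apply, Finset.sum_mul]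
    exact Finset.sum_congr rfl fun k _ => by ring
  simp only [h2, Matrix.one_apply]
  simp

/-- In the sum of the two first-kind symbols all derivatives of the metric cancel except the one in
direction `x`, which appears twice with weight one half. -/
theorem compat (x v w : Euc m) :
    fderiv ℝ (fun y => G y v w) z x = G z (christoffel G z x v) w + G z v (christoffel G z x w) := by
  rw [h.symm z hz v, h.metric_christoffel hz, h.metric_christoffel hz]
  simp only [christoffelFirst]
  rw [h.fderiv_symm hz w v x]
  ring

/-- Cramer's rule: each entry of the inverse is a determinant with smooth entries divided by a
nonvanishing smooth determinant. -/
theorem smooth_gramMatrix_inv (k l : Fin m) :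
    ContDiffAt ℝ ∞ (fun y => (gramMatrix G y)⁻¹ k l) z := by
  have hdet : ∀ A : Euc m → Matrix (Fin m) (Fin m) ℝ,
      (∀ i j, ContDiffAt ℝ ∞ (fun y => A y i j) z) → ContDiffAt ℝ ∞ (fun y => (A y).det) z := by
    intro A hA
    simp only [Matrix.det_apply]
    exact ContDiffAt.sum fun σ _ => ContDiffAt.const_smul _ (contDiffAt_prod fun i _ => hA _ _)
  have hg : ∀ i j, ContDiffAt ℝ ∞ (fun y => gramMatrix G y i j) z := fun i j =>
    h.smooth z hz _ _
  simp only [Matrix.inv_def, Ring.inverse_eq_inv, Matrix.smul_apply, smul_eq_mul,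
    Matrix.adjugate_apply]
  refine ((hdet _ hg).inv (h.det_gramMatrix_ne_zero hz)).mul (hdet _ fun i j => ?_)
  by_cases hi : i = l
  · subst hi; simpa using contDiffAt_const
  · simpa [Matrix.updateRow_ne hi] using hg i j

omit hz in
theorem isConnectionOn : IsConnectionOn U (christoffel G) where
  isOpen := h.isOpen
  lin_right z hz u := by
    have h1 := fun w => h.lin2_christoffelFirst hz u w
    constructor
    · intro a b
      simp only [christoffel, (h1 _).map_add, mul_add, add_smul, Finset.sum_add_distrib]
    · intro c a
      simp only [christoffel, (h1 _).map_smul, smul_eq_mul, Finset.smul_sum, smul_smul]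
      simp only [mul_left_comm]
  symm z hz u v := by
    simp only [christoffel, h.christoffelFirst_symm hz u v]
  smooth z hz u v := by
    unfold christoffel
    exact ContDiffAt.sum fun k _ => ContDiffAt.sum fun l _ =>
      ((h.smooth_gramMatrix_inv hz k l).mul (h.smooth_christoffelFirst hz u v _)).smul
        contDiffAt_const

theorem fderiv_comp_left {w : Euc m → Euc m} (hw : DifferentiableAt ℝ w z) (v x : Euc m) :
    fderiv ℝ (fun y => G y (w y) v) z x =
      fderiv ℝ (fun y => G y (w z) v) z x + G z (fderiv ℝ w z x) v :=
  fderiv_slot (L := fun y w => G y w v) (h.lin_left_ev hz v) (fun _ => h.diff hz _ _) hw x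

theorem diff_comp_left {w : Euc m → Euc m} (hw : DifferentiableAt ℝ w z) (v : Euc m) :
    DifferentiableAt ℝ (fun y => G y (w y) v) z :=
  differentiableAt_slot (L := fun y w => G y w v) (h.lin_left_ev hz v)
    (fun _ => h.diff hz _ _) hw

/-- The second derivatives of `G(c, d)` in directions `a` and `b` commute. Computing both by
applying `compat` twice, the difference is G(R(a,b)c, d) + G(c, R(a,b)d), which therefore vanishes.
-/
theorem curvature_skew (a b c d : Euc m) :
    curvatureCoord G z a b c d = -curvatureCoord G z a b d c := by
  have hc := h.isConnectionOn
  have hd : ∀ x v w, DifferentiableAt ℝ (fun y => G y (christoffel G y x v) w) z := fun x v w =>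
    h.diff_comp_left hz (hc.diff hz x v) w
  have h2 : ∀ x y : Euc m, fderiv ℝ (fun z => fderiv ℝ (fun y => G y c d) z x) z y =
      (G z (christoffel G z y (christoffel G z x c)) d
        + G z (christoffel G z x c) (christoffel G z y d)
        + G z (fderiv ℝ (fun z => christoffel G z x c) z y) d)
      + (G z (christoffel G z y (christoffel G z x d)) c
        + G z (christoffel G z x d) (christoffel G z y c)
        + G z (fderiv ℝ (fun z => christoffel G z x d) z y) c) := by
    intro x y
    have h1 : (fun z => fderiv ℝ (fun y => G y c d) z x) =ᶠ[𝓝 z]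
        fun z => G z (christoffel G z x c) d + G z (christoffel G z x d) c := by
      filter_upwards [h.mem_nhds hz] with y hy
      rw [h.compat hy, h.symm y hy c]
    rw [h1.fderiv_eq, fderiv_fun_add (hd _ _ _) (hd _ _ _), add_apply,
      h.fderiv_comp_left hz (hc.diff hz x c), h.fderiv_comp_left hz (hc.diff hz x d),
      h.compat hz, h.compat hz]
  have h3 := fderiv_fderiv_comm (h.smooth z hz c d) a b
  rw [h2, h2] at h3
  have hl := fun w => h.lin_left hz w
  have e := fun v w => h.symm z hz v w
  simp only [curvatureCoord, curvatureOp, (hl _).map_add, (hl _).map_sub]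
  rw [e (christoffel G z a c), e (christoffel G z a d)] at h3
  linarith

omit h hz in
theorem curvature_swap (z a b c d : Euc m) (hl : IsLinearMap ℝ (fun v => G z v d)) :
    curvatureCoord G z a b c d = -curvatureCoord G z b a c d := by
  have := IsConnectionOn.curvature_swap (Γ := christoffel G) z a b c
  change G z (connCurvature _ _ _ _ _) d = -G z (connCurvature _ _ _ _ _) d
  rw [this]
  exact hl.map_neg _

theorem curvature_bianchi (a b c d : Euc m) :
    curvatureCoord G z a b c d + curvatureCoord G z b c a d + curvatureCoord G z c a b d = 0 := by
  have hl := h.lin_left hz d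
  have := h.isConnectionOn.curvature_bianchi hz a b c
  have h2 := congrArg (fun v => G z v d) this
  simp only [hl.map_add, hl.map_zero] at h2
  exact h2

/-- The classical octahedron argument: a linear combination of four instances of the first Bianchi
identity, simplified by the two skew symmetries. -/
theorem curvature_pair (a b c d : Euc m) :
    curvatureCoord G z a b c d = curvatureCoord G z c d a b := by
  have s1 := fun a b c d => curvature_swap z a b c d (h.lin_left hz d)
  have s2 := fun a b c d => h.curvature_skew hz a b c d
  have e := fun a b c d => h.curvature_bianchi hz a b c d
  linarith [e a b c d, e b c d a, e c d a b, e d a b c, s1 a b c d, s2 a b c d, s1 c d a b,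
    s2 c d a b, s1 b c a d, s2 b c a d, s1 c a b d, s2 c a b d, s1 a d b c, s2 a d b c,
    s1 d b a c, s2 d b a c, s2 b d c a, s1 b d a c, s1 a c b d, s2 a c b d,
    s1 d a b c, s2 d a b c, s1 d a c b, s1 d b c a, s2 b c d a, s2 c a d b, s2 a c d b, s1 a c d b,
    s2 b d a c, s2 c d b a, s2 a b d c]

omit hz in
theorem isTensor4On_curvature : IsTensor4On U (curvatureCoord G) where
  lin1 z hz b c d := by
    have h1 := h.lin_left hz d
    have h2 := h.isConnectionOn.lin1_curvature hz b c
    exact (h1.mk' _ ∘ₗ h2.mk' _).isLinear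
  lin2 z hz a c d := by
    have h1 := h.lin_left hz d
    have h2 := h.isConnectionOn.lin2_curvature hz a c
    exact (h1.mk' _ ∘ₗ h2.mk' _).isLinear
  lin3 z hz a b d := by
    have h1 := h.lin_left hz d
    have h2 := h.isConnectionOn.lin3_curvature hz a b
    exact (h1.mk' _ ∘ₗ h2.mk' _).isLinear
  lin4 z hz a b c := h.lin_right z hz _
  smooth z hz a b c d := contDiffAt_slot (L := fun y w => G y w d) (h.lin_left_ev hz d)
    (fun _ => h.smooth z hz _ _) (h.isConnectionOn.smooth_curvature hz a b c)

/-- The second Bianchi identity. -/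
theorem nabla_bianchi (x a b c d : Euc m) :
    nablaCurvatureCoord G z x a b c d + nablaCurvatureCoord G z a b x c d
      + nablaCurvatureCoord G z b x a c d = 0 := by
  have hc := h.isConnectionOn
  have hl := h.lin_left hz d
  -- Metric compatibility absorbs the correction in the last slot, so the lowered tensor inherits
  -- the operator identity `curvature_bianchi₂`, up to the corrections in the slots `a` and `b`.
  have key : ∀ x a b, nablaCurvatureCoord G z x a b c d =
      G z (fderiv ℝ (fun y => connCurvature (christoffel G) y a b c) z x
        + christoffel G z x (connCurvature (christoffel G) z a b c)
        - connCurvature (christoffel G) z a b (christoffel G z x c)) d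
      - curvatureCoord G z (christoffel G z x a) b c d
      - curvatureCoord G z a (christoffel G z x b) c d := by
    intro x a b
    have hd := (hc.smooth_curvature hz a b c).differentiableAt (by simp)
    have h1 := h.fderiv_comp_left hz hd d x
    rw [h.compat hz] at h1
    have h2 : fderiv ℝ (fun z => curvatureCoord G z a b c d) z x =
      fderiv ℝ (fun z => G z (connCurvature (christoffel G) z a b c) d) z x := rfl
    simp only [nablaCurvatureCoord, hl.map_add, hl.map_sub, h2, h1]
    simp only [curvatureCoord]
    change _ + _ + _ - _ - _ - G z (connCurvature (christoffel G) z a b (christoffel G z x c)) d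
      - G z (connCurvature (christoffel G) z a b c) (christoffel G z x d) = _
    ring
  have h3 := congrArg (fun v => G z v d) (hc.curvature_bianchi₂ hz x a b c)
  simp only [hl.map_add, hl.map_zero] at h3
  simp only [← hl.map_add] at h3
  have s1 := fun a b => curvature_swap z a b c d hl
  -- Symmetry of the Christoffel symbols pairs the six remaining corrections, and skew symmetry of
  -- the curvature makes each pair cancel.
  rw [key, key, key, hc.symm z hz x a, hc.symm z hz b a, hc.symm z hz b x]
  simp only [hl.map_sub, hl.map_add] at h3 ⊢
  linarith [s1 (christoffel G z a x) b, s1 (christoffel G z x b) a, s1 (christoffel G z a b) x]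

end IsMetricOn

end Local

end AsymptoticHarmonic
end

/-! ### Covariant derivatives of fields of multilinear forms. -/

noncomputable section
namespace AsymptoticHarmonic

open Filter Topology

section Local

variable {m : ℕ} {U : Set (Euc m)} {Γ : Euc m → Euc m → Euc m → Euc m}
  {T : Euc m → Euc m → Euc m → Euc m → Euc m → ℝ}

namespace IsTensor4On

theorem lin1_ev (h : IsTensor4On U T) (hU : IsOpen U) {z : Euc m} (hz : z ∈ U) (b c d : Euc m) :
    ∀ᶠ y in 𝓝 z, IsLinearMap ℝ (fun a => T y a b c d) := by
  filter_upwards [hU.mem_nhds hz] with y hy using h.lin1 y hy b c d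

theorem lin2_ev (h : IsTensor4On U T) (hU : IsOpen U) {z : Euc m} (hz : z ∈ U) (a c d : Euc m) :
    ∀ᶠ y in 𝓝 z, IsLinearMap ℝ (fun b => T y a b c d) := by
  filter_upwards [hU.mem_nhds hz] with y hy using h.lin2 y hy a c d

theorem lin3_ev (h : IsTensor4On U T) (hU : IsOpen U) {z : Euc m} (hz : z ∈ U) (a b d : Euc m) :
    ∀ᶠ y in 𝓝 z, IsLinearMap ℝ (fun c => T y a b c d) := by
  filter_upwards [hU.mem_nhds hz] with y hy using h.lin3 y hy a b d

theorem lin4_ev (h : IsTensor4On U T) (hU : IsOpen U) {z : Euc m} (hz : z ∈ U) (a b c : Euc m) :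
    ∀ᶠ y in 𝓝 z, IsLinearMap ℝ (fun d => T y a b c d) := by
  filter_upwards [hU.mem_nhds hz] with y hy using h.lin4 y hy a b c

theorem diff (h : IsTensor4On U T) {z : Euc m} (hz : z ∈ U) (a b c d : Euc m) :
    DifferentiableAt ℝ (fun y => T y a b c d) z :=
  (h.smooth z hz a b c d).differentiableAt (by simp)

/-- Supplies the linearity and smoothness of `∇T` that are needed to differentiate it a second time.
-/
theorem isTensor5On_nab4 (h : IsTensor4On U T) (hΓ : IsConnectionOn U Γ) :
    IsTensor5On U (nab4 Γ T) where
  lin0 z hz a b c d := by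
    have h0 := isLinearMap_fderiv_apply (fun y => T y a b c d) z
    have g := fun a => hΓ.lin_left hz a
    have h1 := fun b c d => h.lin1 z hz b c d
    have h2 := fun a c d => h.lin2 z hz a c d
    have h3 := fun a b d => h.lin3 z hz a b d
    have h4 := fun a b c => h.lin4 z hz a b c
    constructor
    · intro x y
      simp only [nab4, h0.map_add, (g _).map_add, (h1 _ _ _).map_add, (h2 _ _ _).map_add,
        (h3 _ _ _).map_add, (h4 _ _ _).map_add]
      ring
    · intro r x
      simp only [nab4, h0.map_smul, (g _).map_smul, (h1 _ _ _).map_smul, (h2 _ _ _).map_smul,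
        (h3 _ _ _).map_smul, (h4 _ _ _).map_smul, smul_eq_mul]
      ring
  lin1 z hz x b c d := by
    have h0 := isLinearMap_fderiv (L := fun y a => T y a b c d) (h.lin1_ev hΓ.isOpen hz b c d)
      (fun _ => h.diff hz _ _ _ _) x
    have g := fun a => hΓ.lin_right z hz a
    have h1 := fun b c d => h.lin1 z hz b c d
    constructor
    · intro x y
      simp only [nab4, h0.map_add, (g _).map_add, (h1 _ _ _).map_add]
      ring
    · intro r x
      simp only [nab4, h0.map_smul, (g _).map_smul, (h1 _ _ _).map_smul, smul_eq_mul]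
      ring
  lin2 z hz x a c d := by
    have h0 := isLinearMap_fderiv (L := fun y b => T y a b c d) (h.lin2_ev hΓ.isOpen hz a c d)
      (fun _ => h.diff hz _ _ _ _) x
    have g := fun a => hΓ.lin_right z hz a
    have h1 := fun b c d => h.lin2 z hz b c d
    constructor
    · intro x y
      simp only [nab4, h0.map_add, (g _).map_add, (h1 _ _ _).map_add]
      ring
    · intro r x
      simp only [nab4, h0.map_smul, (g _).map_smul, (h1 _ _ _).map_smul, smul_eq_mul]
      ring
  lin3 z hz x a b d := by
    have h0 := isLinearMap_fderiv (L := fun y c => T y a b c d) (h.lin3_ev hΓ.isOpen hz a b d)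
      (fun _ => h.diff hz _ _ _ _) x
    have g := fun a => hΓ.lin_right z hz a
    have h1 := fun b c d => h.lin3 z hz b c d
    constructor
    · intro x y
      simp only [nab4, h0.map_add, (g _).map_add, (h1 _ _ _).map_add]
      ring
    · intro r x
      simp only [nab4, h0.map_smul, (g _).map_smul, (h1 _ _ _).map_smul, smul_eq_mul]
      ring
  lin4 z hz x a b c := by
    have h0 := isLinearMap_fderiv (L := fun y d => T y a b c d) (h.lin4_ev hΓ.isOpen hz a b c)
      (fun _ => h.diff hz _ _ _ _) x
    have g := fun a => hΓ.lin_right z hz a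
    have h1 := fun b c d => h.lin4 z hz b c d
    constructor
    · intro x y
      simp only [nab4, h0.map_add, (g _).map_add, (h1 _ _ _).map_add]
      ring
    · intro r x
      simp only [nab4, h0.map_smul, (g _).map_smul, (h1 _ _ _).map_smul, smul_eq_mul]
      ring
  smooth z hz x a b c d := by
    unfold nab4
    exact ((((contDiffAt_fderiv_apply (h.smooth z hz a b c d) x).sub
      (contDiffAt_slot (L := fun y a => T y a b c d) (h.lin1_ev hΓ.isOpen hz b c d)
        (fun _ => h.smooth z hz _ _ _ _) (hΓ.smooth z hz x a))).sub
      (contDiffAt_slot (L := fun y b => T y a b c d) (h.lin2_ev hΓ.isOpen hz a c d)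
        (fun _ => h.smooth z hz _ _ _ _) (hΓ.smooth z hz x b))).sub
      (contDiffAt_slot (L := fun y c => T y a b c d) (h.lin3_ev hΓ.isOpen hz a b d)
        (fun _ => h.smooth z hz _ _ _ _) (hΓ.smooth z hz x c))).sub
      (contDiffAt_slot (L := fun y d => T y a b c d) (h.lin4_ev hΓ.isOpen hz a b c)
        (fun _ => h.smooth z hz _ _ _ _) (hΓ.smooth z hz x d))

/-- The Ricci identity for fields of `4`-linear forms. -/
theorem ricci_identity (h : IsTensor4On U T) (hΓ : IsConnectionOn U Γ) {z : Euc m} (hz : z ∈ U)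
    (x y a b c d : Euc m) :
    nab5 Γ (nab4 Γ T) z x y a b c d - nab5 Γ (nab4 Γ T) z y x a b c d =
      -(T z (connCurvature Γ z x y a) b c d + T z a (connCurvature Γ z x y b) c d
        + T z a b (connCurvature Γ z x y c) d + T z a b c (connCurvature Γ z x y d)) := by
  have h1 := fun b c d => h.lin1 z hz b c d
  have h2 := fun a c d => h.lin2 z hz a c d
  have h3 := fun a b d => h.lin3 z hz a b d
  have h4 := fun a b c => h.lin4 z hz a b c
  have key : ∀ x y, fderiv ℝ (fun z => nab4 Γ T z y a b c d) z x =
      fderiv ℝ (fun z => fderiv ℝ (fun z => T z a b c d) z y) z x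
      - (fderiv ℝ (fun w => T w (Γ z y a) b c d) z x + T z (fderiv ℝ (fun w => Γ w y a) z x) b c d)
      - (fderiv ℝ (fun w => T w a (Γ z y b) c d) z x + T z a (fderiv ℝ (fun w => Γ w y b) z x) c d)
      - (fderiv ℝ (fun w => T w a b (Γ z y c) d) z x + T z a b (fderiv ℝ (fun w => Γ w y c) z x) d)
      - (fderiv ℝ (fun w => T w a b c (Γ z y d)) z x
        + T z a b c (fderiv ℝ (fun w => Γ w y d) z x)) := by
    intro x y
    have d0 : DifferentiableAt ℝ (fun w => fderiv ℝ (fun z => T z a b c d) w y) z :=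
      (contDiffAt_fderiv_apply (h.smooth z hz a b c d) y).differentiableAt (by simp)
    have d1 := differentiableAt_slot (L := fun y a => T y a b c d) (h.lin1_ev hΓ.isOpen hz b c d)
        (fun _ => h.diff hz _ _ _ _) (hΓ.diff hz y a)
    have d2 := differentiableAt_slot (L := fun y b => T y a b c d) (h.lin2_ev hΓ.isOpen hz a c d)
        (fun _ => h.diff hz _ _ _ _) (hΓ.diff hz y b)
    have d3 := differentiableAt_slot (L := fun y c => T y a b c d) (h.lin3_ev hΓ.isOpen hz a b d)
        (fun _ => h.diff hz _ _ _ _) (hΓ.diff hz y c)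
    have d4 := differentiableAt_slot (L := fun y d => T y a b c d) (h.lin4_ev hΓ.isOpen hz a b c)
        (fun _ => h.diff hz _ _ _ _) (hΓ.diff hz y d)
    have e1 := fderiv_slot (L := fun y a => T y a b c d) (h.lin1_ev hΓ.isOpen hz b c d)
        (fun _ => h.diff hz _ _ _ _) (hΓ.diff hz y a) x
    have e2 := fderiv_slot (L := fun y b => T y a b c d) (h.lin2_ev hΓ.isOpen hz a c d)
        (fun _ => h.diff hz _ _ _ _) (hΓ.diff hz y b) x
    have e3 := fderiv_slot (L := fun y c => T y a b c d) (h.lin3_ev hΓ.isOpen hz a b d)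
        (fun _ => h.diff hz _ _ _ _) (hΓ.diff hz y c) x
    have e4 := fderiv_slot (L := fun y d => T y a b c d) (h.lin4_ev hΓ.isOpen hz a b c)
        (fun _ => h.diff hz _ _ _ _) (hΓ.diff hz y d) x
    simp only [nab4]
    rw [fderiv_fun_sub (((d0.fun_sub d1).fun_sub d2).fun_sub d3) d4,
      fderiv_fun_sub ((d0.fun_sub d1).fun_sub d2) d3, fderiv_fun_sub (d0.fun_sub d1) d2,
      fderiv_fun_sub d0 d1]
    simp only [sub_apply]
    rw [e1, e2, e3, e4]
  have hc := fderiv_fderiv_comm (h.smooth z hz a b c d) y x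
  -- The correction in the slot of the first derivative involves `Γ(x, y)`, which is symmetric and
  -- drops out of the commutator, as do the mixed second partial derivatives of `T`.
  rw [nab5, nab5, key, key, hc, hΓ.symm z hz y x]
  simp only [nab4, connCurvature, (h1 _ _ _).map_add, (h2 _ _ _).map_add, (h3 _ _ _).map_add,
    (h4 _ _ _).map_add, (h1 _ _ _).map_sub, (h2 _ _ _).map_sub, (h3 _ _ _).map_sub,
    (h4 _ _ _).map_sub]
  ring

end IsTensor4On

/-! ### Covariant derivatives inherit the symmetries of a tensor -/

/-- The symmetry holds on an open set and may be differentiated; the connection terms are permuted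
among themselves. The next lemmas follow the same pattern. -/
theorem nab4_swap12 (hU : IsOpen U) (hT : ∀ z ∈ U, ∀ a b c d, T z a b c d = -T z b a c d)
    {z : Euc m} (hz : z ∈ U) (x a b c d : Euc m) :
    nab4 Γ T z x a b c d = -nab4 Γ T z x b a c d := by
  have : fderiv ℝ (fun z => T z a b c d) z = fderiv ℝ (fun z => -T z b a c d) z := by
    apply Filter.EventuallyEq.fderiv_eq
    filter_upwards [hU.mem_nhds hz] with y hy using hT y hy a b c d
  simp only [nab4, this, fderiv_fun_neg, neg_apply]
  rw [hT z hz (Γ z x a), hT z hz a (Γ z x b), hT z hz a b (Γ z x c), hT z hz a b c]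
  ring

theorem nab4_pair (hU : IsOpen U) (hT : ∀ z ∈ U, ∀ a b c d, T z a b c d = T z c d a b)
    {z : Euc m} (hz : z ∈ U) (x a b c d : Euc m) :
    nab4 Γ T z x a b c d = nab4 Γ T z x c d a b := by
  have : fderiv ℝ (fun z => T z a b c d) z = fderiv ℝ (fun z => T z c d a b) z := by
    apply Filter.EventuallyEq.fderiv_eq
    filter_upwards [hU.mem_nhds hz] with y hy using hT y hy a b c d
  simp only [nab4, this]
  rw [hT z hz (Γ z x a), hT z hz a (Γ z x b), hT z hz a b (Γ z x c), hT z hz a b c]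
  ring

theorem nab4_cyclic (h : IsTensor4On U T) (hU : IsOpen U)
    (hT : ∀ z ∈ U, ∀ a b c d, T z a b c d + T z b c a d + T z c a b d = 0)
    {z : Euc m} (hz : z ∈ U) (x a b c d : Euc m) :
    nab4 Γ T z x a b c d + nab4 Γ T z x b c a d + nab4 Γ T z x c a b d = 0 := by
  have : fderiv ℝ (fun z => T z a b c d) z =
      fderiv ℝ (fun z => -T z b c a d - T z c a b d) z := by
    apply Filter.EventuallyEq.fderiv_eq
    filter_upwards [hU.mem_nhds hz] with y hy
    linarith [hT y hy a b c d]
  simp only [nab4, this]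
  rw [fderiv_fun_sub (h.diff hz _ _ _ _).fun_neg (h.diff hz _ _ _ _), fderiv_fun_neg]
  simp only [sub_apply, neg_apply]
  linarith [hT z hz (Γ z x a) b c d, hT z hz a (Γ z x b) c d, hT z hz a b (Γ z x c) d,
    hT z hz a b c (Γ z x d)]

theorem nab5_swap12 {N : Euc m → Euc m → Euc m → Euc m → Euc m → Euc m → ℝ} (hU : IsOpen U)
    (hT : ∀ z ∈ U, ∀ e a b c d, N z e a b c d = -N z e b a c d)
    {z : Euc m} (hz : z ∈ U) (x e a b c d : Euc m) :
    nab5 Γ N z x e a b c d = -nab5 Γ N z x e b a c d := by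
  have : fderiv ℝ (fun z => N z e a b c d) z = fderiv ℝ (fun z => -N z e b a c d) z := by
    apply Filter.EventuallyEq.fderiv_eq
    filter_upwards [hU.mem_nhds hz] with y hy using hT y hy e a b c d
  simp only [nab5, this, fderiv_fun_neg, neg_apply]
  rw [hT z hz (Γ z x e), hT z hz e (Γ z x a), hT z hz e a (Γ z x b), hT z hz e a b (Γ z x c),
    hT z hz e a b c]
  ring

/-- The cyclic sum includes the slot `e` of the first derivative: applied to `∇R`, this is the
covariant derivative of the second Bianchi identity. -/
theorem nab5_cyclic {N : Euc m → Euc m → Euc m → Euc m → Euc m → Euc m → ℝ}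
    (h : IsTensor5On U N) (hU : IsOpen U)
    (hT : ∀ z ∈ U, ∀ x a b c d, N z x a b c d + N z a b x c d + N z b x a c d = 0)
    {z : Euc m} (hz : z ∈ U) (x e a b c d : Euc m) :
    nab5 Γ N z x e a b c d + nab5 Γ N z x a b e c d + nab5 Γ N z x b e a c d = 0 := by
  have hd : ∀ x a b c d, DifferentiableAt ℝ (fun y => N y x a b c d) z := fun x a b c d =>
    (h.smooth z hz x a b c d).differentiableAt (by simp)
  have : fderiv ℝ (fun z => N z e a b c d) z =
      fderiv ℝ (fun z => -N z a b e c d - N z b e a c d) z := by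
    apply Filter.EventuallyEq.fderiv_eq
    filter_upwards [hU.mem_nhds hz] with y hy
    linarith [hT y hy e a b c d]
  simp only [nab5, this]
  rw [fderiv_fun_sub (hd _ _ _ _ _).fun_neg (hd _ _ _ _ _), fderiv_fun_neg]
  simp only [sub_apply, neg_apply]
  linarith [hT z hz (Γ z x e) a b c d, hT z hz e (Γ z x a) b c d, hT z hz e a (Γ z x b) c d,
    hT z hz e a b (Γ z x c) d, hT z hz e a b c (Γ z x d)]

end Local

end AsymptoticHarmonic
end

noncomputable section
namespace AsymptoticHarmonic

open Filter Topology

section Local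

variable {m : ℕ} {U : Set (Euc m)} {Γ : Euc m → Euc m → Euc m → Euc m}

/-! ### Parallel frames along geodesics -/

/-- Through every point there is a geodesic with given velocity and, along it, a parallel frame
with given initial value. -/
theorem exists_parallel_frame (hΓ : IsConnectionOn U Γ) {z₀ : Euc m} (hz₀ : z₀ ∈ U) (x : Euc m)
    (e : Fin m → Euc m) :
    ∃ (γ V : ℝ → Euc m) (E : Fin m → ℝ → Euc m), γ 0 = z₀ ∧ V 0 = x ∧ (∀ a, E a 0 = e a) ∧
      ∀ᶠ t in 𝓝 (0 : ℝ), γ t ∈ U ∧ HasDerivAt γ (V t) t ∧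
        HasDerivAt V (-Γ (γ t) (V t) (V t)) t ∧
        ∀ a, HasDerivAt (E a) (-Γ (γ t) (V t) (E a t)) t := by
  -- The geodesic equation and parallel transport form a single autonomous first-order system for
  -- position, velocity and frame, solved locally by Picard–Lindelöf. Along a geodesic the velocity
  -- is itself parallel, so it may fill a tensor slot in a second differentiation.
  let f : Euc m × Euc m × (Fin m → Euc m) → Euc m × Euc m × (Fin m → Euc m) := fun p =>
    (p.2.1, -Γ p.1 p.2.1 p.2.1, fun a => -Γ p.1 p.2.1 (p.2.2 a))
  set p₀ : Euc m × Euc m × (Fin m → Euc m) := (z₀, x, e) with hp₀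
  have hU : ∀ᶠ p : Euc m × Euc m × (Fin m → Euc m) in 𝓝 p₀, p.1 ∈ U :=
    continuousAt_fst.eventually (hΓ.mem_nhds hz₀)
  have h1 : ContDiff ℝ ∞ (fun p : Euc m × Euc m × (Fin m → Euc m) => p.2.1) :=
    contDiff_fst.comp contDiff_snd
  have hsm : ∀ w : Euc m × Euc m × (Fin m → Euc m) → Euc m, ContDiffAt ℝ ∞ w p₀ →
      ContDiffAt ℝ ∞ (fun p => Γ p.1 p.2.1 (w p)) p₀ := by
    intro w hw
    refine contDiffAt_slot (L := fun p v => Γ p.1 p.2.1 v) ?_ (fun v => ?_) hw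
    · filter_upwards [hU] with p hp using hΓ.lin_right _ hp _
    · refine contDiffAt_slot (L := fun p u => Γ p.1 u v) ?_ (fun u => ?_)
        h1.contDiffAt
      · filter_upwards [hU] with p hp using hΓ.lin_left hp _
      · exact ContDiffAt.comp p₀ (hΓ.smooth z₀ hz₀ u v) contDiffAt_fst
  have h2 : ∀ a, ContDiff ℝ ∞ (fun p : Euc m × Euc m × (Fin m → Euc m) => p.2.2 a) := fun a =>
    (contDiff_apply ℝ (Euc m) a).comp (contDiff_snd.comp contDiff_snd)
  have hf : ContDiffAt ℝ 1 f p₀ :=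
    (h1.contDiffAt.prodMk ((hsm _ h1.contDiffAt).neg.prodMk
      (contDiffAt_pi.2 fun a => (hsm _ (h2 a).contDiffAt).neg))).of_le (by simp)
  obtain ⟨r, hr, ε, hε, hα⟩ :=
    hf.exists_forall_mem_closedBall_exists_eq_forall_mem_Ioo_hasDerivAt 0
  obtain ⟨α, hα0, hα⟩ := hα p₀ (Metric.mem_closedBall_self hr.le)
  refine ⟨fun t => (α t).1, fun t => (α t).2.1, fun a t => (α t).2.2 a, by simp [hα0, hp₀],
    by simp [hα0, hp₀], fun a => by simp [hα0, hp₀], ?_⟩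
  have hev : ∀ᶠ t in 𝓝 (0 : ℝ), t ∈ Set.Ioo (0 - ε) (0 + ε) :=
    Ioo_mem_nhds (by linarith) (by linarith)
  have hcont : ContinuousAt α 0 := (hα 0 (by constructor <;> linarith)).continuousAt
  rw [← hα0] at hU
  filter_upwards [hev, hcont.eventually hU] with t ht htU
  have hd := hα t ht
  have hd2 : HasDerivAt (fun t => (α t).2) (f (α t)).2 t := hd.snd
  have hd3 : HasDerivAt (fun t => (α t).2.2) (f (α t)).2.2 t := hd2.snd
  exact ⟨htU, hd.fst, hd2.fst, fun a => (hasDerivAt_pi.1 hd3) a⟩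

section Along

variable {γ : ℝ → Euc m} {V A B C D K : ℝ → Euc m} {t : ℝ}

/-- By metric compatibility the derivative of the coefficients cancels against the derivatives of
the two parallel fields. -/
theorem hasDerivAt_metric_parallel {G : Euc m → Euc m → Euc m → ℝ} (hG : IsMetricOn U G)
    (ht : γ t ∈ U) (hγ : HasDerivAt γ (V t) t)
    (hA : HasDerivAt A (-christoffel G (γ t) (V t) (A t)) t)
    (hB : HasDerivAt B (-christoffel G (γ t) (V t) (B t)) t) :
    HasDerivAt (fun s => G (γ s) (A s) (B s)) 0 t := by
  have hev : ∀ᶠ s in 𝓝 t, γ s ∈ U := hγ.continuousAt.eventually (hG.mem_nhds ht)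
  have h0 : ∀ a b, HasDerivAt (fun s => G (γ s) a b) (fderiv ℝ (fun y => G y a b) (γ t) (V t)) t :=
    fun a b => (hG.diff ht a b).hasFDerivAt.comp_hasDerivAt t hγ
  have h1 := fun b => hasDerivAt_slot (L := fun s a => G (γ s) a b)
    (by filter_upwards [hev] with s hs using hG.lin_left hs b) (fun a => h0 a b) hA
  have h2 := hasDerivAt_slot (L := fun s b => G (γ s) (A s) b)
    (by filter_upwards [hev] with s hs using hG.lin_right _ hs _) h1 hB
  refine h2.congr_deriv ?_
  rw [(hG.lin_left ht (B t)).map_neg, (hG.lin_right _ ht (A t)).map_neg, hG.compat ht]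
  ring

/-- The product rule yields exactly the correction terms of `nab4`. This turns constancy of an
expression in all orthonormal frames into an identity for `∇T`. -/
theorem hasDerivAt_tensor4_parallel {T : Euc m → Euc m → Euc m → Euc m → Euc m → ℝ}
    (hT : IsTensor4On U T) (hU : IsOpen U) (ht : γ t ∈ U) (hγ : HasDerivAt γ (V t) t)
    (hA : HasDerivAt A (-Γ (γ t) (V t) (A t)) t) (hB : HasDerivAt B (-Γ (γ t) (V t) (B t)) t)
    (hC : HasDerivAt C (-Γ (γ t) (V t) (C t)) t) (hD : HasDerivAt D (-Γ (γ t) (V t) (D t)) t) :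
    HasDerivAt (fun s => T (γ s) (A s) (B s) (C s) (D s))
      (nab4 Γ T (γ t) (V t) (A t) (B t) (C t) (D t)) t := by
  have hev : ∀ᶠ s in 𝓝 t, γ s ∈ U := hγ.continuousAt.eventually (hU.mem_nhds ht)
  have h0 : ∀ a b c d, HasDerivAt (fun s => T (γ s) a b c d)
      (fderiv ℝ (fun y => T y a b c d) (γ t) (V t)) t :=
    fun a b c d => (hT.diff ht a b c d).hasFDerivAt.comp_hasDerivAt t hγ
  have h1 := fun b c d => hasDerivAt_slot (L := fun s a => T (γ s) a b c d)
    (by filter_upwards [hev] with s hs using hT.lin1 _ hs _ _ _) (fun a => h0 a b c d) hA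
  have h2 := fun c d => hasDerivAt_slot (L := fun s b => T (γ s) (A s) b c d)
    (by filter_upwards [hev] with s hs using hT.lin2 _ hs _ _ _) (fun b => h1 b c d) hB
  have h3 := fun d => hasDerivAt_slot (L := fun s c => T (γ s) (A s) (B s) c d)
    (by filter_upwards [hev] with s hs using hT.lin3 _ hs _ _ _) (fun c => h2 c d) hC
  have h4 := hasDerivAt_slot (L := fun s d => T (γ s) (A s) (B s) (C s) d)
    (by filter_upwards [hev] with s hs using hT.lin4 _ hs _ _ _) h3 hD
  refine h4.congr_deriv ?_
  rw [(hT.lin1 _ ht _ _ _).map_neg, (hT.lin2 _ ht _ _ _).map_neg, (hT.lin3 _ ht _ _ _).map_neg,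
    (hT.lin4 _ ht _ _ _).map_neg, nab4]
  ring

theorem hasDerivAt_tensor5_parallel {T : Euc m → Euc m → Euc m → Euc m → Euc m → Euc m → ℝ}
    (hT : IsTensor5On U T) (hU : IsOpen U) (ht : γ t ∈ U) (hγ : HasDerivAt γ (V t) t)
    (hK : HasDerivAt K (-Γ (γ t) (V t) (K t)) t)
    (hA : HasDerivAt A (-Γ (γ t) (V t) (A t)) t) (hB : HasDerivAt B (-Γ (γ t) (V t) (B t)) t)
    (hC : HasDerivAt C (-Γ (γ t) (V t) (C t)) t) (hD : HasDerivAt D (-Γ (γ t) (V t) (D t)) t) :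
    HasDerivAt (fun s => T (γ s) (K s) (A s) (B s) (C s) (D s))
      (nab5 Γ T (γ t) (V t) (K t) (A t) (B t) (C t) (D t)) t := by
  have hev : ∀ᶠ s in 𝓝 t, γ s ∈ U := hγ.continuousAt.eventually (hU.mem_nhds ht)
  have h00 : ∀ k a b c d, HasDerivAt (fun s => T (γ s) k a b c d)
      (fderiv ℝ (fun y => T y k a b c d) (γ t) (V t)) t :=
    fun k a b c d => ((hT.smooth _ ht k a b c d).differentiableAt
      (by simp)).hasFDerivAt.comp_hasDerivAt t hγ
  have h0 := fun a b c d => hasDerivAt_slot (L := fun s k => T (γ s) k a b c d)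
    (by filter_upwards [hev] with s hs using hT.lin0 _ hs _ _ _ _) (fun k => h00 k a b c d) hK
  have h1 := fun b c d => hasDerivAt_slot (L := fun s a => T (γ s) (K s) a b c d)
    (by filter_upwards [hev] with s hs using hT.lin1 _ hs _ _ _ _) (fun a => h0 a b c d) hA
  have h2 := fun c d => hasDerivAt_slot (L := fun s b => T (γ s) (K s) (A s) b c d)
    (by filter_upwards [hev] with s hs using hT.lin2 _ hs _ _ _ _) (fun b => h1 b c d) hB
  have h3 := fun d => hasDerivAt_slot (L := fun s c => T (γ s) (K s) (A s) (B s) c d)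
    (by filter_upwards [hev] with s hs using hT.lin3 _ hs _ _ _ _) (fun c => h2 c d) hC
  have h4 := hasDerivAt_slot (L := fun s d => T (γ s) (K s) (A s) (B s) (C s) d)
    (by filter_upwards [hev] with s hs using hT.lin4 _ hs _ _ _ _) h3 hD
  refine h4.congr_deriv ?_
  rw [(hT.lin0 _ ht _ _ _ _).map_neg, (hT.lin1 _ ht _ _ _ _).map_neg,
    (hT.lin2 _ ht _ _ _ _).map_neg, (hT.lin3 _ ht _ _ _ _).map_neg,
    (hT.lin4 _ ht _ _ _ _).map_neg, nab5]
  ring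

end Along

/-- Orthonormal bases of a metric in coordinates. -/
def IsOrthonormalAt (G : Euc m → Euc m → Euc m → ℝ) (y : Euc m) (e : Fin m → Euc m) : Prop :=
  ∀ i j, G y (e i) (e j) = if i = j then 1 else 0

namespace IsMetricOn

variable {G : Euc m → Euc m → Euc m → ℝ} (h : IsMetricOn U G)
include h

/-- The inner products of parallel fields have zero derivative, so they keep their initial values.
-/
theorem exists_parallel_orthonormal_frame {z₀ : Euc m} (hz₀ : z₀ ∈ U) (x : Euc m)
    {e : Fin m → Euc m} (he : IsOrthonormalAt G z₀ e) :
    ∃ (γ V : ℝ → Euc m) (E : Fin m → ℝ → Euc m), γ 0 = z₀ ∧ V 0 = x ∧ (∀ a, E a 0 = e a) ∧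
      ∀ᶠ t in 𝓝 (0 : ℝ), γ t ∈ U ∧ HasDerivAt γ (V t) t ∧
        HasDerivAt V (-christoffel G (γ t) (V t) (V t)) t ∧
        (∀ a, HasDerivAt (E a) (-christoffel G (γ t) (V t) (E a t)) t) ∧
        IsOrthonormalAt G (γ t) (fun a => E a t) := by
  obtain ⟨γ, V, E, h0, h1, h2, hev⟩ := exists_parallel_frame h.isConnectionOn hz₀ x e
  refine ⟨γ, V, E, h0, h1, h2, ?_⟩
  -- A ball is chosen because a vanishing derivative forces constancy only on a connected set.
  obtain ⟨ε, hε, hball⟩ := Metric.eventually_nhds_iff_ball.1 hev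
  filter_upwards [Metric.ball_mem_nhds (0 : ℝ) hε] with t ht
  obtain ⟨a1, a2, a3, a4⟩ := hball t ht
  refine ⟨a1, a2, a3, a4, fun i j => ?_⟩
  have hd : ∀ s ∈ Metric.ball (0 : ℝ) ε, HasDerivAt (fun s => G (γ s) (E i s) (E j s)) 0 s := by
    intro s hs
    obtain ⟨b1, b2, -, b4⟩ := hball s hs
    exact hasDerivAt_metric_parallel h b1 b2 (b4 i) (b4 j)
  have := Metric.isOpen_ball.is_const_of_deriv_eq_zero (convex_ball (0 : ℝ) ε).isPreconnected
    (fun s hs => (hd s hs).differentiableAt.differentiableWithinAt)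
    (fun s hs => (hd s hs).deriv) ht (Metric.mem_ball_self hε)
  refine Eq.trans this ?_
  rw [h0, h2, h2]
  exact he i j

/-- The covariant derivative of the Ricci tensor of an Einstein metric vanishes. -/
theorem nabla_ricci_eq_zero {Λ : ℝ}
    (hE : ∀ y ∈ U, ∀ e, IsOrthonormalAt G y e → ∀ i j,
      ∑ a, curvatureCoord G y (e a) (e i) (e j) (e a) = if i = j then Λ else 0)
    {z : Euc m} (hz : z ∈ U) {e : Fin m → Euc m} (he : IsOrthonormalAt G z e) (x : Euc m)
    (i j : Fin m) :
    ∑ a, nablaCurvatureCoord G z x (e a) (e i) (e j) (e a) = 0 := by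
  obtain ⟨γ, V, E, h0, h1, h2, hev⟩ := h.exists_parallel_orthonormal_frame hz x he
  obtain ⟨a1, a2, a3, a4, -⟩ := hev.self_of_nhds
  have hd : HasDerivAt (fun t => ∑ a, curvatureCoord G (γ t) (E a t) (E i t) (E j t) (E a t))
      (∑ a, nablaCurvatureCoord G (γ 0) (V 0) (E a 0) (E i 0) (E j 0) (E a 0))
      0 :=
    HasDerivAt.fun_sum fun a _ => hasDerivAt_tensor4_parallel h.isTensor4On_curvature h.isOpen
      a1 a2 (a4 a) (a4 i) (a4 j) (a4 a)
  -- The moving frame stays orthonormal near 0, so the Einstein condition fixes these components and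
  -- the derivative just computed must vanish.
  have hc : (fun t => ∑ a, curvatureCoord G (γ t) (E a t) (E i t) (E j t) (E a t)) =ᶠ[𝓝 0]
      fun _ => if i = j then Λ else 0 := by
    filter_upwards [hev] with t ht
    exact hE _ ht.1 _ ht.2.2.2.2 i j
  have := hd.unique ((hasDerivAt_const (0 : ℝ) (if i = j then Λ else 0)).congr_of_eventuallyEq hc)
  simpa only [h0, h1, h2] using this

theorem nabla_swap12 {z : Euc m} (hz : z ∈ U) (x a b c d : Euc m) :
    nablaCurvatureCoord G z x a b c d = -nablaCurvatureCoord G z x b a c d :=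
  nab4_swap12 (Γ := christoffel G) (T := curvatureCoord G) h.isOpen (fun _ hz a b c d => curvature_swap _ a b c d (h.lin_left hz d))
    hz x a b c d

theorem nabla_pair {z : Euc m} (hz : z ∈ U) (x a b c d : Euc m) :
    nablaCurvatureCoord G z x a b c d = nablaCurvatureCoord G z x c d a b :=
  nab4_pair (Γ := christoffel G) (T := curvatureCoord G) h.isOpen (fun _ hz a b c d => h.curvature_pair hz a b c d) hz x a b c d

theorem nabla_cyclic {z : Euc m} (hz : z ∈ U) (x a b c d : Euc m) :
    nablaCurvatureCoord G z x a b c d + nablaCurvatureCoord G z x b c a d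
      + nablaCurvatureCoord G z x c a b d = 0 :=
  nab4_cyclic (Γ := christoffel G) (T := curvatureCoord G) h.isTensor4On_curvature h.isOpen
    (fun _ hz a b c d => h.curvature_bianchi hz a b c d) hz x a b c d

theorem nabla_swap34 {z : Euc m} (hz : z ∈ U) (x a b c d : Euc m) :
    nablaCurvatureCoord G z x a b c d = -nablaCurvatureCoord G z x a b d c := by
  rw [h.nabla_pair hz, h.nabla_swap12 hz, h.nabla_pair hz]

/-- The curvature tensor of an Einstein metric is divergence free. -/
theorem divergence_eq_zero {Λ : ℝ}
    (hE : ∀ y ∈ U, ∀ e, IsOrthonormalAt G y e → ∀ i j,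
      ∑ a, curvatureCoord G y (e a) (e i) (e j) (e a) = if i = j then Λ else 0)
    {z : Euc m} (hz : z ∈ U) {e : Fin m → Euc m} (he : IsOrthonormalAt G z e)
    (b c d : Fin m) :
    ∑ i, nablaCurvatureCoord G z (e i) (e i) (e b) (e c) (e d) = 0 := by
  -- Pair symmetry moves the divergence index to the second pair; the second Bianchi identity then
  -- shifts the derivative onto `d` and `c`, leaving two gradients of the Ricci tensor.
  have key : ∀ i, nablaCurvatureCoord G z (e i) (e i) (e b) (e c) (e d) =
      nablaCurvatureCoord G z (e d) (e i) (e c) (e b) (e i)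
      - nablaCurvatureCoord G z (e c) (e i) (e d) (e b) (e i) := by
    intro i
    have h1 := h.nabla_pair hz (e i) (e i) (e b) (e c) (e d)
    have h2 := h.nabla_bianchi hz (e i) (e c) (e d) (e i) (e b)
    have h3 := h.nabla_swap12 hz (e c) (e d) (e i) (e i) (e b)
    have h4 := h.nabla_swap34 hz (e c) (e i) (e d) (e i) (e b)
    have h5 := h.nabla_swap34 hz (e d) (e i) (e c) (e i) (e b)
    linarith
  rw [Finset.sum_congr rfl fun i _ => key i, Finset.sum_sub_distrib,
    h.nabla_ricci_eq_zero hE hz he, h.nabla_ricci_eq_zero hE hz he, sub_zero]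

/-- The divergence vanishes at every point of the geodesic in the parallel frame, so its derivative,
a trace of the second covariant derivative, vanishes too. -/
theorem nabla_divergence_eq_zero {Λ : ℝ}
    (hE : ∀ y ∈ U, ∀ e, IsOrthonormalAt G y e → ∀ i j,
      ∑ a, curvatureCoord G y (e a) (e i) (e j) (e a) = if i = j then Λ else 0)
    {z : Euc m} (hz : z ∈ U) {e : Fin m → Euc m} (he : IsOrthonormalAt G z e)
    (x : Euc m) (b c d : Fin m) :
    ∑ i, nab5 (christoffel G) (nablaCurvatureCoord G) z x (e i) (e i) (e b) (e c) (e d) = 0 := by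
  obtain ⟨γ, V, E, h0, h1, h2, hev⟩ := h.exists_parallel_orthonormal_frame hz x he
  obtain ⟨a1, a2, a3, a4, -⟩ := hev.self_of_nhds
  have hN := h.isTensor4On_curvature.isTensor5On_nab4 h.isConnectionOn
  have hd : HasDerivAt
      (fun t => ∑ i, nablaCurvatureCoord G (γ t) (E i t) (E i t) (E b t) (E c t) (E d t))
      (∑ i, nab5 (christoffel G) (nablaCurvatureCoord G) (γ 0) (V 0) (E i 0) (E i 0) (E b 0)
        (E c 0) (E d 0)) 0 :=
    HasDerivAt.fun_sum fun i _ => hasDerivAt_tensor5_parallel hN h.isOpen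
      a1 a2 (a4 i) (a4 i) (a4 b) (a4 c) (a4 d)
  have hc : (fun t => ∑ i, nablaCurvatureCoord G (γ t) (E i t) (E i t) (E b t) (E c t) (E d t))
      =ᶠ[𝓝 0] fun _ => 0 := by
    filter_upwards [hev] with t ht
    exact h.divergence_eq_zero hE ht.1 ht.2.2.2.2 b c d
  have := hd.unique ((hasDerivAt_const (0 : ℝ) (0 : ℝ)).congr_of_eventuallyEq hc)
  simpa only [h0, h1, h2] using this

/-- If `|R|²` is constant then `|∇_x R|² + ⟨∇²_{x,x} R, R⟩ = 0`. -/
theorem second_derivative_normSq {c₀ : ℝ}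
    (hC : ∀ y ∈ U, ∀ e, IsOrthonormalAt G y e →
      ∑ a, ∑ b, ∑ c, ∑ d, curvatureCoord G y (e a) (e b) (e c) (e d) ^ 2 = c₀)
    {z : Euc m} (hz : z ∈ U) {e : Fin m → Euc m} (he : IsOrthonormalAt G z e) (x : Euc m) :
    ∑ a, ∑ b, ∑ c, ∑ d, (nablaCurvatureCoord G z x (e a) (e b) (e c) (e d) ^ 2
      + curvatureCoord G z (e a) (e b) (e c) (e d) *
        nab5 (christoffel G) (nablaCurvatureCoord G) z x x (e a) (e b) (e c) (e d)) = 0 := by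
  obtain ⟨γ, V, E, h0, h1, h2, hev⟩ := h.exists_parallel_orthonormal_frame hz x he
  have hN := h.isTensor4On_curvature.isTensor5On_nab4 h.isConnectionOn
  have hR : ∀ᶠ t in 𝓝 (0 : ℝ), ∀ a b c d,
      HasDerivAt (fun t => curvatureCoord G (γ t) (E a t) (E b t) (E c t) (E d t))
        (nablaCurvatureCoord G (γ t) (V t) (E a t) (E b t) (E c t) (E d t)) t := by
    filter_upwards [hev] with t ⟨a1, a2, a3, a4, _⟩ a b c d
    exact hasDerivAt_tensor4_parallel h.isTensor4On_curvature h.isOpen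
      a1 a2 (a4 a) (a4 b) (a4 c) (a4 d)
  have hR' : ∀ a b c d,
      HasDerivAt (fun t => nablaCurvatureCoord G (γ t) (V t) (E a t) (E b t) (E c t) (E d t))
        (nab5 (christoffel G) (nablaCurvatureCoord G) (γ 0) (V 0) (V 0) (E a 0) (E b 0)
          (E c 0) (E d 0)) 0 := by
    obtain ⟨a1, a2, a3, a4, -⟩ := hev.self_of_nhds
    intro a b c d
    exact hasDerivAt_tensor5_parallel hN h.isOpen a1 a2 a3 (a4 a) (a4 b) (a4 c) (a4 d)
  -- The first derivative of |R|² must vanish for all `t` near 0, not only at 0, since it is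
  -- differentiated once more; hence the constancy is used near each such `t`.
  have hfirst : (fun t => ∑ a, ∑ b, ∑ c, ∑ d,
      curvatureCoord G (γ t) (E a t) (E b t) (E c t) (E d t) *
        nablaCurvatureCoord G (γ t) (V t) (E a t) (E b t) (E c t) (E d t)) =ᶠ[𝓝 0]
      fun _ => 0 := by
    filter_upwards [hR, hev.eventually_nhds] with t ht hevt
    have hd : HasDerivAt (fun t => ∑ a, ∑ b, ∑ c, ∑ d,
        curvatureCoord G (γ t) (E a t) (E b t) (E c t) (E d t) ^ 2)
        (∑ a, ∑ b, ∑ c, ∑ d, (2 * (curvatureCoord G (γ t) (E a t) (E b t) (E c t) (E d t) *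
          nablaCurvatureCoord G (γ t) (V t) (E a t) (E b t) (E c t) (E d t)))) t := by
      refine HasDerivAt.fun_sum fun a _ => HasDerivAt.fun_sum fun b _ => HasDerivAt.fun_sum
        fun c _ => HasDerivAt.fun_sum fun d _ => ?_
      refine ((ht a b c d).pow 2).congr_deriv ?_
      push_cast
      ring
    have hc : (fun t => ∑ a, ∑ b, ∑ c, ∑ d,
        curvatureCoord G (γ t) (E a t) (E b t) (E c t) (E d t) ^ 2) =ᶠ[𝓝 t] fun _ => c₀ := by
      filter_upwards [hevt] with s hs
      exact hC _ hs.1 _ hs.2.2.2.2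
    have := hd.unique ((hasDerivAt_const t c₀).congr_of_eventuallyEq hc)
    simp only [← Finset.mul_sum] at this
    linarith
  have hd : HasDerivAt (fun t => ∑ a, ∑ b, ∑ c, ∑ d,
      curvatureCoord G (γ t) (E a t) (E b t) (E c t) (E d t) *
        nablaCurvatureCoord G (γ t) (V t) (E a t) (E b t) (E c t) (E d t))
      (∑ a, ∑ b, ∑ c, ∑ d,
        (nablaCurvatureCoord G (γ 0) (V 0) (E a 0) (E b 0) (E c 0) (E d 0) ^ 2
        + curvatureCoord G (γ 0) (E a 0) (E b 0) (E c 0) (E d 0) *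
        nab5 (christoffel G) (nablaCurvatureCoord G) (γ 0) (V 0) (V 0) (E a 0) (E b 0) (E c 0)
          (E d 0))) 0 := by
    refine HasDerivAt.fun_sum fun a _ => HasDerivAt.fun_sum fun b _ => HasDerivAt.fun_sum
      fun c _ => HasDerivAt.fun_sum fun d _ => ?_
    refine ((hR.self_of_nhds a b c d).mul (hR' a b c d)).congr_deriv ?_
    ring
  have := hd.unique ((hasDerivAt_const (0 : ℝ) (0 : ℝ)).congr_of_eventuallyEq hfirst)
  simpa only [h0, h1, h2] using this

/-- Expansion of a vector in an orthonormal basis. -/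
theorem eq_sum_of_orthonormal {z : Euc m} (hz : z ∈ U) {e : Fin m → Euc m}
    (he : IsOrthonormalAt G z e) (v : Euc m) : v = ∑ k, G z v (e k) • e k := by
  have hli : LinearIndependent ℝ e := by
    rw [Fintype.linearIndependent_iff]
    intro c hc i
    have h1 := isLinearMap_sum (h.lin_left hz (e i)) Finset.univ c e
    rw [hc, (h.lin_left hz (e i)).map_zero] at h1
    simpa [he _ i] using h1.symm
  let b := Module.Basis.mk hli (hli.span_eq_top_of_card_eq_finrank' (by simp)).ge
  have hb : ∀ k, b k = e k := fun k => by simp [b]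
  have h1 : v = ∑ k, b.repr v k • e k := by
    conv_lhs => rw [← b.sum_repr v]
    simp [hb]
  have h2 : ∀ k, G z v (e k) = b.repr v k := by
    intro k
    conv_lhs => rw [h1]
    rw [isLinearMap_sum (h.lin_left hz (e k))]
    simp [he _ k]
  simp only [h2]
  exact h1

end IsMetricOn

end Local

end AsymptoticHarmonic
end

noncomputable section
namespace AsymptoticHarmonic

open Filter Topology

/-! ### Naturality of the curvature under changes of coordinates -/

section Naturality

variable {m : ℕ}

/-- `G'` on `U'` is the pullback under the local diffeomorphism `ψ` of the metric `G` on `U`. -/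
structure IsPullbackOn (U U' : Set (Euc m)) (ψ : Euc m → Euc m)
    (G G' : Euc m → Euc m → Euc m → ℝ) : Prop where
  metric : IsMetricOn U G
  metric' : IsMetricOn U' G'
  mapsTo : ∀ z ∈ U', ψ z ∈ U
  smooth : ∀ z ∈ U', ContDiffAt ℝ ∞ ψ z
  surj : ∀ z ∈ U', Function.Surjective (fderiv ℝ ψ z)
  eq : ∀ z ∈ U', ∀ v w, G' z v w = G (ψ z) (fderiv ℝ ψ z v) (fderiv ℝ ψ z w)

namespace IsPullbackOn

variable {U U' : Set (Euc m)} {ψ : Euc m → Euc m} {G G' : Euc m → Euc m → Euc m → ℝ}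
  (h : IsPullbackOn U U' ψ G G') {z : Euc m} (hz : z ∈ U')
include h hz

theorem ev : ∀ᶠ y in 𝓝 z, ψ y ∈ U := by
  filter_upwards [h.metric'.mem_nhds hz] with y hy using h.mapsTo y hy

theorem diff : DifferentiableAt ℝ ψ z := (h.smooth z hz).differentiableAt (by simp)

theorem smooth_deriv (v : Euc m) : ContDiffAt ℝ ∞ (fun y => fderiv ℝ ψ y v) z :=
  contDiffAt_fderiv_apply (h.smooth z hz) v

theorem diff_deriv (v : Euc m) : DifferentiableAt ℝ (fun y => fderiv ℝ ψ y v) z :=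
  (h.smooth_deriv hz v).differentiableAt (by simp)

theorem fderiv_comp_pullback {F : Type*} [NormedAddCommGroup F] [NormedSpace ℝ F] {f : Euc m → F}
    (hf : DifferentiableAt ℝ f (ψ z)) (u : Euc m) :
    fderiv ℝ (fun y => f (ψ y)) z u = fderiv ℝ f (ψ z) (fderiv ℝ ψ z u) := by
  rw [fderiv_fun_comp z hf (h.diff hz)]
  rfl

theorem fderiv_metric (u v w : Euc m) :
    fderiv ℝ (fun y => G' y v w) z u =
      fderiv ℝ (fun y => G y (fderiv ℝ ψ z v) (fderiv ℝ ψ z w)) (ψ z) (fderiv ℝ ψ z u)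
      + G (ψ z) (fderiv ℝ (fun y => fderiv ℝ ψ y v) z u) (fderiv ℝ ψ z w)
      + G (ψ z) (fderiv ℝ ψ z v) (fderiv ℝ (fun y => fderiv ℝ ψ y w) z u) := by
  have h0 : (fun y => G' y v w) =ᶠ[𝓝 z]
      fun y => G (ψ y) (fderiv ℝ ψ y v) (fderiv ℝ ψ y w) := by
    filter_upwards [h.metric'.mem_nhds hz] with y hy using h.eq y hy v w
  have hd : ∀ p q, DifferentiableAt ℝ (fun y => G (ψ y) p q) z := fun p q =>
    (h.metric.diff (h.mapsTo z hz) p q).comp z (h.diff hz)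
  have hl1 : ∀ q, ∀ᶠ y in 𝓝 z, IsLinearMap ℝ (fun p => G (ψ y) p q) := fun q => by
    filter_upwards [h.ev hz] with y hy using h.metric.lin_left hy q
  have hl2 : ∀ᶠ y in 𝓝 z, IsLinearMap ℝ (fun q => G (ψ y) (fderiv ℝ ψ y v) q) := by
    filter_upwards [h.ev hz] with y hy using h.metric.lin_right _ hy _
  rw [h0.fderiv_eq, fderiv_slot (L := fun y q => G (ψ y) (fderiv ℝ ψ y v) q) hl2
    (fun q => differentiableAt_slot (L := fun y p => G (ψ y) p q) (hl1 q) (fun p => hd p q)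
      (h.diff_deriv hz v)) (h.diff_deriv hz w),
    fderiv_slot (L := fun y p => G (ψ y) p (fderiv ℝ ψ z w)) (hl1 _) (fun p => hd p _)
      (h.diff_deriv hz v),
    h.fderiv_comp_pullback hz (f := fun y => G y (fderiv ℝ ψ z v) (fderiv ℝ ψ z w))
      (h.metric.diff (h.mapsTo z hz) _ _)]

theorem hessian_symm (u v : Euc m) :
    fderiv ℝ (fun y => fderiv ℝ ψ y v) z u = fderiv ℝ (fun y => fderiv ℝ ψ y u) z v :=
  fderiv_fderiv_comm (h.smooth z hz) v u

/-- The transformation law of the Christoffel symbols. -/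
theorem christoffel_eq (u v : Euc m) :
    fderiv ℝ ψ z (christoffel G' z u v) =
      christoffel G (ψ z) (fderiv ℝ ψ z u) (fderiv ℝ ψ z v)
        + fderiv ℝ (fun y => fderiv ℝ ψ y v) z u := by
  have hm := h.mapsTo z hz
  -- By nondegeneracy it suffices to pair with all vectors, and surjectivity of the differential of
  -- `ψ` makes each of them an image.
  refine h.metric.eq_of_forall hm fun x => ?_
  obtain ⟨w, rfl⟩ := h.surj z hz x

  rw [← h.eq z hz, h.metric'.metric_christoffel hz, (h.metric.lin_left hm _).map_add,
    h.metric.metric_christoffel hm]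
  -- By symmetry of the Hessian of `ψ`, its contributions to the Koszul combination cancel, except
  -- for two equal ones paired with `w`.
  simp only [christoffelFirst, h.fderiv_metric hz]
  rw [h.hessian_symm hz v u, h.hessian_symm hz w u, h.hessian_symm hz w v,
    h.metric.symm _ hm (fderiv ℝ ψ z v), h.metric.symm _ hm (fderiv ℝ ψ z u)]
  ring

/-- Differentiate the transformation law of the Christoffel symbols and antisymmetrize. Third
derivatives of `ψ` drop out by symmetry, and the Hessian terms cancel against those from the
quadratic part of the curvature. -/
theorem connCurvature_eq (u v w : Euc m) :
    fderiv ℝ ψ z (connCurvature (christoffel G') z u v w) =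
      connCurvature (christoffel G) (ψ z) (fderiv ℝ ψ z u) (fderiv ℝ ψ z v) (fderiv ℝ ψ z w) := by
  have hm := h.mapsTo z hz
  have hc := h.metric.isConnectionOn
  have hc' := h.metric'.isConnectionOn
  have key : ∀ u v, fderiv ℝ (fun y => fderiv ℝ ψ y (christoffel G' z v w)) z u
        + fderiv ℝ ψ z (fderiv ℝ (fun y => christoffel G' y v w) z u) =
      fderiv ℝ (fun y => christoffel G y (fderiv ℝ ψ z v) (fderiv ℝ ψ z w)) (ψ z) (fderiv ℝ ψ z u)
      + christoffel G (ψ z) (fderiv ℝ (fun y => fderiv ℝ ψ y v) z u) (fderiv ℝ ψ z w)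
      + christoffel G (ψ z) (fderiv ℝ ψ z v) (fderiv ℝ (fun y => fderiv ℝ ψ y w) z u)
      + fderiv ℝ (fun y => fderiv ℝ (fun y => fderiv ℝ ψ y w) y v) z u := by
    intro u v
    have h0 : (fun y => fderiv ℝ ψ y (christoffel G' y v w)) =ᶠ[𝓝 z]
        fun y => christoffel G (ψ y) (fderiv ℝ ψ y v) (fderiv ℝ ψ y w)
          + fderiv ℝ (fun y => fderiv ℝ ψ y w) y v := by
      filter_upwards [h.metric'.mem_nhds hz] with y hy using h.christoffel_eq hy v w
    have hd : ∀ p q, DifferentiableAt ℝ (fun y => christoffel G (ψ y) p q) z := fun p q =>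
      (hc.diff hm p q).comp z (h.diff hz)
    have hl1 : ∀ q, ∀ᶠ y in 𝓝 z, IsLinearMap ℝ (fun p => christoffel G (ψ y) p q) := fun q => by
      filter_upwards [h.ev hz] with y hy using hc.lin_left hy q
    have hl2 : ∀ᶠ y in 𝓝 z, IsLinearMap ℝ (fun q => christoffel G (ψ y) (fderiv ℝ ψ y v) q) := by
      filter_upwards [h.ev hz] with y hy using hc.lin_right _ hy _
    have hd1 := fun q => differentiableAt_slot (L := fun y p => christoffel G (ψ y) p q) (hl1 q)
      (fun p => hd p q) (h.diff_deriv hz v)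
    have hd2 := differentiableAt_slot (L := fun y q => christoffel G (ψ y) (fderiv ℝ ψ y v) q) hl2
      hd1 (h.diff_deriv hz w)
    have hd3 : DifferentiableAt ℝ (fun y => fderiv ℝ (fun y => fderiv ℝ ψ y w) y v) z :=
      (contDiffAt_fderiv_apply (h.smooth_deriv hz w) v).differentiableAt (by simp)
    have e1 := fderiv_slot (L := fun y p => fderiv ℝ ψ y p)
      (Eventually.of_forall fun y => isLinearMap_fderiv_apply ψ y)
      (fun p => h.diff_deriv hz p) (hc'.diff hz v w) u
    rw [← e1, h0.fderiv_eq, fderiv_fun_add hd2 hd3, add_apply,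
      fderiv_slot (L := fun y q => christoffel G (ψ y) (fderiv ℝ ψ y v) q) hl2
        hd1 (h.diff_deriv hz w),
      fderiv_slot (L := fun y p => christoffel G (ψ y) p (fderiv ℝ ψ z w)) (hl1 _)
        (fun p => hd p _) (h.diff_deriv hz v),
      h.fderiv_comp_pullback hz
        (f := fun y => christoffel G y (fderiv ℝ ψ z v) (fderiv ℝ ψ z w)) (hc.diff hm _ _)]
  have k1 := key u v
  have k2 := key v u
  have h3 := fderiv_fderiv_comm (h.smooth_deriv hz w) v u
  rw [h3] at k1
  rw [h.hessian_symm hz v u] at k2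
  have k1' := eq_sub_of_add_eq' k1
  have k2' := eq_sub_of_add_eq' k2
  simp only [connCurvature, map_add, map_sub, h.christoffel_eq hz, k1', k2',
    (hc.lin_right _ hm _).map_add]
  abel

/-- The curvature tensor is natural under local diffeomorphisms. -/
theorem curvatureCoord_eq (a b c d : Euc m) :
    curvatureCoord G' z a b c d =
      curvatureCoord G (ψ z) (fderiv ℝ ψ z a) (fderiv ℝ ψ z b) (fderiv ℝ ψ z c)
        (fderiv ℝ ψ z d) := by
  change G' z (connCurvature _ _ _ _ _) d = G (ψ z) (connCurvature _ _ _ _ _) _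
  rw [h.eq z hz, h.connCurvature_eq hz]

end IsPullbackOn

end Naturality

end AsymptoticHarmonic
end

/-! ### The metric in a chart, and independence of the curvature from the chart. -/

noncomputable section
namespace AsymptoticHarmonic

open Filter Topology

section Manifold

variable {m : ℕ} {M : Type*} [TopologicalSpace M] [ChartedSpace (EuclideanSpace ℝ (Fin m)) M]
  [IsManifold (𝓡 m) ∞ M]

section Chart

variable (p : M)

theorem mdifferentiableAt_chart_symm {y : Euc m} (hy : y ∈ (extChartAt (𝓡 m) p).target) :
    MDifferentiableAt 𝓘(ℝ, Euc m) (𝓡 m) (extChartAt (𝓡 m) p).symm y := by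
  have := mdifferentiableWithinAt_extChartAt_symm hy
  rwa [ModelWithCorners.range_eq_univ, mdifferentiableWithinAt_univ] at this

theorem isInvertible_mfderiv_chart_symm {y : Euc m} (hy : y ∈ (extChartAt (𝓡 m) p).target) :
    (mfderiv 𝓘(ℝ, Euc m) (𝓡 m) (extChartAt (𝓡 m) p).symm y).IsInvertible := by
  have := isInvertible_mfderivWithin_extChartAt_symm hy
  rwa [ModelWithCorners.range_eq_univ, mfderivWithin_univ] at this

theorem mfderiv_chart_symm_comp {y : Euc m} (hy : y ∈ (extChartAt (𝓡 m) p).target)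
    (v : TangentSpace (𝓡 m) ((extChartAt (𝓡 m) p).symm y)) :
    mfderiv 𝓘(ℝ, Euc m) (𝓡 m) (extChartAt (𝓡 m) p).symm y
      (mfderiv (𝓡 m) 𝓘(ℝ, Euc m) (extChartAt (𝓡 m) p) ((extChartAt (𝓡 m) p).symm y) v) = v := by
  have := mfderivWithin_extChartAt_symm_comp_mfderiv_extChartAt (I := 𝓡 m) hy
  rw [ModelWithCorners.range_eq_univ, mfderivWithin_univ] at this
  exact DFunLike.congr_fun this v

/-- The coordinate field is the tangent map of the inverse chart composed with the constant section
`z ↦ (z, v)`. It gives smoothness of the metric coefficients. -/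
theorem contMDiffAt_mfderiv_chart_symm {y : Euc m} (hy : y ∈ (extChartAt (𝓡 m) p).target)
    (v : Euc m) :
    ContMDiffAt 𝓘(ℝ, Euc m) (𝓡 m).tangent ∞ (fun z =>
      (⟨(extChartAt (𝓡 m) p).symm z,
        mfderiv 𝓘(ℝ, Euc m) (𝓡 m) (extChartAt (𝓡 m) p).symm z v⟩ : TangentBundle (𝓡 m) M)) y := by
  have ho := isOpen_extChartAt_target (I := 𝓡 m) p
  have h1 := (contMDiffOn_extChartAt_symm (n := ∞) (I := 𝓡 m) p).contMDiffOn_tangentMapWithin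
    (m := ∞) (by simp) ho.uniqueMDiffOn
  have h2 : ContMDiff 𝓘(ℝ, Euc m) 𝓘(ℝ, Euc m).tangent ∞
      (fun z => (⟨z, v⟩ : TangentBundle 𝓘(ℝ, Euc m) (Euc m))) := fun z =>
    contMDiffAt_vectorSpace_iff_contDiffAt.2 contDiffAt_const
  have h3 := h1.comp h2.contMDiffOn (s := (extChartAt (𝓡 m) p).target) (fun z hz => hz)
  refine (h3.contMDiffAt (ho.mem_nhds hy)).congr_of_eventuallyEq ?_
  filter_upwards [ho.mem_nhds hy] with z hz
  have h4 := mfderivWithin_of_isOpen (I := 𝓘(ℝ, Euc m)) (I' := 𝓡 m)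
    (f := (extChartAt (𝓡 m) p).symm) ho hz
  simp only [Function.comp_apply, tangentMapWithin, h4]

variable (g : Bundle.ContMDiffRiemannianMetric (𝓡 m) ∞ (EuclideanSpace ℝ (Fin m))
      (fun q : M => TangentSpace (𝓡 m) q))

theorem isMetricOn_metricInChart :
    IsMetricOn (extChartAt (𝓡 m) p).target (metricInChart g p) where
  isOpen := isOpen_extChartAt_target p
  lin_right z hz v := ((g.inner ((extChartAt (𝓡 m) p).symm z)
    (mfderiv 𝓘(ℝ, Euc m) (𝓡 m) (extChartAt (𝓡 m) p).symm z v)).comp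
    (mfderiv 𝓘(ℝ, Euc m) (𝓡 m) (extChartAt (𝓡 m) p).symm z)).toLinearMap.isLinear
  symm z hz v w := g.symm _ _ _
  pos z hz v hv := by
    refine g.pos _ _ ?_
    have := (isInvertible_mfderiv_chart_symm p hz).injective
    intro h0
    exact hv (this (h0.trans (map_zero _).symm))
  smooth z hz v w := by
    have hb : ContMDiffAt 𝓘(ℝ, Euc m) (𝓡 m) ∞ (extChartAt (𝓡 m) p).symm z :=
      (contMDiffOn_extChartAt_symm p).contMDiffAt
        ((isOpen_extChartAt_target p).mem_nhds hz)
    have hg := ContMDiffAt.comp z (g.contMDiff _) hb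
    have h3 := ContMDiffAt.clm_bundle_apply₂ (F₁ := Euc m) (F₂ := Euc m) (F₃ := ℝ)
      (E₃ := Bundle.Trivial M ℝ) hg
      (contMDiffAt_mfderiv_chart_symm p hz v) (contMDiffAt_mfderiv_chart_symm p hz w)
    simp only [Bundle.contMDiffAt_totalSpace] at h3
    exact h3.2.contDiffAt

theorem metricInChart_mfderiv {q : M} (hq : q ∈ (extChartAt (𝓡 m) p).source)
    (v w : TangentSpace (𝓡 m) q) :
    metricInChart g p (extChartAt (𝓡 m) p q)
      (mfderiv (𝓡 m) 𝓘(ℝ, Euc m) (extChartAt (𝓡 m) p) q v)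
      (mfderiv (𝓡 m) 𝓘(ℝ, Euc m) (extChartAt (𝓡 m) p) q w) = g.inner q v w := by
  obtain ⟨y, hy, rfl⟩ : ∃ y ∈ (extChartAt (𝓡 m) p).target, (extChartAt (𝓡 m) p).symm y = q :=
    ⟨_, (extChartAt (𝓡 m) p).map_source hq, (extChartAt (𝓡 m) p).left_inv hq⟩
  have h1 : ∀ a b : Euc m, metricInChart g p
      (extChartAt (𝓡 m) p ((extChartAt (𝓡 m) p).symm y)) a b = metricInChart g p y a b := by
    rw [(extChartAt (𝓡 m) p).right_inv hy]; exact fun _ _ => rfl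
  refine (h1 _ _).trans ?_
  unfold metricInChart
  rw [mfderiv_chart_symm_comp p hy, mfderiv_chart_symm_comp p hy]

theorem metricInChart_toChart (v w : TangentSpace (𝓡 m) p) :
    metricInChart g p (extChartAt (𝓡 m) p p) (toChart p v) (toChart p w) = g.inner p v w :=
  metricInChart_mfderiv p g (mem_extChartAt_source p) v w

variable (q : M)

omit [IsManifold (𝓡 m) ∞ M] in
theorem isOpen_chart_overlap : IsOpen ((extChartAt (𝓡 m) p).target ∩
    (extChartAt (𝓡 m) p).symm ⁻¹' (extChartAt (𝓡 m) q).source) :=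
  (continuousOn_extChartAt_symm p).isOpen_inter_preimage (isOpen_extChartAt_target p)
    (isOpen_extChartAt_source q)

theorem fderiv_transition {z : Euc m} (hz : z ∈ (extChartAt (𝓡 m) p).target)
    (hz' : (extChartAt (𝓡 m) p).symm z ∈ (extChartAt (𝓡 m) q).source) (v : Euc m) :
    fderiv ℝ (fun y => extChartAt (𝓡 m) q ((extChartAt (𝓡 m) p).symm y)) z v =
      mfderiv (𝓡 m) 𝓘(ℝ, Euc m) (extChartAt (𝓡 m) q) ((extChartAt (𝓡 m) p).symm z)
        (mfderiv 𝓘(ℝ, Euc m) (𝓡 m) (extChartAt (𝓡 m) p).symm z v) := by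
  have h1 : MDifferentiableAt (𝓡 m) 𝓘(ℝ, Euc m) (extChartAt (𝓡 m) q)
      ((extChartAt (𝓡 m) p).symm z) :=
    mdifferentiableAt_extChartAt (by rwa [extChartAt_source] at hz')
  have h2 := mfderiv_comp z h1 (mdifferentiableAt_chart_symm p hz)
  rw [mfderiv_eq_fderiv] at h2
  exact DFunLike.congr_fun h2 v

/-- Both coordinate metrics are pullbacks of `g`, so the transition map is an isometry on the
overlap; its differential is a composite of two invertible maps. -/
theorem isPullbackOn_transition :
    IsPullbackOn (extChartAt (𝓡 m) q).target
      ((extChartAt (𝓡 m) p).target ∩ (extChartAt (𝓡 m) p).symm ⁻¹' (extChartAt (𝓡 m) q).source)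
      (fun y => extChartAt (𝓡 m) q ((extChartAt (𝓡 m) p).symm y))
      (metricInChart g q) (metricInChart g p) where
  metric := isMetricOn_metricInChart q g
  metric' := by
    have h := isMetricOn_metricInChart p g
    exact ⟨isOpen_chart_overlap p q, fun z hz => h.lin_right z hz.1, fun z hz => h.symm z hz.1,
      fun z hz => h.pos z hz.1, fun z hz => h.smooth z hz.1⟩
  mapsTo z hz := (extChartAt (𝓡 m) q).map_source hz.2
  smooth z hz := by
    have hb : ContMDiffAt 𝓘(ℝ, Euc m) (𝓡 m) ∞ (extChartAt (𝓡 m) p).symm z :=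
      (contMDiffOn_extChartAt_symm p).contMDiffAt
        ((isOpen_extChartAt_target p).mem_nhds hz.1)
    have hq : ContMDiffAt (𝓡 m) 𝓘(ℝ, Euc m) ∞ (extChartAt (𝓡 m) q)
        ((extChartAt (𝓡 m) p).symm z) :=
      contMDiffAt_extChartAt' (by have := hz.2; rwa [Set.mem_preimage, extChartAt_source] at this)
    exact (hq.comp z hb).contDiffAt
  surj z hz w := by
    obtain ⟨u, hu⟩ := (isInvertible_mfderiv_extChartAt (I := 𝓡 m) hz.2).surjective w
    obtain ⟨v, hv⟩ := (isInvertible_mfderiv_chart_symm p hz.1).surjective u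
    exact ⟨v, (fderiv_transition p q hz.1 hz.2 v).trans ((congrArg _ hv).trans hu)⟩
  eq z hz v w := by
    rw [fderiv_transition p q hz.1 hz.2, fderiv_transition p q hz.1 hz.2]
    exact (metricInChart_mfderiv q g hz.2 _ _).symm

/-- The curvature tensor of `M` can be computed in the chart at any nearby point. -/
theorem curvature_eq_curvatureCoord {y : Euc m} (hy : y ∈ (extChartAt (𝓡 m) p).target)
    (a b c d : Euc m) :
    curvature g ((extChartAt (𝓡 m) p).symm y)
      (mfderiv 𝓘(ℝ, Euc m) (𝓡 m) (extChartAt (𝓡 m) p).symm y a)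
      (mfderiv 𝓘(ℝ, Euc m) (𝓡 m) (extChartAt (𝓡 m) p).symm y b)
      (mfderiv 𝓘(ℝ, Euc m) (𝓡 m) (extChartAt (𝓡 m) p).symm y c)
      (mfderiv 𝓘(ℝ, Euc m) (𝓡 m) (extChartAt (𝓡 m) p).symm y d) =
    curvatureCoord (metricInChart g p) y a b c d := by
  have hs := mem_extChartAt_source (I := 𝓡 m) ((extChartAt (𝓡 m) p).symm y)
  -- At the nearby point, `curvature` is by definition computed in the chart centred there, so the
  -- relevant transition goes from the chart at `p` to that one.
  have h := isPullbackOn_transition p g ((extChartAt (𝓡 m) p).symm y)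
  rw [h.curvatureCoord_eq (z := y) ⟨hy, hs⟩]
  simp only [fderiv_transition p _ hy hs]
  rfl

end Chart

end Manifold

end AsymptoticHarmonic
end

noncomputable section
namespace AsymptoticHarmonic

/-! ### Reindexing of multiple sums -/

section Sums

variable {ι : Type*} [Fintype ι]

theorem sum_fin_succ_fun {n : ℕ} (F : (Fin (n + 1) → ι) → ℝ) :
    ∑ x, F x = ∑ a, ∑ x : Fin n → ι, F (Matrix.vecCons a x) := by
  rw [← (Fin.consEquiv fun _ => ι).sum_comp, Fintype.sum_prod_type]
  rfl

theorem sum_fin_zero_fun (F : (Fin 0 → ι) → ℝ) : ∑ x, F x = F ![] := by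
  rw [Fintype.sum_unique]
  congr 1

theorem sum_comp_bijective {n : ℕ} (s : Fin n → Fin n) (hs : Function.Bijective s)
    (F : (Fin n → ι) → ℝ) : ∑ x : Fin n → ι, F (x ∘ s) = ∑ x, F x :=
  ((Equiv.ofBijective s hs).symm.arrowCongr (Equiv.refl ι)).sum_comp F

/-- Renaming of six summation indices. -/
theorem sum6_reindex (ε : ℝ) (s0 s1 s2 s3 s4 s5 : Fin 6)
    (hs : Function.Bijective ![s0, s1, s2, s3, s4, s5]) {F G : ι → ι → ι → ι → ι → ι → ℝ}
    (h : ∀ x : Fin 6 → ι, F (x 0) (x 1) (x 2) (x 3) (x 4) (x 5) =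
      ε * G (x s0) (x s1) (x s2) (x s3) (x s4) (x s5)) :
    ∑ a, ∑ b, ∑ c, ∑ d, ∑ u, ∑ v, F a b c d u v =
      ε * ∑ a, ∑ b, ∑ c, ∑ d, ∑ u, ∑ v, G a b c d u v := by
  -- Iterated sums become one sum over functions on `Fin 6`, where renaming indices is
  -- precomposition with a bijection.
  have key : ∀ F : ι → ι → ι → ι → ι → ι → ℝ, ∑ a, ∑ b, ∑ c, ∑ d, ∑ u, ∑ v, F a b c d u v =
      ∑ x : Fin 6 → ι, F (x 0) (x 1) (x 2) (x 3) (x 4) (x 5) := fun F => by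
    simp only [sum_fin_succ_fun, sum_fin_zero_fun]
    rfl
  rw [key, key, Finset.sum_congr rfl fun x _ => h x, ← Finset.mul_sum,
    ← sum_comp_bijective _ hs fun x => G (x 0) (x 1) (x 2) (x 3) (x 4) (x 5)]
  rfl

/-- Renaming of five summation indices. -/
theorem sum5_reindex (ε : ℝ) (s0 s1 s2 s3 s4 : Fin 5)
    (hs : Function.Bijective ![s0, s1, s2, s3, s4]) {F G : ι → ι → ι → ι → ι → ℝ}
    (h : ∀ x : Fin 5 → ι, F (x 0) (x 1) (x 2) (x 3) (x 4) =
      ε * G (x s0) (x s1) (x s2) (x s3) (x s4)) :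
    ∑ a, ∑ b, ∑ c, ∑ d, ∑ u, F a b c d u = ε * ∑ a, ∑ b, ∑ c, ∑ d, ∑ u, G a b c d u := by
  have key : ∀ F : ι → ι → ι → ι → ι → ℝ, ∑ a, ∑ b, ∑ c, ∑ d, ∑ u, F a b c d u =
      ∑ x : Fin 5 → ι, F (x 0) (x 1) (x 2) (x 3) (x 4) := fun F => by
    simp only [sum_fin_succ_fun, sum_fin_zero_fun]
    rfl
  rw [key, key, Finset.sum_congr rfl fun x _ => h x, ← Finset.mul_sum,
    ← sum_comp_bijective _ hs fun x => G (x 0) (x 1) (x 2) (x 3) (x 4)]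
  rfl

/-- Renaming of four summation indices. -/
theorem sum4_reindex (ε : ℝ) (s0 s1 s2 s3 : Fin 4)
    (hs : Function.Bijective ![s0, s1, s2, s3]) {F G : ι → ι → ι → ι → ℝ}
    (h : ∀ x : Fin 4 → ι, F (x 0) (x 1) (x 2) (x 3) = ε * G (x s0) (x s1) (x s2) (x s3)) :
    ∑ a, ∑ b, ∑ c, ∑ d, F a b c d = ε * ∑ a, ∑ b, ∑ c, ∑ d, G a b c d := by
  have key : ∀ F : ι → ι → ι → ι → ℝ, ∑ a, ∑ b, ∑ c, ∑ d, F a b c d =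
      ∑ x : Fin 4 → ι, F (x 0) (x 1) (x 2) (x 3) := fun F => by
    simp only [sum_fin_succ_fun, sum_fin_zero_fun]
    rfl
  rw [key, key, Finset.sum_congr rfl fun x _ => h x, ← Finset.mul_sum,
    ← sum_comp_bijective _ hs fun x => G (x 0) (x 1) (x 2) (x 3)]
  rfl

end Sums

/-! ### Contraction of symmetrized expressions -/

section SymSum

variable {ι : Type*}

theorem symSum_comp_perm {n : ℕ} (T : (Fin n → ι) → ℝ) (i : Fin n → ι) (τ : Equiv.Perm (Fin n)) :
    symSum T (i ∘ τ) = symSum T i :=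
  Equiv.sum_comp (Equiv.mulLeft τ) fun σ : Equiv.Perm (Fin n) => T (i ∘ σ)

theorem symSum_eq_of_perm {n : ℕ} (T : (Fin n → ι) → ℝ) {i j : Fin n → ι}
    (τ : Equiv.Perm (Fin n)) (h : ∀ k, j k = i (τ k)) : symSum T j = symSum T i := by
  rw [← symSum_comp_perm T i τ]
  congr 1
  exact funext h

/-- A permutation is the choice of the entry `p` that goes first, followed by a permutation of the
rest. The rest is the original list with entry 0 in the place of entry `p`, which explains the order
of the lists in the expansions below. -/
theorem symSum_succ {n : ℕ} (T : (Fin (n + 1) → ι) → ℝ) (i : Fin (n + 1) → ι) :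
    symSum T i = ∑ p, symSum (fun j => T (Matrix.vecCons (i p) j))
      (fun k => i (Equiv.swap 0 p k.succ)) := by
  unfold symSum
  rw [← Equiv.Perm.decomposeFin.symm.sum_comp, Fintype.sum_prod_type]
  refine Finset.sum_congr rfl fun p _ => Finset.sum_congr rfl fun e _ => ?_
  congr 1
  funext k
  refine Fin.cases ?_ (fun k => ?_) k
  · simp
  · simp

theorem symSum_zero (T : (Fin 0 → ι) → ℝ) (i : Fin 0 → ι) : symSum T i = T ![] := by
  unfold symSum
  rw [Fintype.sum_unique]
  congr 1
  exact Subsingleton.elim _ _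

theorem symSum_one (T : (Fin 1 → ι) → ℝ) (a : ι) : symSum T ![a] = T ![a] := by
  rw [symSum_succ, Fin.sum_univ_one, symSum_zero]
  rfl

theorem symSum_two (T : (Fin 2 → ι) → ℝ) (a b : ι) :
    symSum T ![a, b] = T ![a, b] + T ![b, a] := by
  have h (p : Fin 2) (v : Fin 1 → ι) (hv : ∀ k, ![a, b] (Equiv.swap 0 p k.succ) = v k) :
      (fun k : Fin 1 => ![a, b] (Equiv.swap 0 p k.succ)) = v := funext hv
  rw [symSum_succ, Fin.sum_univ_two, h 0 ![b] (by intro k; fin_cases k; rfl),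
    h 1 ![a] (by intro k; fin_cases k; rfl), symSum_one, symSum_one]
  rfl

theorem symSum_three (T : (Fin 3 → ι) → ℝ) (a b c : ι) :
    symSum T ![a, b, c] = symSum (fun j => T (Matrix.vecCons a j)) ![b, c]
      + symSum (fun j => T (Matrix.vecCons b j)) ![a, c]
      + symSum (fun j => T (Matrix.vecCons c j)) ![b, a] := by
  have h (p : Fin 3) (v : Fin 2 → ι) (hv : ∀ k, ![a, b, c] (Equiv.swap 0 p k.succ) = v k) :
      (fun k : Fin 2 => ![a, b, c] (Equiv.swap 0 p k.succ)) = v := funext hv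
  rw [symSum_succ, Fin.sum_univ_three, h 0 ![b, c] (by intro k; fin_cases k <;> rfl),
    h 1 ![a, c] (by intro k; fin_cases k <;> rfl), h 2 ![b, a] (by intro k; fin_cases k <;> rfl)]
  rfl

theorem symSum_four (T : (Fin 4 → ι) → ℝ) (a b c d : ι) :
    symSum T ![a, b, c, d] = symSum (fun j => T (Matrix.vecCons a j)) ![b, c, d]
      + symSum (fun j => T (Matrix.vecCons b j)) ![a, c, d]
      + symSum (fun j => T (Matrix.vecCons c j)) ![b, a, d]
      + symSum (fun j => T (Matrix.vecCons d j)) ![b, c, a] := by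
  have h (p : Fin 4) (v : Fin 3 → ι) (hv : ∀ k, ![a, b, c, d] (Equiv.swap 0 p k.succ) = v k) :
      (fun k : Fin 3 => ![a, b, c, d] (Equiv.swap 0 p k.succ)) = v := funext hv
  rw [symSum_succ, Fin.sum_univ_four, h 0 ![b, c, d] (by intro k; fin_cases k <;> rfl),
    h 1 ![a, c, d] (by intro k; fin_cases k <;> rfl),
    h 2 ![b, a, d] (by intro k; fin_cases k <;> rfl),
    h 3 ![b, c, a] (by intro k; fin_cases k <;> rfl)]
  rfl

theorem symSum_five (T : (Fin 5 → ι) → ℝ) (a b c d e : ι) :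
    symSum T ![a, b, c, d, e] = symSum (fun j => T (Matrix.vecCons a j)) ![b, c, d, e]
      + symSum (fun j => T (Matrix.vecCons b j)) ![a, c, d, e]
      + symSum (fun j => T (Matrix.vecCons c j)) ![b, a, d, e]
      + symSum (fun j => T (Matrix.vecCons d j)) ![b, c, a, e]
      + symSum (fun j => T (Matrix.vecCons e j)) ![b, c, d, a] := by
  have h (p : Fin 5) (v : Fin 4 → ι) (hv : ∀ k, ![a, b, c, d, e] (Equiv.swap 0 p k.succ) = v k) :
      (fun k : Fin 4 => ![a, b, c, d, e] (Equiv.swap 0 p k.succ)) = v := funext hv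
  rw [symSum_succ, Fin.sum_univ_five, h 0 ![b, c, d, e] (by intro k; fin_cases k <;> rfl),
    h 1 ![a, c, d, e] (by intro k; fin_cases k <;> rfl),
    h 2 ![b, a, d, e] (by intro k; fin_cases k <;> rfl),
    h 3 ![b, c, a, e] (by intro k; fin_cases k <;> rfl),
    h 4 ![b, c, d, a] (by intro k; fin_cases k <;> rfl)]
  rfl

theorem symSum_six (T : (Fin 6 → ι) → ℝ) (a b c d e f : ι) :
    symSum T ![a, b, c, d, e, f] = symSum (fun j => T (Matrix.vecCons a j)) ![b, c, d, e, f]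
      + symSum (fun j => T (Matrix.vecCons b j)) ![a, c, d, e, f]
      + symSum (fun j => T (Matrix.vecCons c j)) ![b, a, d, e, f]
      + symSum (fun j => T (Matrix.vecCons d j)) ![b, c, a, e, f]
      + symSum (fun j => T (Matrix.vecCons e j)) ![b, c, d, a, f]
      + symSum (fun j => T (Matrix.vecCons f j)) ![b, c, d, e, a] := by
  have h (p : Fin 6) (v : Fin 5 → ι)
      (hv : ∀ k, ![a, b, c, d, e, f] (Equiv.swap 0 p k.succ) = v k) :
      (fun k : Fin 5 => ![a, b, c, d, e, f] (Equiv.swap 0 p k.succ)) = v := funext hv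
  rw [symSum_succ, Fin.sum_univ_six, h 0 ![b, c, d, e, f] (by intro k; fin_cases k <;> rfl),
    h 1 ![a, c, d, e, f] (by intro k; fin_cases k <;> rfl),
    h 2 ![b, a, d, e, f] (by intro k; fin_cases k <;> rfl),
    h 3 ![b, c, a, e, f] (by intro k; fin_cases k <;> rfl),
    h 4 ![b, c, d, a, f] (by intro k; fin_cases k <;> rfl),
    h 5 ![b, c, d, e, a] (by intro k; fin_cases k <;> rfl)]
  rfl

theorem symSum_sub_smul {n : ℕ} (α β : ℝ) (A B : (Fin n → ι) → ℝ) (i : Fin n → ι) :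
    symSum (fun i => α * A i - β * B i) i = α * symSum A i - β * symSum B i := by
  simp only [symSum, Finset.sum_sub_distrib, Finset.mul_sum]

variable [Fintype ι]

theorem sum_sum_swap (F : ι → ι → ℝ) : ∑ x, ∑ y, F y x = ∑ x, ∑ y, F x y := Finset.sum_comm

/-- The full contraction of a symmetrized expression with four indices. -/
theorem sum_symSum_four (T : (Fin 4 → ι) → ℝ) :
    ∑ x, ∑ y, symSum T ![x, x, y, y] =
      8 * (∑ x, ∑ y, T ![x, x, y, y] + ∑ x, ∑ y, T ![x, y, x, y] + ∑ x, ∑ y, T ![x, y, y, x]) := by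
  -- The 24 permutations produce six patterns, four times each. Summing over `x` and `y` merges
  -- patterns that differ by exchanging the letters, leaving the three pairings of four slots.
  have h : ∀ x y, symSum T ![x, x, y, y] = 4 * (T ![x, x, y, y] + T ![y, y, x, x]
      + (T ![x, y, x, y] + T ![y, x, y, x]) + (T ![x, y, y, x] + T ![y, x, x, y])) := by
    intro x y
    simp only [symSum_four, symSum_three, symSum_two]
    ring
  simp only [h, ← Finset.mul_sum, Finset.sum_add_distrib]
  rw [sum_sum_swap fun x y => T ![x, x, y, y], sum_sum_swap fun x y => T ![x, y, x, y],
    sum_sum_swap fun x y => T ![x, y, y, x]]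
  ring

/-- The full contraction of a symmetrized expression with six indices. -/
theorem sum_symSum_six (T : (Fin 6 → ι) → ℝ) :
    ∑ x, ∑ y, ∑ z, symSum T ![x, x, y, y, z, z] =
      48 * ((∑ x, ∑ y, ∑ z, T ![x, x, y, y, z, z] + ∑ x, ∑ y, ∑ z, T ![x, x, y, z, y, z]
          + ∑ x, ∑ y, ∑ z, T ![x, x, y, z, z, y])
        + (∑ x, ∑ y, ∑ z, T ![x, y, x, y, z, z] + ∑ x, ∑ y, ∑ z, T ![x, y, x, z, y, z]
          + ∑ x, ∑ y, ∑ z, T ![x, y, x, z, z, y])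
        + (∑ x, ∑ y, ∑ z, T ![x, y, y, x, z, z] + ∑ x, ∑ y, ∑ z, T ![x, y, z, x, y, z]
          + ∑ x, ∑ y, ∑ z, T ![x, y, z, x, z, y])
        + (∑ x, ∑ y, ∑ z, T ![x, y, y, z, x, z] + ∑ x, ∑ y, ∑ z, T ![x, y, z, y, x, z]
          + ∑ x, ∑ y, ∑ z, T ![x, y, z, z, x, y])
        + (∑ x, ∑ y, ∑ z, T ![x, y, y, z, z, x] + ∑ x, ∑ y, ∑ z, T ![x, y, z, y, z, x]
          + ∑ x, ∑ y, ∑ z, T ![x, y, z, z, y, x])) := by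
  -- Each of the fifteen pairings of six slots arises 48 = 2³ · 3! times. Instead of expanding 720
  -- permutations, the first slot is filled (`A`), then the second, with the partner of the first
  -- (`D`) or with another letter (`B`).
  set A : ι → ι → ι → ℝ := fun x y z =>
    symSum (fun j => T (Matrix.vecCons x j)) ![x, y, y, z, z] with hA
  set B : ι → ι → ι → ℝ := fun x y z =>
    symSum (fun j => T (Matrix.vecCons x (Matrix.vecCons y j))) ![x, y, z, z] with hB
  set D : ι → ι → ι → ℝ := fun x y z =>
    symSum (fun j => T (Matrix.vecCons x (Matrix.vecCons x j))) ![y, y, z, z] with hD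
  have swap12 : ∀ F : ι → ι → ι → ℝ, ∑ x, ∑ y, ∑ z, F y x z = ∑ x, ∑ y, ∑ z, F x y z :=
    fun F => Finset.sum_comm
  have swap23 : ∀ F : ι → ι → ι → ℝ, ∑ x, ∑ y, ∑ z, F x z y = ∑ x, ∑ y, ∑ z, F x y z :=
    fun F => Finset.sum_congr rfl fun x _ => Finset.sum_comm
  have rot : ∀ F : ι → ι → ι → ℝ, ∑ x, ∑ y, ∑ z, F z x y = ∑ x, ∑ y, ∑ z, F x y z :=
    fun F => (swap23 fun x y z => F y x z).trans (swap12 F)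
  have h1 : ∀ x y z, symSum T ![x, x, y, y, z, z] = 2 * A x y z + 2 * A y x z + 2 * A z x y := by
    intro x y z
    have e1 : symSum (fun j => T (Matrix.vecCons y j)) ![x, x, y, z, z] = A y x z :=
      symSum_eq_of_perm _ (Equiv.swap 0 2) (by intro k; fin_cases k <;> rfl)
    have e2 : symSum (fun j => T (Matrix.vecCons y j)) ![x, y, x, z, z] = A y x z :=
      symSum_eq_of_perm _ (Equiv.swap 0 1) (by intro k; fin_cases k <;> rfl)
    have e3 : symSum (fun j => T (Matrix.vecCons z j)) ![x, y, y, x, z] = A z x y :=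
      symSum_eq_of_perm _ (Equiv.swap 0 1 * Equiv.swap 1 3 * Equiv.swap 3 2 * Equiv.swap 2 4)
        (by intro k; fin_cases k <;> rfl)
    have e4 : symSum (fun j => T (Matrix.vecCons z j)) ![x, y, y, z, x] = A z x y :=
      symSum_eq_of_perm _ (Equiv.swap 0 1 * Equiv.swap 1 3 * Equiv.swap 2 4)
        (by intro k; fin_cases k <;> rfl)
    rw [symSum_six, e1, e2, e3, e4]
    ring
  have h2 : ∀ x y z, A x y z = D x y z + 2 * B x y z + 2 * B x z y := by
    intro x y z
    have e1 : symSum (fun j => T (Matrix.vecCons x (Matrix.vecCons y j))) ![y, x, z, z] =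
        B x y z :=
      symSum_eq_of_perm _ (Equiv.swap 0 1) (by intro k; fin_cases k <;> rfl)
    have e2 : symSum (fun j => T (Matrix.vecCons x (Matrix.vecCons z j))) ![y, y, x, z] =
        B x z y :=
      symSum_eq_of_perm _ (Equiv.swap 0 2 * Equiv.swap 1 3) (by intro k; fin_cases k <;> rfl)
    have e3 : symSum (fun j => T (Matrix.vecCons x (Matrix.vecCons z j))) ![y, y, z, x] =
        B x z y :=
      symSum_eq_of_perm _ (Equiv.swap 0 2 * Equiv.swap 1 3 * Equiv.swap 2 3)
        (by intro k; fin_cases k <;> rfl)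
    rw [hA]
    simp only
    rw [symSum_five, e1, e2, e3]
    ring
  have h3 : ∑ x, ∑ y, ∑ z, D x y z = 8 * (∑ x, ∑ y, ∑ z, T ![x, x, y, y, z, z]
      + ∑ x, ∑ y, ∑ z, T ![x, x, y, z, y, z] + ∑ x, ∑ y, ∑ z, T ![x, x, y, z, z, y]) := by
    simp only [hD, sum_symSum_four, ← Finset.mul_sum, Finset.sum_add_distrib]
  have h4 : ∀ x y z, B x y z = 2 * (
      (T ![x, y, x, y, z, z] + T ![x, y, x, z, y, z] + T ![x, y, x, z, z, y])
      + (T ![x, y, y, x, z, z] + T ![x, y, z, x, y, z] + T ![x, y, z, x, z, y])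
      + (T ![x, y, y, z, x, z] + T ![x, y, z, y, x, z] + T ![x, y, z, z, x, y])
      + (T ![x, y, y, z, z, x] + T ![x, y, z, y, z, x] + T ![x, y, z, z, y, x])) := by
    intro x y z
    simp only [hB, symSum_four, symSum_three, symSum_two]
    ring
  have h5 : ∑ x, ∑ y, ∑ z, A x y z =
      ∑ x, ∑ y, ∑ z, D x y z + 4 * ∑ x, ∑ y, ∑ z, B x y z := by
    simp only [h2, Finset.sum_add_distrib, ← Finset.mul_sum, swap23 B]
    ring
  simp only [h1, Finset.sum_add_distrib, ← Finset.mul_sum, swap12 A, rot A]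
  rw [h5, h3]
  simp only [h4, Finset.sum_add_distrib, ← Finset.mul_sum]
  ring

/-- Symmetrization does not change the associated homogeneous polynomial. -/
theorem sum_prod_mul_symSum {n : ℕ} (T : (Fin n → ι) → ℝ) (x : ι → ℝ) :
    ∑ i : Fin n → ι, (∏ k, x (i k)) * symSum T i =
      n.factorial * ∑ i : Fin n → ι, (∏ k, x (i k)) * T i := by
  unfold symSum
  simp only [Finset.mul_sum]
  rw [Finset.sum_comm]
  have h : ∀ σ : Equiv.Perm (Fin n), ∑ i : Fin n → ι, (∏ k, x (i k)) * T (i ∘ σ) =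
      ∑ i : Fin n → ι, (∏ k, x (i k)) * T i := by
    intro σ
    rw [← sum_comp_bijective σ σ.bijective fun i => (∏ k, x (i k)) * T i]
    refine Finset.sum_congr rfl fun i _ => ?_
    rw [← Equiv.prod_comp σ fun k => x (i k)]
    rfl
  simp only [h, Finset.sum_const, Finset.card_univ, Fintype.card_perm, Fintype.card_fin,
    nsmul_eq_mul, Finset.mul_sum]

end SymSum

end AsymptoticHarmonic
end

noncomputable section
namespace AsymptoticHarmonic

/-! ### Algebraic curvature tensors in an orthonormal basis -/

section Index

variable {ι : Type*}

/-- The symmetries of a curvature tensor. -/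
structure IsAlgCurv (R : ι → ι → ι → ι → ℝ) : Prop where
  skew_eq : ∀ a b c d, R a b c d = (-1) * R b a c d
  pair_eq : ∀ a b c d, R a b c d = R c d a b
  bianchi : ∀ a b c d, R a b c d + R b c a d + R c a b d = 0

/-- `|R|²`. -/
def sqIdx [Fintype ι] (R : ι → ι → ι → ι → ℝ) : ℝ := ∑ a, ∑ b, ∑ c, ∑ d, R a b c d ^ 2

/-- `R_{abcd} R_{abuv} R_{cduv}`. -/
def hatIdx [Fintype ι] (R : ι → ι → ι → ι → ℝ) : ℝ :=
  ∑ a, ∑ b, ∑ c, ∑ d, ∑ u, ∑ v, R a b c d * R a b u v * R c d u v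

/-- `R_{abcd} R_{aucv} R_{budv}`. -/
def ringIdx [Fintype ι] (R : ι → ι → ι → ι → ℝ) : ℝ :=
  ∑ a, ∑ b, ∑ c, ∑ d, ∑ u, ∑ v, R a b c d * R a u c v * R b u d v

/-- Rewrites each factor by one curvature symmetry. Signs are kept as factors `(-1)`, so that `ring`
can collect them into the sign of a reindexing lemma. -/
theorem mul3_eq {p q r p' q' r' : ℝ} (hp : p = p') (hq : q = q') (hr : r = r') :
    p * q * r = p' * q' * r' := by rw [hp, hq, hr]

namespace IsAlgCurv

variable {R : ι → ι → ι → ι → ℝ} (h : IsAlgCurv R)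
include h

theorem skew_right_eq (a b c d : ι) : R a b c d = (-1) * R a b d c := by
  rw [h.pair_eq, h.skew_eq, h.pair_eq]

theorem skew_skew_eq (a b c d : ι) : R a b c d = R b a d c := by
  rw [h.skew_eq, h.skew_right_eq]; ring

theorem pair_skew_eq (a b c d : ι) : R a b c d = (-1) * R d c a b := by
  rw [h.skew_right_eq, h.pair_eq]

theorem pair_skew_right_eq (a b c d : ι) : R a b c d = (-1) * R c d b a := by
  rw [h.skew_eq, h.pair_eq]

theorem reverse_eq (a b c d : ι) : R a b c d = R d c b a := by
  rw [h.skew_skew_eq, h.pair_eq]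

/-- The first Bianchi identity as a difference under exchange of the second and fourth slots; this
form produces the factors 1/2 and 1/4 below. -/
theorem bianchi_diff (a b c d : ι) : R a b c d - R a d c b = R a c b d := by
  have h1 := h.bianchi a b c d
  have h2 := h.pair_skew_eq b c a d
  have h3 := h.skew_eq c a b d
  have h4 := h.skew_skew_eq d a b c
  linarith [h.skew_right_eq a d b c]

variable [Fintype ι]

omit h in
theorem sum_sq : ∑ a, ∑ b, ∑ c, ∑ d, R a b c d * R a b c d = sqIdx R := by
  simp only [sqIdx, pow_two]

omit h in
theorem sum_hat : ∑ a, ∑ b, ∑ c, ∑ d, ∑ u, ∑ v, R a b c d * R a b u v * R c d u v = hatIdx R :=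
  rfl

omit h in
theorem sum_ring : ∑ a, ∑ b, ∑ c, ∑ d, ∑ u, ∑ v, R a b c d * R a u c v * R b u d v = ringIdx R :=
  rfl

/-- Let X be the sum of R_{abcd}R_{adcb}. Squaring `bianchi_diff` gives |R|² = 2|R|² − 2X, and
pairing it with R_{abcd} gives |R|² − X = |R|²/2. -/
theorem sum_sq_half : ∑ a, ∑ b, ∑ c, ∑ d, R a b c d * R a c b d = sqIdx R / 2 := by
  have h2 : ∑ a, ∑ b, ∑ c, ∑ d, R a d c b * R a d c b =
      1 * ∑ a, ∑ b, ∑ c, ∑ d, R a b c d * R a b c d :=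
    sum4_reindex 1 0 3 2 1 (by decide) fun X => (one_mul _).symm
  have h3 : ∑ a, ∑ b, ∑ c, ∑ d, R a c b d * R a c b d =
      1 * ∑ a, ∑ b, ∑ c, ∑ d, R a b c d * R a b c d :=
    sum4_reindex 1 0 2 1 3 (by decide) fun X => (one_mul _).symm
  have h5 : ∑ a, ∑ b, ∑ c, ∑ d, R a c b d * R a c b d =
      ∑ a, ∑ b, ∑ c, ∑ d, R a b c d * R a b c d - 2 * ∑ a, ∑ b, ∑ c, ∑ d, R a b c d * R a d c b
        + ∑ a, ∑ b, ∑ c, ∑ d, R a d c b * R a d c b := by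
    simp only [Finset.mul_sum, ← Finset.sum_add_distrib, ← Finset.sum_sub_distrib]
    refine Finset.sum_congr rfl fun a _ => Finset.sum_congr rfl fun b _ =>
      Finset.sum_congr rfl fun c _ => Finset.sum_congr rfl fun d _ => ?_
    rw [← h.bianchi_diff a b c d]; ring
  have h6 : ∑ a, ∑ b, ∑ c, ∑ d, R a b c d * R a c b d =
      ∑ a, ∑ b, ∑ c, ∑ d, R a b c d * R a b c d - ∑ a, ∑ b, ∑ c, ∑ d, R a b c d * R a d c b := by
    simp only [← Finset.sum_sub_distrib]
    refine Finset.sum_congr rfl fun a _ => Finset.sum_congr rfl fun b _ =>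
      Finset.sum_congr rfl fun c _ => Finset.sum_congr rfl fun d _ => ?_
    rw [← h.bianchi_diff a b c d]; ring
  rw [sum_sq (R := R)] at h2 h3 h5 h6
  linarith

/-- The middle factor is skew in `u, v`, so exchanging these letters in the last factor changes the
sign of the sum. By `bianchi_diff` the difference of the two sums is R̂. -/
theorem sum_hat_half :
    ∑ a, ∑ b, ∑ c, ∑ d, ∑ u, ∑ v, R a b c d * R a b u v * R c u d v = hatIdx R / 2 := by
  have h1 : ∑ a, ∑ b, ∑ c, ∑ d, ∑ u, ∑ v, R a b c d * R a b u v * R c u d v =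
      (-1) * ∑ a, ∑ b, ∑ c, ∑ d, ∑ u, ∑ v, R a b c d * R a b u v * R c v d u :=
    sum6_reindex (-1) 0 1 2 3 5 4 (by decide) fun X => by
      rw [h.skew_right_eq (X 0) (X 1) (X 4) (X 5)]; ring
  have h2 : ∑ a, ∑ b, ∑ c, ∑ d, ∑ u, ∑ v, R a b c d * R a b u v * R c u d v
      - ∑ a, ∑ b, ∑ c, ∑ d, ∑ u, ∑ v, R a b c d * R a b u v * R c v d u = hatIdx R := by
    unfold hatIdx
    simp only [← Finset.sum_sub_distrib]
    refine Finset.sum_congr rfl fun a _ => Finset.sum_congr rfl fun b _ =>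
      Finset.sum_congr rfl fun c _ => Finset.sum_congr rfl fun d _ =>
      Finset.sum_congr rfl fun u _ => Finset.sum_congr rfl fun v _ => ?_
    rw [← h.bianchi_diff c u d v]; ring
  linarith

/-- The same antisymmetrization for `a, b`, applied to the middle factor, halves the value once
more. -/
theorem sum_hat_quarter :
    ∑ a, ∑ b, ∑ c, ∑ d, ∑ u, ∑ v, R a b c d * R a u b v * R c u d v = hatIdx R / 4 := by
  have h1 : ∑ a, ∑ b, ∑ c, ∑ d, ∑ u, ∑ v, R a b c d * R a u b v * R c u d v =
      (-1) * ∑ a, ∑ b, ∑ c, ∑ d, ∑ u, ∑ v, R a b c d * R a v b u * R c u d v :=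
    sum6_reindex (-1) 1 0 2 3 4 5 (by decide) fun X => by
      rw [h.skew_eq (X 0) (X 1) (X 2) (X 3), h.pair_eq (X 0) (X 4) (X 1) (X 5)]; ring
  have h2 : ∑ a, ∑ b, ∑ c, ∑ d, ∑ u, ∑ v, R a b c d * R a u b v * R c u d v
      - ∑ a, ∑ b, ∑ c, ∑ d, ∑ u, ∑ v, R a b c d * R a v b u * R c u d v =
      ∑ a, ∑ b, ∑ c, ∑ d, ∑ u, ∑ v, R a b c d * R a b u v * R c u d v := by
    simp only [← Finset.sum_sub_distrib]
    refine Finset.sum_congr rfl fun a _ => Finset.sum_congr rfl fun b _ =>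
      Finset.sum_congr rfl fun c _ => Finset.sum_congr rfl fun d _ =>
      Finset.sum_congr rfl fun u _ => Finset.sum_congr rfl fun v _ => ?_
    rw [← h.bianchi_diff a u b v]; ring
  rw [h.sum_hat_half] at h2
  linarith

/-- Twisting the last factor of R̊ costs, by `bianchi_diff`, a sum that is `sum_hat_quarter` after
renaming. -/
theorem sum_ring_twist :
    ∑ a, ∑ b, ∑ c, ∑ d, ∑ u, ∑ v, R a b c d * R a u c v * R b v d u =
      ringIdx R - hatIdx R / 4 := by
  have h1 : ∑ a, ∑ b, ∑ c, ∑ d, ∑ u, ∑ v, R a b c d * R a u c v * R b d u v = hatIdx R / 4 := by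
    refine (sum6_reindex (G := fun a b c d u v => R a b c d * R a u b v * R c u d v)
      (1) 1 3 4 5 0 2 (by decide) fun X => (mul3_eq (h.skew_skew_eq (X 0) (X 1) (X 2) (X 3))
      (h.skew_skew_eq (X 0) (X 4) (X 2) (X 5)) ((rfl : R (X 1) (X 3) (X 4) (X 5) = R (X 1) (X 3) (X 4) (X 5)))).trans
      (by ring)).trans ?_
    rw [h.sum_hat_quarter]; ring
  have h2 : ringIdx R - ∑ a, ∑ b, ∑ c, ∑ d, ∑ u, ∑ v, R a b c d * R a u c v * R b v d u =
      ∑ a, ∑ b, ∑ c, ∑ d, ∑ u, ∑ v, R a b c d * R a u c v * R b d u v := by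
    unfold ringIdx
    simp only [← Finset.sum_sub_distrib]
    refine Finset.sum_congr rfl fun a _ => Finset.sum_congr rfl fun b _ =>
      Finset.sum_congr rfl fun c _ => Finset.sum_congr rfl fun d _ =>
      Finset.sum_congr rfl fun u _ => Finset.sum_congr rfl fun v _ => ?_
    rw [← h.bianchi_diff b u d v]; ring
  linarith


end IsAlgCurv
end Index
end AsymptoticHarmonic
end

/-! ### Full contractions of the conditions H₂ and H₃. -/

noncomputable section
namespace AsymptoticHarmonic

section Index

variable {ι : Type*} [Fintype ι]

/-- `R_{aijb} R_{bkla}`. -/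
def quadForm (R : ι → ι → ι → ι → ℝ) (i : Fin 4 → ι) : ℝ :=
  ∑ a, ∑ b, R a (i 0) (i 1) b * R b (i 2) (i 3) a

/-- `R_{aijb} R_{bklc} R_{cuva}`. -/
def cubicForm (R : ι → ι → ι → ι → ℝ) (i : Fin 6 → ι) : ℝ :=
  ∑ a, ∑ b, ∑ c, R a (i 0) (i 1) b * R b (i 2) (i 3) c * R c (i 4) (i 5) a

/-- `R_{aijb;k} R_{buva;l}`. -/
def gradForm (N : ι → ι → ι → ι → ι → ℝ) (i : Fin 6 → ι) : ℝ :=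
  ∑ a, ∑ b, N (i 2) a (i 0) (i 1) b * N (i 3) b (i 4) (i 5) a

section Einstein

variable [DecidableEq ι] {R : ι → ι → ι → ι → ℝ} {Λ : ℝ}

namespace IsAlgCurv

variable (h : IsAlgCurv R) (hric : ∀ i j, ∑ a, R a i j a = if i = j then Λ else 0)
include h hric

theorem sum_ric_mid (a b : ι) : ∑ x, R a x x b = if a = b then Λ else 0 := by
  have : ∀ x, R a x x b = R x b a x := fun x => h.pair_eq a x x b
  simp only [this, hric, eq_comm]

/-- The suffix records the pairing of the six slots, two per curvature factor. If the slots of one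
factor are paired together, that factor is a Ricci tensor and yields Λ; the other pairings are
multiples of R̂, with R̊ occurring once. -/
theorem sum_cubicForm_xxyyzz :
    ∑ x, ∑ y, ∑ z, cubicForm R ![x, x, y, y, z, z] = Fintype.card ι * Λ ^ 3 := by
  change ∑ x, ∑ y, ∑ z, ∑ a, ∑ b, ∑ c, R a x x b * R b y y c * R c z z a = _
  refine (sum6_reindex (G := fun a b c z y x => R c z z a * R b y y c * R a x x b)
    1 3 4 5 2 1 0 (by decide) fun X => (by ring)).trans ?_
  simp only [← Finset.mul_sum, ← Finset.sum_mul]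
  simp only [h.sum_ric_mid hric, ite_mul, mul_ite, mul_zero, zero_mul, Finset.sum_ite_eq, Finset.mem_univ, if_true, Finset.sum_const, Finset.card_univ,
    nsmul_eq_mul]
  ring

theorem sum_cubicForm_xxyzyz :
    ∑ x, ∑ y, ∑ z, cubicForm R ![x, x, y, z, y, z] = Λ * sqIdx R / 2 := by
  change ∑ x, ∑ y, ∑ z, ∑ a, ∑ b, ∑ c, R a x x b * R b y z c * R c y z a = _
  -- The repeated letter `x` is moved innermost, where its sum is a Ricci contraction that collapses
  -- the sum over `b`.
  refine (sum6_reindex (G := fun a y z c b x => R b y z c * R c y z a * R a x x b)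
    1 3 1 2 5 4 0 (by decide) fun X => (by ring)).trans ?_
  simp only [← Finset.mul_sum, h.sum_ric_mid hric, mul_ite, mul_zero, Finset.sum_ite_eq,
    Finset.mem_univ, if_true, ← Finset.sum_mul]
  have q : ∑ a, ∑ y, ∑ z, ∑ c, R a y z c * R c y z a =
      (1) * ∑ a, ∑ b, ∑ c, ∑ d, R a b c d * R a c b d :=
    sum4_reindex (1) 0 1 2 3 (by decide) fun X =>
      (congrArg₂ (· * ·) ((rfl : R (X 0) (X 1) (X 2) (X 3) = R (X 0) (X 1) (X 2) (X 3)))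
        (h.reverse_eq (X 3) (X 1) (X 2) (X 0))).trans (by ring)
  rw [h.sum_sq_half] at q
  rw [q]; ring

theorem sum_cubicForm_xxyzzy :
    ∑ x, ∑ y, ∑ z, cubicForm R ![x, x, y, z, z, y] = Λ * sqIdx R := by
  change ∑ x, ∑ y, ∑ z, ∑ a, ∑ b, ∑ c, R a x x b * R b y z c * R c z y a = _
  refine (sum6_reindex (G := fun a y z c b x => R b y z c * R c z y a * R a x x b)
    1 3 1 2 5 4 0 (by decide) fun X => (by ring)).trans ?_
  simp only [← Finset.mul_sum, h.sum_ric_mid hric, mul_ite, mul_zero, Finset.sum_ite_eq,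
    Finset.mem_univ, if_true, ← Finset.sum_mul]
  have q : ∑ a, ∑ y, ∑ z, ∑ c, R a y z c * R c z y a =
      (1) * ∑ a, ∑ b, ∑ c, ∑ d, R a b c d * R a b c d :=
    sum4_reindex (1) 0 1 2 3 (by decide) fun X =>
      (congrArg₂ (· * ·) ((rfl : R (X 0) (X 1) (X 2) (X 3) = R (X 0) (X 1) (X 2) (X 3)))
        (h.reverse_eq (X 3) (X 2) (X 1) (X 0))).trans (by ring)
  rw [sum_sq (R := R)] at q
  rw [q]; ring

theorem sum_cubicForm_xyxyzz :
    ∑ x, ∑ y, ∑ z, cubicForm R ![x, y, x, y, z, z] = Λ * sqIdx R / 2 := by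
  change ∑ x, ∑ y, ∑ z, ∑ a, ∑ b, ∑ c, R a x y b * R b x y c * R c z z a = _
  refine (sum6_reindex (G := fun c x y b a z => R a x y b * R b x y c * R c z z a)
    1 5 0 1 4 3 2 (by decide) fun X => (by ring)).trans ?_
  simp only [← Finset.mul_sum, h.sum_ric_mid hric, mul_ite, mul_zero, Finset.sum_ite_eq,
    Finset.mem_univ, if_true, ← Finset.sum_mul]
  have q : ∑ c, ∑ x, ∑ y, ∑ b, R c x y b * R b x y c =
      (1) * ∑ a, ∑ b, ∑ c, ∑ d, R a b c d * R a c b d :=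
    sum4_reindex (1) 0 1 2 3 (by decide) fun X =>
      (congrArg₂ (· * ·) ((rfl : R (X 0) (X 1) (X 2) (X 3) = R (X 0) (X 1) (X 2) (X 3)))
        (h.reverse_eq (X 3) (X 1) (X 2) (X 0))).trans (by ring)
  rw [h.sum_sq_half] at q
  rw [q]; ring

omit [DecidableEq ι] hric in
theorem sum_cubicForm_xyxzyz :
    ∑ x, ∑ y, ∑ z, cubicForm R ![x, y, x, z, y, z] = (-1) * (hatIdx R / 4) := by
  change ∑ x, ∑ y, ∑ z, ∑ a, ∑ b, ∑ c, R a x y b * R b x z c * R c y z a = _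
  refine (sum6_reindex (G := fun a b c d u v => R a b c d * R a u b v * R c u d v)
    (-1) 0 4 2 5 3 1 (by decide) fun X => (mul3_eq (h.skew_skew_eq (X 3) (X 0) (X 1) (X 4))
    (h.skew_eq (X 4) (X 0) (X 2) (X 5)) (h.pair_eq (X 5) (X 1) (X 2) (X 3))).trans
    (by ring)).trans ?_
  rw [h.sum_hat_quarter]

omit [DecidableEq ι] hric in
theorem sum_cubicForm_xyxzzy :
    ∑ x, ∑ y, ∑ z, cubicForm R ![x, y, x, z, z, y] = (-1) * (hatIdx R / 2) := by
  change ∑ x, ∑ y, ∑ z, ∑ a, ∑ b, ∑ c, R a x y b * R b x z c * R c z y a = _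
  refine (sum6_reindex (G := fun a b c d u v => R a b c d * R a b u v * R c u d v)
    (-1) 2 5 0 4 3 1 (by decide) fun X => (mul3_eq (h.skew_skew_eq (X 3) (X 0) (X 1) (X 4))
    (h.pair_skew_right_eq (X 4) (X 0) (X 2) (X 5)) (h.skew_skew_eq (X 5) (X 2) (X 1) (X 3))).trans
    (by ring)).trans ?_
  rw [h.sum_hat_half]

theorem sum_cubicForm_xyyxzz :
    ∑ x, ∑ y, ∑ z, cubicForm R ![x, y, y, x, z, z] = Λ * sqIdx R := by
  change ∑ x, ∑ y, ∑ z, ∑ a, ∑ b, ∑ c, R a x y b * R b y x c * R c z z a = _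
  refine (sum6_reindex (G := fun c x y b a z => R a x y b * R b y x c * R c z z a)
    1 5 0 1 4 3 2 (by decide) fun X => (by ring)).trans ?_
  simp only [← Finset.mul_sum, h.sum_ric_mid hric, mul_ite, mul_zero, Finset.sum_ite_eq,
    Finset.mem_univ, if_true, ← Finset.sum_mul]
  have q : ∑ c, ∑ x, ∑ y, ∑ b, R c x y b * R b y x c =
      (1) * ∑ a, ∑ b, ∑ c, ∑ d, R a b c d * R a b c d :=
    sum4_reindex (1) 0 1 2 3 (by decide) fun X =>
      (congrArg₂ (· * ·) ((rfl : R (X 0) (X 1) (X 2) (X 3) = R (X 0) (X 1) (X 2) (X 3)))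
        (h.reverse_eq (X 3) (X 2) (X 1) (X 0))).trans (by ring)
  rw [sum_sq (R := R)] at q
  rw [q]; ring

-- The only one of the fifteen pairings in which R̊ occurs.
omit [DecidableEq ι] hric in
theorem sum_cubicForm_xyzxyz :
    ∑ x, ∑ y, ∑ z, cubicForm R ![x, y, z, x, y, z] = (1) * (ringIdx R - hatIdx R / 4) := by
  change ∑ x, ∑ y, ∑ z, ∑ a, ∑ b, ∑ c, R a x y b * R b z x c * R c y z a = _
  refine (sum6_reindex (G := fun a b c d u v => R a b c d * R a u c v * R b v d u)
    (1) 0 3 4 1 5 2 (by decide) fun X => (mul3_eq (h.skew_skew_eq (X 3) (X 0) (X 1) (X 4))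
    (h.pair_eq (X 4) (X 2) (X 0) (X 5)) (h.reverse_eq (X 5) (X 1) (X 2) (X 3))).trans
    (by ring)).trans ?_
  rw [h.sum_ring_twist]

omit [DecidableEq ι] hric in
theorem sum_cubicForm_xyzxzy :
    ∑ x, ∑ y, ∑ z, cubicForm R ![x, y, z, x, z, y] = (-1) * (hatIdx R / 4) := by
  change ∑ x, ∑ y, ∑ z, ∑ a, ∑ b, ∑ c, R a x y b * R b z x c * R c z y a = _
  refine (sum6_reindex (G := fun a b c d u v => R a b c d * R a u b v * R c u d v)
    (-1) 3 1 5 2 0 4 (by decide) fun X => (mul3_eq ((rfl : R (X 3) (X 0) (X 1) (X 4) = R (X 3) (X 0) (X 1) (X 4)))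
    (h.reverse_eq (X 4) (X 2) (X 0) (X 5)) (h.pair_skew_eq (X 5) (X 2) (X 1) (X 3))).trans
    (by ring)).trans ?_
  rw [h.sum_hat_quarter]

omit [DecidableEq ι] hric in
theorem sum_cubicForm_xyyzxz :
    ∑ x, ∑ y, ∑ z, cubicForm R ![x, y, y, z, x, z] = (-1) * (hatIdx R / 2) := by
  change ∑ x, ∑ y, ∑ z, ∑ a, ∑ b, ∑ c, R a x y b * R b y z c * R c x z a = _
  refine (sum6_reindex (G := fun a b c d u v => R a b c d * R a b u v * R c u d v)
    (-1) 1 4 3 0 2 5 (by decide) fun X => (mul3_eq (h.pair_eq (X 3) (X 0) (X 1) (X 4))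
    (h.skew_eq (X 4) (X 1) (X 2) (X 5)) (h.reverse_eq (X 5) (X 0) (X 2) (X 3))).trans
    (by ring)).trans ?_
  rw [h.sum_hat_half]

omit [DecidableEq ι] hric in
theorem sum_cubicForm_xyzyxz :
    ∑ x, ∑ y, ∑ z, cubicForm R ![x, y, z, y, x, z] = (-1) * (hatIdx R / 4) := by
  change ∑ x, ∑ y, ∑ z, ∑ a, ∑ b, ∑ c, R a x y b * R b z y c * R c x z a = _
  refine (sum6_reindex (G := fun a b c d u v => R a b c d * R a u b v * R c u d v)
    (-1) 4 1 3 0 2 5 (by decide) fun X => (mul3_eq (h.pair_skew_eq (X 3) (X 0) (X 1) (X 4))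
    ((rfl : R (X 4) (X 2) (X 1) (X 5) = R (X 4) (X 2) (X 1) (X 5))) (h.reverse_eq (X 5) (X 0) (X 2) (X 3))).trans
    (by ring)).trans ?_
  rw [h.sum_hat_quarter]

theorem sum_cubicForm_xyzzxy :
    ∑ x, ∑ y, ∑ z, cubicForm R ![x, y, z, z, x, y] = Λ * sqIdx R / 2 := by
  change ∑ x, ∑ y, ∑ z, ∑ a, ∑ b, ∑ c, R a x y b * R b z z c * R c x y a = _
  refine (sum6_reindex (G := fun b x y a c z => R a x y b * R c x y a * R b z z c)
    1 4 0 1 3 5 2 (by decide) fun X => (by ring)).trans ?_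
  simp only [← Finset.mul_sum, h.sum_ric_mid hric, mul_ite, mul_zero, Finset.sum_ite_eq,
    Finset.mem_univ, if_true, ← Finset.sum_mul]
  have q : ∑ b, ∑ x, ∑ y, ∑ a, R a x y b * R b x y a =
      (1) * ∑ a, ∑ b, ∑ c, ∑ d, R a b c d * R a c b d :=
    sum4_reindex (1) 3 1 2 0 (by decide) fun X =>
      (congrArg₂ (· * ·) ((rfl : R (X 3) (X 1) (X 2) (X 0) = R (X 3) (X 1) (X 2) (X 0)))
        (h.reverse_eq (X 0) (X 1) (X 2) (X 3))).trans (by ring)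
  rw [h.sum_sq_half] at q
  rw [q]; ring

omit [DecidableEq ι] hric in
theorem sum_cubicForm_xyyzzx :
    ∑ x, ∑ y, ∑ z, cubicForm R ![x, y, y, z, z, x] = (-1) * hatIdx R := by
  change ∑ x, ∑ y, ∑ z, ∑ a, ∑ b, ∑ c, R a x y b * R b y z c * R c z x a = _
  refine (sum6_reindex (G := fun a b c d u v => R a b c d * R a b u v * R c d u v)
    (-1) 1 4 3 0 2 5 (by decide) fun X => (mul3_eq (h.pair_eq (X 3) (X 0) (X 1) (X 4))
    (h.skew_eq (X 4) (X 1) (X 2) (X 5)) (h.reverse_eq (X 5) (X 2) (X 0) (X 3))).trans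
    (by ring)).trans ?_
  rw [IsAlgCurv.sum_hat]

omit [DecidableEq ι] hric in
theorem sum_cubicForm_xyzyzx :
    ∑ x, ∑ y, ∑ z, cubicForm R ![x, y, z, y, z, x] = (-1) * (hatIdx R / 2) := by
  change ∑ x, ∑ y, ∑ z, ∑ a, ∑ b, ∑ c, R a x y b * R b z y c * R c z x a = _
  refine (sum6_reindex (G := fun a b c d u v => R a b c d * R a b u v * R c u d v)
    (-1) 3 0 1 4 5 2 (by decide) fun X => (mul3_eq ((rfl : R (X 3) (X 0) (X 1) (X 4) = R (X 3) (X 0) (X 1) (X 4)))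
    (h.pair_eq (X 4) (X 2) (X 1) (X 5)) (h.pair_skew_eq (X 5) (X 2) (X 0) (X 3))).trans
    (by ring)).trans ?_
  rw [h.sum_hat_half]

theorem sum_cubicForm_xyzzyx :
    ∑ x, ∑ y, ∑ z, cubicForm R ![x, y, z, z, y, x] = Λ * sqIdx R := by
  change ∑ x, ∑ y, ∑ z, ∑ a, ∑ b, ∑ c, R a x y b * R b z z c * R c y x a = _
  refine (sum6_reindex (G := fun b x y a c z => R a x y b * R c y x a * R b z z c)
    1 4 0 1 3 5 2 (by decide) fun X => (by ring)).trans ?_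
  simp only [← Finset.mul_sum, h.sum_ric_mid hric, mul_ite, mul_zero, Finset.sum_ite_eq,
    Finset.mem_univ, if_true, ← Finset.sum_mul]
  have q : ∑ b, ∑ x, ∑ y, ∑ a, R a x y b * R b y x a =
      (1) * ∑ a, ∑ b, ∑ c, ∑ d, R a b c d * R a b c d :=
    sum4_reindex (1) 3 1 2 0 (by decide) fun X =>
      (congrArg₂ (· * ·) ((rfl : R (X 3) (X 1) (X 2) (X 0) = R (X 3) (X 1) (X 2) (X 0)))
        (h.reverse_eq (X 0) (X 2) (X 1) (X 3))).trans (by ring)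
  rw [sum_sq (R := R)] at q
  rw [q]; ring

/-- The full contraction of the cubic part of the third condition. -/
theorem sum_symSum_cubicForm :
    ∑ x, ∑ y, ∑ z, symSum (cubicForm R) ![x, x, y, y, z, z] =
      48 * (Fintype.card ι * Λ ^ 3 + 9 / 2 * Λ * sqIdx R - 7 / 2 * hatIdx R + ringIdx R) := by
  -- Six pairings have exactly one Ricci factor and give 3(1 + 1/2)Λ|R|². The eight without Ricci
  -- factor give R̊ and −(1 + 3/2 + 4/4)R̂.
  rw [sum_symSum_six, h.sum_cubicForm_xxyyzz hric,
    h.sum_cubicForm_xxyzyz hric,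
    h.sum_cubicForm_xxyzzy hric,
    h.sum_cubicForm_xyxyzz hric,
    h.sum_cubicForm_xyxzyz,
    h.sum_cubicForm_xyxzzy,
    h.sum_cubicForm_xyyxzz hric,
    h.sum_cubicForm_xyzxyz,
    h.sum_cubicForm_xyzxzy,
    h.sum_cubicForm_xyyzxz,
    h.sum_cubicForm_xyzyxz,
    h.sum_cubicForm_xyzzxy hric,
    h.sum_cubicForm_xyyzzx,
    h.sum_cubicForm_xyzyzx,
    h.sum_cubicForm_xyzzyx hric]
  ring

/-- The full contraction of the second condition. -/
theorem sum_symSum_quadForm :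
    ∑ x, ∑ y, symSum (quadForm R) ![x, x, y, y] =
      8 * (Fintype.card ι * Λ ^ 2 + 3 / 2 * sqIdx R) := by
  have e1 : ∑ x, ∑ y, quadForm R ![x, x, y, y] = Fintype.card ι * Λ ^ 2 := by
    change ∑ x, ∑ y, ∑ a, ∑ b, R a x x b * R b y y a = _
    refine (sum4_reindex (G := fun a b y x => R b y y a * R a x x b)
      1 2 3 1 0 (by decide) fun X => (by ring)).trans ?_
    simp only [← Finset.mul_sum, ← Finset.sum_mul]
    simp only [h.sum_ric_mid hric, ite_mul, mul_ite, mul_zero, zero_mul, Finset.sum_ite_eq, Finset.mem_univ, if_true, Finset.sum_const, Finset.card_univ,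
      nsmul_eq_mul]
    ring
  have e2 : ∑ x, ∑ y, quadForm R ![x, y, x, y] = sqIdx R / 2 := by
    change ∑ x, ∑ y, ∑ a, ∑ b, R a x y b * R b x y a = _
    have q : ∑ x, ∑ y, ∑ a, ∑ b, R a x y b * R b x y a =
        (1) * ∑ a, ∑ b, ∑ c, ∑ d, R a b c d * R a c b d :=
      sum4_reindex (1) 2 0 1 3 (by decide) fun X =>
        (congrArg₂ (· * ·) ((rfl : R (X 2) (X 0) (X 1) (X 3) = R (X 2) (X 0) (X 1) (X 3)))
          (h.reverse_eq (X 3) (X 0) (X 1) (X 2))).trans (by ring)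
    rw [h.sum_sq_half] at q
    rw [q]; ring
  have e3 : ∑ x, ∑ y, quadForm R ![x, y, y, x] = sqIdx R := by
    change ∑ x, ∑ y, ∑ a, ∑ b, R a x y b * R b y x a = _
    have q : ∑ x, ∑ y, ∑ a, ∑ b, R a x y b * R b y x a =
        (1) * ∑ a, ∑ b, ∑ c, ∑ d, R a b c d * R a b c d :=
      sum4_reindex (1) 2 0 1 3 (by decide) fun X =>
        (congrArg₂ (· * ·) ((rfl : R (X 2) (X 0) (X 1) (X 3) = R (X 2) (X 0) (X 1) (X 3)))
          (h.reverse_eq (X 3) (X 1) (X 0) (X 2))).trans (by ring)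
    rw [sum_sq (R := R)] at q
    rw [q]; ring
  rw [sum_symSum_four, e1, e2, e3]
  ring

end IsAlgCurv

end Einstein

/-! ### Contractions of products of two covariant derivatives of the curvature. -/

section Gradient

variable {N : ι → ι → ι → ι → ι → ℝ}

/-- `|∇R|²`. -/
def gradSq (N : ι → ι → ι → ι → ι → ℝ) : ℝ := ∑ k, sqIdx (N k)

theorem sum_grad_sq : ∑ k, ∑ a, ∑ b, ∑ c, ∑ d, N k a b c d * N k a b c d = gradSq N := by
  simp only [gradSq, sqIdx, pow_two]

variable (hN : ∀ k, IsAlgCurv (N k))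
include hN

theorem sum_grad_half :
    ∑ k, ∑ a, ∑ b, ∑ c, ∑ d, N k a b c d * N k a c b d = gradSq N / 2 := by
  rw [gradSq, Finset.sum_div]
  exact Finset.sum_congr rfl fun k _ => (hN k).sum_sq_half

variable (hB : ∀ x a b c d, N x a b c d + N a b x c d + N b x a c d = 0)
include hB

/-- The second Bianchi identity writes ∇_b R_{ui} as the difference of ∇_i R_{ub} and ∇_u R_{ib}.
Squaring and summing gives |∇R|² = 2|∇R|² − 2X for the cross term X. -/
theorem sum_grad_cross :
    ∑ u, ∑ i, ∑ b, ∑ c, ∑ d, N u i b c d * N i u b c d = gradSq N / 2 := by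
  have h1 : ∑ u, ∑ i, ∑ b, ∑ c, ∑ d, N i u b c d * N i u b c d =
      1 * ∑ k, ∑ a, ∑ b, ∑ c, ∑ d, N k a b c d * N k a b c d :=
    sum5_reindex 1 1 0 2 3 4 (by decide) fun X => (one_mul _).symm
  have h2 : ∑ u, ∑ i, ∑ b, ∑ c, ∑ d, N b u i c d * N b u i c d =
      1 * ∑ k, ∑ a, ∑ b, ∑ c, ∑ d, N k a b c d * N k a b c d :=
    sum5_reindex 1 2 0 1 3 4 (by decide) fun X => (one_mul _).symm
  have h3 : ∑ u, ∑ i, ∑ b, ∑ c, ∑ d, N b u i c d * N b u i c d =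
      ∑ u, ∑ i, ∑ b, ∑ c, ∑ d, N u i b c d * N u i b c d
        - 2 * ∑ u, ∑ i, ∑ b, ∑ c, ∑ d, N u i b c d * N i u b c d
        + ∑ u, ∑ i, ∑ b, ∑ c, ∑ d, N i u b c d * N i u b c d := by
    simp only [Finset.mul_sum, ← Finset.sum_add_distrib, ← Finset.sum_sub_distrib]
    refine Finset.sum_congr rfl fun u _ => Finset.sum_congr rfl fun i _ =>
      Finset.sum_congr rfl fun b _ => Finset.sum_congr rfl fun c _ =>
      Finset.sum_congr rfl fun d _ => ?_
    have e : N b u i c d = N i u b c d - N u i b c d := by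
      linarith [hB u i b c d, (hN i).skew_eq u b c d]
    rw [e]; ring
  rw [sum_grad_sq (N := N)] at h1 h2 h3
  linarith

/-- Skew symmetry in `c, d` and the first Bianchi identity show that this is half of
`sum_grad_cross`. -/
theorem sum_grad_twist :
    ∑ u, ∑ i, ∑ b, ∑ c, ∑ d, N u i b c d * N i u c b d = gradSq N / 4 := by
  have h1 : ∑ u, ∑ i, ∑ b, ∑ c, ∑ d, N u i b c d * N i u c b d =
      (-1) * ∑ u, ∑ i, ∑ b, ∑ c, ∑ d, N u i b c d * N i u d b c :=
    sum5_reindex (-1) 0 1 2 4 3 (by decide) fun X => by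
      rw [(hN (X 0)).skew_right_eq (X 1) (X 2) (X 3) (X 4)]; ring
  have h2 : ∑ u, ∑ i, ∑ b, ∑ c, ∑ d, N u i b c d * N i u b c d =
      ∑ u, ∑ i, ∑ b, ∑ c, ∑ d, N u i b c d * N i u c b d
        - ∑ u, ∑ i, ∑ b, ∑ c, ∑ d, N u i b c d * N i u d b c := by
    simp only [← Finset.sum_sub_distrib]
    refine Finset.sum_congr rfl fun u _ => Finset.sum_congr rfl fun i _ =>
      Finset.sum_congr rfl fun b _ => Finset.sum_congr rfl fun c _ =>
      Finset.sum_congr rfl fun d _ => ?_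
    have e : N i u b c d = N i u c b d - N i u d b c := by
      linarith [(hN i).bianchi u b c d, (hN i).pair_eq b c u d, (hN i).skew_eq c u b d]
    rw [e]; ring
  rw [sum_grad_cross hN hB] at h2
  linarith

section Contracted

variable [DecidableEq ι] (hric : ∀ k i j, ∑ a, N k a i j a = 0)
  (hdiv : ∀ b c d, ∑ i, N i i b c d = 0)

omit [DecidableEq ι] hB in
include hric in
theorem sum_grad_ric (k a b : ι) : ∑ x, N k a x x b = 0 := by
  rw [← hric k b a]
  exact Finset.sum_congr rfl fun x _ => (hN k).pair_eq a x x b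

omit [DecidableEq ι] hB in
include hdiv in
theorem sum_grad_div₂ (a j b : ι) : ∑ x, N x a x j b = 0 := by
  rw [Finset.sum_congr rfl fun x _ => (hN x).skew_eq a x j b, ← Finset.mul_sum, hdiv, mul_zero]

omit [DecidableEq ι] hB in
include hdiv in
theorem sum_grad_div₃ (a j b : ι) : ∑ x, N x a j x b = 0 := by
  rw [← hdiv b a j]
  exact Finset.sum_congr rfl fun x _ => (hN x).pair_eq a j x b

-- Slots 0, 1, 2 belong to the first factor and slots 3, 4, 5 to the second, the derivatives being
-- slots 2 and 3. A pair inside one triple produces a Ricci gradient or a divergence, so nine of the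
-- fifteen pairings vanish; the six matchings between the triples add up to 3|∇R|².
omit [DecidableEq ι] hB in
include hric in
theorem sum_gradForm_xxyyzz : ∑ x, ∑ y, ∑ z, gradForm N ![x, x, y, y, z, z] = 0 := by
  change ∑ x, ∑ y, ∑ z, ∑ a, ∑ b, N y a x x b * N y b z z a = _
  refine (sum5_reindex (G := fun y z a b x => N y b z z a * N y a x x b)
    1 1 2 3 4 0 (by decide) fun X => (by ring)).trans ?_
  simp only [← Finset.mul_sum, sum_grad_ric hN hric, mul_zero, Finset.sum_const_zero]

omit [DecidableEq ι] hB in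
include hric in
theorem sum_gradForm_xxyzyz : ∑ x, ∑ y, ∑ z, gradForm N ![x, x, y, z, y, z] = 0 := by
  change ∑ x, ∑ y, ∑ z, ∑ a, ∑ b, N y a x x b * N z b y z a = _
  refine (sum5_reindex (G := fun y z a b x => N z b y z a * N y a x x b)
    1 1 2 3 4 0 (by decide) fun X => (by ring)).trans ?_
  simp only [← Finset.mul_sum, sum_grad_ric hN hric, mul_zero, Finset.sum_const_zero]

omit [DecidableEq ι] hB in
include hric in
theorem sum_gradForm_xxyzzy : ∑ x, ∑ y, ∑ z, gradForm N ![x, x, y, z, z, y] = 0 := by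
  change ∑ x, ∑ y, ∑ z, ∑ a, ∑ b, N y a x x b * N z b z y a = _
  refine (sum5_reindex (G := fun y z a b x => N z b z y a * N y a x x b)
    1 1 2 3 4 0 (by decide) fun X => (by ring)).trans ?_
  simp only [← Finset.mul_sum, sum_grad_ric hN hric, mul_zero, Finset.sum_const_zero]

omit [DecidableEq ι] hB in
include hdiv in
theorem sum_gradForm_xyxyzz : ∑ x, ∑ y, ∑ z, gradForm N ![x, y, x, y, z, z] = 0 := by
  change ∑ x, ∑ y, ∑ z, ∑ a, ∑ b, N x a x y b * N y b z z a = _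
  refine (sum5_reindex (G := fun y z a b x => N y b z z a * N x a x y b)
    1 1 2 3 4 0 (by decide) fun X => (by ring)).trans ?_
  simp only [← Finset.mul_sum, sum_grad_div₂ hN hdiv, mul_zero, Finset.sum_const_zero]

omit [DecidableEq ι] hB in
include hdiv in
theorem sum_gradForm_xyxzyz : ∑ x, ∑ y, ∑ z, gradForm N ![x, y, x, z, y, z] = 0 := by
  change ∑ x, ∑ y, ∑ z, ∑ a, ∑ b, N x a x y b * N z b y z a = _
  refine (sum5_reindex (G := fun y z a b x => N z b y z a * N x a x y b)
    1 1 2 3 4 0 (by decide) fun X => (by ring)).trans ?_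
  simp only [← Finset.mul_sum, sum_grad_div₂ hN hdiv, mul_zero, Finset.sum_const_zero]

omit [DecidableEq ι] hB in
include hdiv in
theorem sum_gradForm_xyxzzy : ∑ x, ∑ y, ∑ z, gradForm N ![x, y, x, z, z, y] = 0 := by
  change ∑ x, ∑ y, ∑ z, ∑ a, ∑ b, N x a x y b * N z b z y a = _
  refine (sum5_reindex (G := fun y z a b x => N z b z y a * N x a x y b)
    1 1 2 3 4 0 (by decide) fun X => (by ring)).trans ?_
  simp only [← Finset.mul_sum, sum_grad_div₂ hN hdiv, mul_zero, Finset.sum_const_zero]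

omit [DecidableEq ι] hB in
include hdiv in
theorem sum_gradForm_xyyxzz : ∑ x, ∑ y, ∑ z, gradForm N ![x, y, y, x, z, z] = 0 := by
  change ∑ x, ∑ y, ∑ z, ∑ a, ∑ b, N y a x y b * N x b z z a = _
  refine (sum5_reindex (G := fun x z a b y => N x b z z a * N y a x y b)
    1 0 2 3 4 1 (by decide) fun X => (by ring)).trans ?_
  simp only [← Finset.mul_sum, sum_grad_div₃ hN hdiv, mul_zero, Finset.sum_const_zero]

omit [DecidableEq ι] in
theorem sum_gradForm_xyzxyz :
    ∑ x, ∑ y, ∑ z, gradForm N ![x, y, z, x, y, z] = (1) * (gradSq N / 2) := by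
  change ∑ x, ∑ y, ∑ z, ∑ a, ∑ b, N z a x y b * N x b y z a = _
  refine (sum5_reindex (G := fun u i b c d => N u i b c d * N i u b c d)
    (1) 2 0 3 1 4 (by decide) fun X => (congrArg₂ (· * ·)
    ((hN (X 2)).skew_eq (X 3) (X 0) (X 1) (X 4))
    ((hN (X 0)).pair_skew_right_eq (X 4) (X 1) (X 2) (X 3))).trans (by ring)).trans ?_
  rw [sum_grad_cross hN hB]

omit [DecidableEq ι] in
theorem sum_gradForm_xyzxzy :
    ∑ x, ∑ y, ∑ z, gradForm N ![x, y, z, x, z, y] = (1) * (gradSq N / 4) := by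
  change ∑ x, ∑ y, ∑ z, ∑ a, ∑ b, N z a x y b * N x b z y a = _
  refine (sum5_reindex (G := fun u i b c d => N u i b c d * N i u c b d)
    (1) 2 0 3 4 1 (by decide) fun X => (congrArg₂ (· * ·)
    ((hN (X 2)).skew_skew_eq (X 3) (X 0) (X 1) (X 4))
    ((hN (X 0)).skew_skew_eq (X 4) (X 2) (X 1) (X 3))).trans (by ring)).trans ?_
  rw [sum_grad_twist hN hB]

omit [DecidableEq ι] hB in
include hdiv in
theorem sum_gradForm_xyyzxz : ∑ x, ∑ y, ∑ z, gradForm N ![x, y, y, z, x, z] = 0 := by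
  change ∑ x, ∑ y, ∑ z, ∑ a, ∑ b, N y a x y b * N z b x z a = _
  refine (sum5_reindex (G := fun x z a b y => N z b x z a * N y a x y b)
    1 0 2 3 4 1 (by decide) fun X => (by ring)).trans ?_
  simp only [← Finset.mul_sum, sum_grad_div₃ hN hdiv, mul_zero, Finset.sum_const_zero]

omit [DecidableEq ι] in
theorem sum_gradForm_xyzyxz :
    ∑ x, ∑ y, ∑ z, gradForm N ![x, y, z, y, x, z] = (1) * (gradSq N / 4) := by
  change ∑ x, ∑ y, ∑ z, ∑ a, ∑ b, N z a x y b * N y b x z a = _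
  refine (sum5_reindex (G := fun u i b c d => N u i b c d * N i u c b d)
    (1) 2 1 4 3 0 (by decide) fun X => (congrArg₂ (· * ·)
    ((hN (X 2)).pair_eq (X 3) (X 0) (X 1) (X 4))
    ((hN (X 1)).pair_eq (X 4) (X 0) (X 2) (X 3))).trans (by ring)).trans ?_
  rw [sum_grad_twist hN hB]

omit [DecidableEq ι] hB in
theorem sum_gradForm_xyzzxy :
    ∑ x, ∑ y, ∑ z, gradForm N ![x, y, z, z, x, y] = (1) * (gradSq N / 2) := by
  change ∑ x, ∑ y, ∑ z, ∑ a, ∑ b, N z a x y b * N z b x y a = _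
  refine (sum5_reindex (G := fun k a b c d => N k a b c d * N k a c b d)
    (1) 2 3 0 1 4 (by decide) fun X => (congrArg₂ (· * ·)
    ((rfl : N (X 2) (X 3) (X 0) (X 1) (X 4) = N (X 2) (X 3) (X 0) (X 1) (X 4)))
    ((hN (X 2)).reverse_eq (X 4) (X 0) (X 1) (X 3))).trans (by ring)).trans ?_
  rw [sum_grad_half hN]

omit [DecidableEq ι] hB in
include hdiv in
theorem sum_gradForm_xyyzzx : ∑ x, ∑ y, ∑ z, gradForm N ![x, y, y, z, z, x] = 0 := by
  change ∑ x, ∑ y, ∑ z, ∑ a, ∑ b, N y a x y b * N z b z x a = _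
  refine (sum5_reindex (G := fun x z a b y => N z b z x a * N y a x y b)
    1 0 2 3 4 1 (by decide) fun X => (by ring)).trans ?_
  simp only [← Finset.mul_sum, sum_grad_div₃ hN hdiv, mul_zero, Finset.sum_const_zero]

omit [DecidableEq ι] in
theorem sum_gradForm_xyzyzx :
    ∑ x, ∑ y, ∑ z, gradForm N ![x, y, z, y, z, x] = (1) * (gradSq N / 2) := by
  change ∑ x, ∑ y, ∑ z, ∑ a, ∑ b, N z a x y b * N y b z x a = _
  refine (sum5_reindex (G := fun u i b c d => N u i b c d * N i u b c d)
    (1) 2 1 4 3 0 (by decide) fun X => (congrArg₂ (· * ·)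
    ((hN (X 2)).pair_eq (X 3) (X 0) (X 1) (X 4))
    ((hN (X 1)).skew_skew_eq (X 4) (X 2) (X 0) (X 3))).trans (by ring)).trans ?_
  rw [sum_grad_cross hN hB]

omit [DecidableEq ι] hB in
theorem sum_gradForm_xyzzyx :
    ∑ x, ∑ y, ∑ z, gradForm N ![x, y, z, z, y, x] = (1) * gradSq N := by
  change ∑ x, ∑ y, ∑ z, ∑ a, ∑ b, N z a x y b * N z b y x a = _
  refine (sum5_reindex (G := fun k a b c d => N k a b c d * N k a b c d)
    (1) 2 3 0 1 4 (by decide) fun X => (congrArg₂ (· * ·)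
    ((rfl : N (X 2) (X 3) (X 0) (X 1) (X 4) = N (X 2) (X 3) (X 0) (X 1) (X 4)))
    ((hN (X 2)).reverse_eq (X 4) (X 1) (X 0) (X 3))).trans (by ring)).trans ?_
  rw [sum_grad_sq]

omit [DecidableEq ι] in
include hric hdiv in
/-- The full contraction of the gradient part of the third condition. -/
theorem sum_symSum_gradForm :
    ∑ x, ∑ y, ∑ z, symSum (gradForm N) ![x, x, y, y, z, z] = 48 * (3 * gradSq N) := by
  rw [sum_symSum_six, sum_gradForm_xxyyzz hN hric,
    sum_gradForm_xxyzyz hN hric,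
    sum_gradForm_xxyzzy hN hric,
    sum_gradForm_xyxyzz hN hdiv,
    sum_gradForm_xyxzyz hN hdiv,
    sum_gradForm_xyxzzy hN hdiv,
    sum_gradForm_xyyxzz hN hdiv,
    sum_gradForm_xyzxyz hN hB,
    sum_gradForm_xyzxzy hN hB,
    sum_gradForm_xyyzxz hN hdiv,
    sum_gradForm_xyzyxz hN hB,
    sum_gradForm_xyzzxy hN,
    sum_gradForm_xyyzzx hN hdiv,
    sum_gradForm_xyzyzx hN hB,
    sum_gradForm_xyzzyx hN]
  ring

end Contracted

end Gradient

/-- The Laplacian of the curvature tensor of an Einstein metric, contracted with the curvature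
tensor. -/
theorem IsAlgCurv.sum_laplacian [DecidableEq ι] {R : ι → ι → ι → ι → ℝ} {Λ : ℝ}
    (h : IsAlgCurv R) (hric : ∀ i j, ∑ a, R a i j a = if i = j then Λ else 0)
    {S : ι → ι → ι → ι → ι → ι → ℝ}
    (hS : ∀ x e a b c d, S x e a b c d + S x a b e c d + S x b e a c d = 0)
    (hskew : ∀ x e a b c d, S x e a b c d = -S x e b a c d)
    (hdiv : ∀ x b c d, ∑ i, S x i i b c d = 0)
    (hcomm : ∀ x y a b c d, S x y a b c d - S y x a b c d =
      -∑ k, (R x y a k * R k b c d + R x y b k * R a k c d + R x y c k * R a b k d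
        + R x y d k * R a b c k)) :
    ∑ x, ∑ a, ∑ b, ∑ c, ∑ d, R a b c d * S x x a b c d =
      2 * Λ * sqIdx R + hatIdx R + 4 * ringIdx R := by
  -- The differentiated second Bianchi identity replaces ∇²_{xx}R_{abcd} by ∇²_{xa}R_{xbcd} −
  -- ∇²_{xb}R_{xacd}; since R is skew in `a, b`, both parts contribute equally.
  have e1 : ∑ x, ∑ a, ∑ b, ∑ c, ∑ d, R a b c d * S x x a b c d =
      ∑ x, ∑ a, ∑ b, ∑ c, ∑ d, R a b c d * S x a x b c d
        - ∑ x, ∑ a, ∑ b, ∑ c, ∑ d, R a b c d * S x b x a c d := by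
    simp only [← Finset.sum_sub_distrib]
    refine Finset.sum_congr rfl fun x _ => Finset.sum_congr rfl fun a _ =>
      Finset.sum_congr rfl fun b _ => Finset.sum_congr rfl fun c _ =>
      Finset.sum_congr rfl fun d _ => ?_
    linear_combination R a b c d * hS x x a b c d - R a b c d * hskew x a b x c d
  have e2 : ∑ x, ∑ a, ∑ b, ∑ c, ∑ d, R a b c d * S x b x a c d =
      (-1) * ∑ x, ∑ a, ∑ b, ∑ c, ∑ d, R a b c d * S x a x b c d :=
    sum5_reindex (-1) 0 2 1 3 4 (by decide) fun X => by
      rw [h.skew_eq (X 1) (X 2) (X 3) (X 4)]; ring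
  -- With the derivatives in this order the inner one is a divergence.
  have e3 : ∑ x, ∑ a, ∑ b, ∑ c, ∑ d, R a b c d * S a x x b c d = 0 := by
    refine (sum5_reindex (G := fun a b c d x => R a b c d * S a x x b c d)
      1 1 2 3 4 0 (by decide) fun X => (one_mul _).symm).trans ?_
    simp only [← Finset.mul_sum, hdiv, mul_zero, Finset.sum_const_zero]
  -- Exchanging the derivatives by the Ricci identity leaves one curvature term per slot: a Ricci
  -- term, one multiple of R̂ and two of R̊.
  have e4 : ∑ x, ∑ a, ∑ b, ∑ c, ∑ d, R a b c d * S x a x b c d =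
      ∑ x, ∑ a, ∑ b, ∑ c, ∑ d, R a b c d * S a x x b c d
      - (∑ x, ∑ a, ∑ b, ∑ c, ∑ d, ∑ k, R a b c d * R x a x k * R k b c d
        + ∑ x, ∑ a, ∑ b, ∑ c, ∑ d, ∑ k, R a b c d * R x a b k * R x k c d
        + ∑ x, ∑ a, ∑ b, ∑ c, ∑ d, ∑ k, R a b c d * R x a c k * R x b k d
        + ∑ x, ∑ a, ∑ b, ∑ c, ∑ d, ∑ k, R a b c d * R x a d k * R x b c k) := by
    simp only [← Finset.sum_sub_distrib, ← Finset.sum_add_distrib]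
    refine Finset.sum_congr rfl fun x _ => Finset.sum_congr rfl fun a _ =>
      Finset.sum_congr rfl fun b _ => Finset.sum_congr rfl fun c _ =>
      Finset.sum_congr rfl fun d _ => ?_
    rw [eq_add_of_sub_eq (hcomm x a x b c d), mul_add, mul_neg, Finset.mul_sum, add_comm,
      sub_eq_add_neg]
    congr 2
    exact Finset.sum_congr rfl fun k _ => by ring
  have t1 : ∑ x, ∑ a, ∑ b, ∑ c, ∑ d, ∑ k, R a b c d * R x a x k * R k b c d =
      -(Λ * sqIdx R) := by
    refine (sum6_reindex (G := fun a b c d k x => R a b c d * R k b c d * R x a k x)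
      (-1) 1 2 3 4 5 0 (by decide) fun X => ?_).trans ?_
    · rw [h.skew_right_eq (X 0) (X 1) (X 0) (X 5)]; ring
    · simp only [← Finset.mul_sum, hric, mul_ite, mul_zero, Finset.sum_ite_eq,
        Finset.mem_univ, if_true, ← Finset.sum_mul]
      rw [IsAlgCurv.sum_sq]; ring
  have t2 : ∑ x, ∑ a, ∑ b, ∑ c, ∑ d, ∑ k, R a b c d * R x a b k * R x k c d =
      (-1) * (hatIdx R / 2) := by
    refine (sum6_reindex (G := fun a b c d u v => R a b c d * R a b u v * R c u d v)
      (-1) 3 4 1 2 0 5 (by decide) fun X => (mul3_eq (h.pair_eq (X 1) (X 2) (X 3) (X 4))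
      (h.skew_eq (X 0) (X 1) (X 2) (X 5)) (h.pair_eq (X 0) (X 5) (X 3) (X 4))).trans
      (by ring)).trans ?_
    rw [h.sum_hat_half]
  have t3 : ∑ x, ∑ a, ∑ b, ∑ c, ∑ d, ∑ k, R a b c d * R x a c k * R x b k d =
      (-1) * ringIdx R := by
    refine (sum6_reindex (G := fun a b c d u v => R a b c d * R a u c v * R b u d v)
      (-1) 1 2 3 4 0 5 (by decide) fun X => (mul3_eq ((rfl : R (X 1) (X 2) (X 3) (X 4) = R (X 1) (X 2) (X 3) (X 4)))
      (h.skew_eq (X 0) (X 1) (X 3) (X 5)) (h.skew_skew_eq (X 0) (X 2) (X 5) (X 4))).trans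
      (by ring)).trans ?_
    rw [IsAlgCurv.sum_ring]
  have t4 : ∑ x, ∑ a, ∑ b, ∑ c, ∑ d, ∑ k, R a b c d * R x a d k * R x b c k =
      (-1) * ringIdx R := by
    refine (sum6_reindex (G := fun a b c d u v => R a b c d * R a u c v * R b u d v)
      (-1) 1 2 4 3 0 5 (by decide) fun X => (mul3_eq (h.skew_right_eq (X 1) (X 2) (X 3) (X 4))
      (h.skew_eq (X 0) (X 1) (X 4) (X 5)) (h.skew_eq (X 0) (X 2) (X 3) (X 5))).trans
      (by ring)).trans ?_
    rw [IsAlgCurv.sum_ring]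
  rw [e1, e2, e4, e3, t1, t2, t3, t4]
  ring

end Index

end AsymptoticHarmonic
end

/-! ### The quartic polynomial of H₂. -/

noncomputable section
namespace AsymptoticHarmonic

section Polynomial

variable {ι : Type*} [Fintype ι] [DecidableEq ι]

/-- The polynomial identity encoded by the second condition. -/
theorem quadForm_polynomial {R : ι → ι → ι → ι → ℝ} {Λ : ℝ}
    (hq : ∀ i, symSum (quadForm R) i = Λ * symSum (fun i : Fin 4 → ι =>
      (if i 0 = i 1 then 1 else 0) * (if i 2 = i 3 then 1 else 0)) i) (c : ι → ℝ) :
    ∑ a, ∑ b, (∑ i, ∑ j, c i * c j * R a i j b) * (∑ k, ∑ l, c k * c l * R b k l a) =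
      Λ * (∑ i, c i ^ 2) ^ 2 := by
  have expand : ∀ F : (Fin 4 → ι) → ℝ, ∑ i : Fin 4 → ι, (∏ k, c (i k)) * F i =
      ∑ i, ∑ j, ∑ k, ∑ l, c i * c j * c k * c l * F ![i, j, k, l] := fun F => by
    simp only [sum_fin_succ_fun, sum_fin_zero_fun, Fin.prod_univ_four]
    rfl
  have h1 := sum_prod_mul_symSum (quadForm R) c
  have h2 := sum_prod_mul_symSum (fun i : Fin 4 → ι =>
      (if i 0 = i 1 then (1 : ℝ) else 0) * (if i 2 = i 3 then 1 else 0)) c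
  simp only [hq, mul_left_comm _ Λ, ← Finset.mul_sum] at h1
  rw [h2, expand, expand] at h1
  -- Both sides were symmetrized over the same four slots, so the factor 4! cancels.
  have h3 : ∑ i, ∑ j, ∑ k, ∑ l, c i * c j * c k * c l * quadForm R ![i, j, k, l] =
      Λ * ∑ i, ∑ j, ∑ k, ∑ l, c i * c j * c k * c l *
        ((if i = j then (1 : ℝ) else 0) * (if k = l then 1 else 0)) := by
    have h4 : ((Nat.factorial 4 : ℕ) : ℝ) ≠ 0 := by positivity
    refine mul_left_cancel₀ h4 ?_
    rw [← h1, mul_left_comm]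
    rfl
  have h4 : ∑ i, ∑ j, ∑ k, ∑ l, c i * c j * c k * c l *
        ((if i = j then (1 : ℝ) else 0) * (if k = l then 1 else 0)) = (∑ i, c i ^ 2) ^ 2 := by
    simp only [mul_ite, mul_one, mul_zero, Finset.sum_ite_eq, Finset.mem_univ, if_true]
    rw [pow_two, Finset.sum_mul_sum]
    refine Finset.sum_congr rfl fun i _ => ?_
    rw [Finset.sum_comm]
    refine Finset.sum_congr rfl fun k _ => ?_
    simp
    ring
  rw [← h4, ← h3]
  have h5 : ∀ i j k l, quadForm R ![i, j, k, l] = ∑ a, ∑ b, R a i j b * R b k l a :=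
    fun i j k l => rfl
  simp only [h5, Finset.mul_sum, Finset.sum_mul]
  refine (sum6_reindex (G := fun i j k l a b => c i * c j * c k * c l * (R a i j b * R b k l a))
    1 4 5 2 3 0 1 (by decide) fun X => (by ring)).trans (one_mul _)

end Polynomial

/-! ### The formula for |∇R|² in coordinates. -/

section Local

variable {m : ℕ} {U : Set (Euc m)} {G : Euc m → Euc m → Euc m → ℝ}

namespace IsMetricOn

variable (h : IsMetricOn U G) {z : Euc m} (hz : z ∈ U)
include h hz

theorem isAlgCurv_curvature (e : Fin m → Euc m) :
    IsAlgCurv fun a b c d => curvatureCoord G z (e a) (e b) (e c) (e d) where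
  skew_eq a b c d := by rw [neg_one_mul]; exact curvature_swap z _ _ _ _ (h.lin_left hz _)
  pair_eq a b c d := h.curvature_pair hz _ _ _ _
  bianchi a b c d := h.curvature_bianchi hz _ _ _ _

theorem isAlgCurv_nabla (e : Fin m → Euc m) (k : Fin m) :
    IsAlgCurv fun a b c d => nablaCurvatureCoord G z (e k) (e a) (e b) (e c) (e d) where
  skew_eq a b c d := by rw [neg_one_mul]; exact h.nabla_swap12 hz _ _ _ _ _
  pair_eq a b c d := h.nabla_pair hz _ _ _ _ _
  bianchi a b c d := h.nabla_cyclic hz _ _ _ _ _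

/-- On an Einstein manifold with `|R|²` constant, `|∇R|²` is a combination of the cubic
invariants of the curvature tensor. -/
theorem gradSq_eq {Λ c₀ : ℝ}
    (hE : ∀ y ∈ U, ∀ e, IsOrthonormalAt G y e → ∀ i j,
      ∑ a, curvatureCoord G y (e a) (e i) (e j) (e a) = if i = j then Λ else 0)
    (hC : ∀ y ∈ U, ∀ e, IsOrthonormalAt G y e →
      ∑ a, ∑ b, ∑ c, ∑ d, curvatureCoord G y (e a) (e b) (e c) (e d) ^ 2 = c₀)
    {e : Fin m → Euc m} (he : IsOrthonormalAt G z e) :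
    gradSq (fun k a b c d => nablaCurvatureCoord G z (e k) (e a) (e b) (e c) (e d)) +
      2 * Λ * c₀ + hatIdx (fun a b c d => curvatureCoord G z (e a) (e b) (e c) (e d))
      + 4 * ringIdx (fun a b c d => curvatureCoord G z (e a) (e b) (e c) (e d)) = 0 := by
  have hc := h.isConnectionOn
  have hT := h.isTensor4On_curvature
  have hN := hT.isTensor5On_nab4 hc
  have hlap := (h.isAlgCurv_curvature hz e).sum_laplacian (hE z hz e he)
    (S := fun x y a b c d => nab5 (christoffel G) (nablaCurvatureCoord G) z (e x) (e y) (e a)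
      (e b) (e c) (e d))
    (fun x y a b c d => nab5_cyclic (Γ := christoffel G) (N := nablaCurvatureCoord G) hN h.isOpen
      (fun _ hz => h.nabla_bianchi hz) hz _ _ _ _ _ _)
    (fun x y a b c d => nab5_swap12 (Γ := christoffel G) (N := nablaCurvatureCoord G) h.isOpen
      (fun _ hz => h.nabla_swap12 hz) hz _ _ _ _ _ _)
    (fun x b c d => h.nabla_divergence_eq_zero hE hz he _ _ _ _)
    (fun x y a b c d => by
      -- Expanding the curvature operator in the orthonormal frame turns the Ricci identity into its
      -- index form.
      have hop : ∀ a, connCurvature (christoffel G) z (e x) (e y) (e a) =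
          ∑ k, curvatureCoord G z (e x) (e y) (e a) (e k) • e k := fun a =>
        h.eq_sum_of_orthonormal hz he _
      refine (hT.ricci_identity hc hz (e x) (e y) (e a) (e b) (e c) (e d)).trans ?_
      rw [hop, hop, hop, hop, isLinearMap_sum (hT.lin1 z hz _ _ _),
        isLinearMap_sum (hT.lin2 z hz _ _ _), isLinearMap_sum (hT.lin3 z hz _ _ _),
        isLinearMap_sum (hT.lin4 z hz _ _ _)]
      simp only [smul_eq_mul, Finset.sum_add_distrib])
  -- Tracing the second derivative of |R|² over the frame gives |∇R|² + ⟨ΔR, R⟩ = 0.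
  have h2 : ∑ x, ∑ a, ∑ b, ∑ c, ∑ d,
      (nablaCurvatureCoord G z (e x) (e a) (e b) (e c) (e d) ^ 2
      + curvatureCoord G z (e a) (e b) (e c) (e d) *
        nab5 (christoffel G) (nablaCurvatureCoord G) z (e x) (e x) (e a) (e b) (e c) (e d)) = 0 :=
    Finset.sum_eq_zero fun x _ => h.second_derivative_normSq hC hz he (e x)
  simp only [Finset.sum_add_distrib] at h2
  have h3 : sqIdx (fun a b c d => curvatureCoord G z (e a) (e b) (e c) (e d)) = c₀ :=
    hC z hz e he
  rw [h3] at hlap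
  have h4 : gradSq (fun k a b c d => nablaCurvatureCoord G z (e k) (e a) (e b) (e c) (e d)) =
    ∑ x, ∑ a, ∑ b, ∑ c, ∑ d, nablaCurvatureCoord G z (e x) (e a) (e b) (e c) (e d) ^ 2 := rfl
  linarith

end IsMetricOn

end Local

/-! ### Orthonormal frames on the manifold, read in a chart. -/

section Manifold

variable {m : ℕ} {M : Type*} [TopologicalSpace M] [ChartedSpace (EuclideanSpace ℝ (Fin m)) M]
  [IsManifold (𝓡 m) ∞ M]
  {g : Bundle.ContMDiffRiemannianMetric (𝓡 m) ∞ (EuclideanSpace ℝ (Fin m))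
      (fun q : M => TangentSpace (𝓡 m) q)}

section Frame

variable {p : M} {e : Fin m → TangentSpace (𝓡 m) p}

theorem isOrthonormalAt_toChart (he : IsOrthonormalFrame g p e) :
    IsOrthonormalAt (metricInChart g p) (extChartAt (𝓡 m) p p) (fun i => toChart p (e i)) :=
  fun i j => (metricInChart_toChart p g (e i) (e j)).trans (he i j)

variable (g) in
theorem isAlgCurv_frame (e : Fin m → TangentSpace (𝓡 m) p) :
    IsAlgCurv fun a b c d => curvature g p (e a) (e b) (e c) (e d) :=
  (isMetricOn_metricInChart p g).isAlgCurv_curvature (mem_extChartAt_target p)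
    (fun i => toChart p (e i))

/-- The Jacobi operator in terms of the components of the vector in an orthonormal basis. -/
theorem curvature_expand (he : IsOrthonormalFrame g p e) (x : TangentSpace (𝓡 m) p)
    (a b : TangentSpace (𝓡 m) p) :
    curvature g p a x x b = ∑ i, ∑ j, g.inner p x (e i) * g.inner p x (e j) *
      curvature g p a (e i) (e j) b := by
  have hm := isMetricOn_metricInChart p g
  have hz := mem_extChartAt_target (I := 𝓡 m) p
  have hT := hm.isTensor4On_curvature
  have hx : toChart p x = ∑ k, g.inner p x (e k) • toChart p (e k) := by
    rw [hm.eq_sum_of_orthonormal hz (isOrthonormalAt_toChart he) (toChart p x)]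
    simp only [metricInChart_toChart]
  unfold curvature
  rw [hx, isLinearMap_sum (hT.lin2 _ hz _ _ _)]
  refine Finset.sum_congr rfl fun i _ => ?_
  rw [isLinearMap_sum (hT.lin3 _ hz _ _ _), Finset.smul_sum]
  refine Finset.sum_congr rfl fun j _ => ?_
  simp only [smul_eq_mul]
  ring

theorem inner_self_expand (he : IsOrthonormalFrame g p e) (x : TangentSpace (𝓡 m) p) :
    g.inner p x x = ∑ i, g.inner p x (e i) ^ 2 := by
  have hm := isMetricOn_metricInChart p g
  have hz := mem_extChartAt_target (I := 𝓡 m) p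
  have hx : toChart p x = ∑ k, g.inner p x (e k) • toChart p (e k) := by
    rw [hm.eq_sum_of_orthonormal hz (isOrthonormalAt_toChart he) (toChart p x)]
    simp only [metricInChart_toChart]
  rw [← metricInChart_toChart p g x x]
  conv_lhs => rw [hx]
  rw [isLinearMap_sum (hm.lin_left hz _)]
  refine Finset.sum_congr rfl fun i _ => ?_
  rw [← hx, metricInChart_toChart, g.symm, smul_eq_mul, pow_two]

end Frame

/-- A condition on the curvature tensor in all orthonormal bases of all tangent spaces can be
read in a chart. -/
theorem forall_chart_of_forall_frame {P : (Fin m → Fin m → Fin m → Fin m → ℝ) → Prop}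
    (hP : ∀ (p : M) (e : Fin m → TangentSpace (𝓡 m) p), IsOrthonormalFrame g p e →
      P fun a b c d => curvature g p (e a) (e b) (e c) (e d))
    (p : M) : ∀ y ∈ (extChartAt (𝓡 m) p).target, ∀ e,
      IsOrthonormalAt (metricInChart g p) y e →
      P fun a b c d => curvatureCoord (metricInChart g p) y (e a) (e b) (e c) (e d) := by
  intro y hy e he
  -- The differential of the inverse chart carries the frame to the manifold; it is orthonormal
  -- there because `metricInChart` is the pullback of `g` by definition.
  have := hP ((extChartAt (𝓡 m) p).symm y)
    (fun i => mfderiv 𝓘(ℝ, Euc m) (𝓡 m) (extChartAt (𝓡 m) p).symm y (e i)) he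
  simpa only [curvature_eq_curvatureCoord p g hy] using this

end Manifold

end AsymptoticHarmonic
end

/-! ### Proof of the five assertions. -/

theorem mainTheorem8 {m : ℕ} {M : Type*} [TopologicalSpace M]
    [ChartedSpace (EuclideanSpace ℝ (Fin m)) M] [IsManifold (𝓡 m) ∞ M]
    (g : Bundle.ContMDiffRiemannianMetric (𝓡 m) ∞ (EuclideanSpace ℝ (Fin m))
      (fun q : M => TangentSpace (𝓡 m) q))
    (hg : AsymptoticHarmonic.IsAsymptoticHarmonicUpToThree g) :
    AsymptoticHarmonic.IsTwoStein g ∧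
    AsymptoticHarmonic.IsConstantScalar g (fun p e => AsymptoticHarmonic.normSqR g p e) ∧
    AsymptoticHarmonic.IsConstantScalar g (fun p e =>
      AsymptoticHarmonic.normSqNablaR g p e + AsymptoticHarmonic.hatR g p e
        + 4 * AsymptoticHarmonic.ringR g p e) ∧
    AsymptoticHarmonic.IsConstantScalar g (fun p e =>
      27 * AsymptoticHarmonic.normSqNablaR g p e + 112 * AsymptoticHarmonic.hatR g p e
        - 32 * AsymptoticHarmonic.ringR g p e) ∧
    AsymptoticHarmonic.IsConstantScalar g (fun p e =>
      17 * AsymptoticHarmonic.hatR g p e - 28 * AsymptoticHarmonic.ringR g p e) := by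
  open AsymptoticHarmonic in
  obtain ⟨⟨Λ₁, h₁⟩, ⟨Λ₂, h₂⟩, ⟨Λ₃, h₃⟩⟩ := hg
  have hric : ∀ (p : M) (e : Fin m → TangentSpace (𝓡 m) p), IsOrthonormalFrame g p e →
      ∀ i j, ∑ a, curvature g p (e a) (e i) (e j) (e a) = if i = j then Λ₁ else 0 := by
    intro p e he i j
    rw [h₁ p e he i j, he i j]
    simp
  have hquad : ∀ (p : M) (e : Fin m → TangentSpace (𝓡 m) p), IsOrthonormalFrame g p e →
      ∀ i, symSum (quadForm fun a b c d => curvature g p (e a) (e b) (e c) (e d)) i =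
        Λ₂ * symSum (fun i : Fin 4 → Fin m =>
          (if i 0 = i 1 then 1 else 0) * (if i 2 = i 3 then 1 else 0)) i := by
    intro p e he i
    have he' : ∀ i j, g.inner p (e i) (e j) = if i = j then 1 else 0 := he
    have := h₂ p e he i
    simp only [he'] at this
    exact this
  -- `K₂` and `K₃` are the contracted right-hand sides of H₂ and H₃ without the constants. They
  -- depend on `m` only, so their values are not needed.
  set K₂ : ℝ := ∑ x : Fin m, ∑ y, symSum (fun i : Fin 4 → Fin m =>
    (if i 0 = i 1 then (1 : ℝ) else 0) * (if i 2 = i 3 then 1 else 0)) ![x, x, y, y]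
  set K₃ : ℝ := ∑ x : Fin m, ∑ y, ∑ z, symSum (fun i : Fin 6 → Fin m =>
    (if i 0 = i 1 then (1 : ℝ) else 0) * (if i 2 = i 3 then 1 else 0) *
      (if i 4 = i 5 then 1 else 0)) ![x, x, y, y, z, z]
  -- The solution |R|² of 8(mΛ₁² + 3/2 |R|²) = Λ₂K₂.
  set c₀ : ℝ := 2 / 3 * (Λ₂ * K₂ / 8 - m * Λ₁ ^ 2) with hc₀
  have hsq : ∀ (p : M) (e : Fin m → TangentSpace (𝓡 m) p), IsOrthonormalFrame g p e →
      sqIdx (fun a b c d => curvature g p (e a) (e b) (e c) (e d)) = c₀ := by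
    intro p e he
    have h := (isAlgCurv_frame g e).sum_symSum_quadForm (hric p e he)
    simp only [hquad p e he, ← Finset.mul_sum, Fintype.card_fin] at h
    rw [hc₀]
    linarith
  have hgrad : ∀ (p : M) (e : Fin m → TangentSpace (𝓡 m) p), IsOrthonormalFrame g p e →
      normSqNablaR g p e + 2 * Λ₁ * c₀ + hatR g p e + 4 * ringR g p e = 0 := by
    intro p e he
    -- The Einstein condition and |R|² = c₀ are needed on the whole chart domain, because they get
    -- differentiated.
    exact (isMetricOn_metricInChart p g).gradSq_eq (mem_extChartAt_target p)
      (forall_chart_of_forall_frame (g := g)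
        (P := fun R => ∀ i j, ∑ a, R a i j a = if i = j then Λ₁ else 0) hric p)
      (forall_chart_of_forall_frame (g := g) (P := fun R => sqIdx R = c₀) hsq p)
      (isOrthonormalAt_toChart he)
  have hcub : ∀ (p : M) (e : Fin m → TangentSpace (𝓡 m) p), IsOrthonormalFrame g p e →
      32 * (48 * (m * Λ₁ ^ 3 + 9 / 2 * Λ₁ * c₀ - 7 / 2 * hatR g p e + ringR g p e))
        - 9 * (48 * (3 * normSqNablaR g p e)) = Λ₃ * K₃ := by
    intro p e he
    have hm := isMetricOn_metricInChart p g
    have hz := mem_extChartAt_target (I := 𝓡 m) p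
    have hE := forall_chart_of_forall_frame (g := g)
        (P := fun R => ∀ i j, ∑ a, R a i j a = if i = j then Λ₁ else 0) hric p
    have he' : ∀ i j, g.inner p (e i) (e j) = if i = j then 1 else 0 := he
    have a1 := (isAlgCurv_frame g e).sum_symSum_cubicForm (hric p e he)
    have a2 := sum_symSum_gradForm (hm.isAlgCurv_nabla hz fun i => toChart p (e i))
      (fun x a b c d => hm.nabla_bianchi hz _ _ _ _ _)
      (fun k i j => hm.nabla_ricci_eq_zero hE hz (isOrthonormalAt_toChart he) _ i j)
      (fun b c d => hm.divergence_eq_zero hE hz (isOrthonormalAt_toChart he) b c d)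
    have a3 : ∀ i, 32 * symSum (cubicForm fun a b c d => curvature g p (e a) (e b) (e c) (e d)) i
        - 9 * symSum (gradForm fun k a b c d =>
          nablaCurvature g p (e k) (e a) (e b) (e c) (e d)) i =
        Λ₃ * symSum (fun i : Fin 6 → Fin m => (if i 0 = i 1 then (1 : ℝ) else 0) *
          (if i 2 = i 3 then 1 else 0) * (if i 4 = i 5 then 1 else 0)) i := by
      intro i
      have := h₃ p e he i
      simp only [he'] at this
      rw [← symSum_sub_smul]
      exact this
    have a4 : 32 * ∑ x, ∑ y, ∑ z,
          symSum (cubicForm fun a b c d => curvature g p (e a) (e b) (e c) (e d))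
            ![x, x, y, y, z, z]
        - 9 * ∑ x, ∑ y, ∑ z, symSum (gradForm fun k a b c d =>
          nablaCurvature g p (e k) (e a) (e b) (e c) (e d)) ![x, x, y, y, z, z] = Λ₃ * K₃ := by
      simp only [K₃, Finset.mul_sum, ← Finset.sum_sub_distrib, a3]
    rw [a1, hsq p e he, Fintype.card_fin] at a4
    rw [← a4]
    congr 2
    exact a2.symm
  -- The function `μ` is the constant Λ₂.
  refine ⟨⟨⟨Λ₁, fun p e he x => ?_⟩, fun _ => Λ₂, fun p e he x => ?_⟩, ⟨c₀, hsq⟩,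
    ⟨-(2 * Λ₁ * c₀), fun p e he => ?_⟩,
    ⟨32 * (m * Λ₁ ^ 3 + 9 / 2 * Λ₁ * c₀) - Λ₃ * K₃ / 48, fun p e he => ?_⟩,
    -- Assertion 4 minus 27 times assertion 3 reads 85R̂ − 140R̊ = 5(17R̂ − 28R̊), whence the
    -- division by 5.
    ⟨(32 * (m * Λ₁ ^ 3 + 9 / 2 * Λ₁ * c₀) - Λ₃ * K₃ / 48 + 27 * (2 * Λ₁ * c₀)) / 5,
      fun p e he => ?_⟩⟩
  · rw [inner_self_expand he x]
    simp only [curvature_expand he x]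
    rw [Finset.sum_comm]
    have : ∀ i, ∑ a, ∑ j, g.inner p x (e i) * g.inner p x (e j) *
        curvature g p (e a) (e i) (e j) (e a) = Λ₁ * g.inner p x (e i) ^ 2 := by
      intro i
      rw [Finset.sum_comm]
      simp only [← Finset.mul_sum, hric p e he, mul_ite, mul_zero, Finset.sum_ite_eq,
        Finset.mem_univ, if_true]
      ring
    simp only [this, Finset.mul_sum]
  · rw [inner_self_expand he x]
    simp only [curvature_expand he x]
    exact quadForm_polynomial (hquad p e he) fun i => g.inner p x (e i)
  · linarith [hgrad p e he]
  · linarith [hcub p e he]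
  · linarith [hgrad p e he, hcub p e he]
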